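/- **Setting.** Let $D_1,\dots,D_k$ be unknown distributions on $[n]$ and $\varepsilon\in(0,1]$. Assume there is a hidden partition of $[k]$ into two non-empty clusters $\mathcal I_1,\mathcal I_2$ such that $D_a=D_b$ for $a,b$ in the same cluster and $d_{\mathrm{TV}}(D_a,D_b)=\frac12\sum_{x\in[n]}|D_a(x)-D_b(x)|\ge\varepsilon$ for $a,b$ in different clusters; both cluster distributions are unknown. Let $r=\min(|\mathcal I_1|,|\mathcal I_2|)$. An algorithm is randomized, knows $n,k,\varepsilon$, draws samples from the $D_i$ adaptively, and outputs a partition of $[k]$. **Two-stage algorithm** (which also knows $r$). *Stage 1 (Find-One-Unknown).* Choose a uniformly random subset of $\min(\lceil 9k/r\rceil,k)$ indices. Together with a fixed reference index, say $1$, they form $m$ indices. Put $s_1=\min\big(n,(nm/\varepsilon^2)^{2/3}\big)$, $\delta'=\frac1{30m}$, $b=\sqrt{30/s_1}$ and $s_2=\lceil C_1 n s_1^{-1/2}\log(1/\delta')/\varepsilon^2\rceil$. Draw $s\sim\mathrm{Poi}(s_1)$ and abort if $s>2s_1$. Draw a multiset $\mathcal S$ of $s$ samples from $D_1$. For $i\in[k]$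 let $D_{i,\mathcal S}$ be the flattened distribution: each $x\in[n]$ is split into as many equally likely copies as one plus the multiplicity of $x$ in $\mathcal S$. For each of the other $m-1$ indices $i$ in turn, apply an equivalence test with parameters $\varepsilon,\delta',b$ to $s_2$ fresh samples from each of $D_{1,\mathcal S}$ and $D_{i,\mathcal S}$, and stop at the first $i=j$ that is declared different. *Stage 2 (MultiLFHT).* Draw $\lceil C_2T\rceil$ samples from each of $D_1$ and $D_j$, and $\lceil C_2T/k\rceil$ samples from each other $D_i$. Classify each such $D_i$ as $D_1$ or $D_j$ by a likelihood-free hypothesis test with parameters $\varepsilon$ and $\frac1{9k}$. Here $T$ is $\big(\frac{n^2k\log k}{\varepsilon^4}\big)^{1/3}$ if $n\ge\frac{k\log k}{\varepsilon^4}$, $\frac{\sqrt{nk\log k}}{\varepsilon^2}$ if $k\log k\le n<\frac{k\log k}{\varepsilon^4}$, and $\frac{k\log k}{\varepsilon^2}$ if $n<k\log k$. (If Stage 1 found no $j$, output a trivial partition.) **Theorem.** There are an equivalence-test decision rule, a likelihood-free hypothesis-test decision rule and universal constants $C_1,C_2>0$ for which the two-stage algorithm outputs the true partition $\{\mathcal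 I_1,\mathcal I_2\}$ with probability at least $2/3$. The total number of samples it draws is always at most $$O\left(\max\left(\left(\tfrac{nk}{r\varepsilon^2}\right)^{2/3},\tfrac{k\sqrt n}{r\varepsilon^2}\right)\log k+T_2\right),\qquad T_2=\begin{cases}\left(\frac{n^2k\log k}{\varepsilon^4}\right)^{1/3}& n\gtrsim\frac{k\log k}{\varepsilon^4},\\[1ex] \frac{\sqrt{nk\log k}}{\varepsilon^2}& k\log k\lesssim n\lesssim\frac{k\log k}{\varepsilon^4},\\[1ex] \frac{k\log k}{\varepsilon^2}& n\lesssim k\log k.\end{cases}$$ The constant in $O(\cdot)$ depends only on the constants in $\lesssim,\gtrsim$, which may be any positive numbers. Moreover, knowledge of $r$ is not needed: there is an algorithm that knows only $n,k,\varepsilon$ and that, with probability at least $2/3$, outputs the true partition and draws a number of samples obeying the same bound. -/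

import Mathlib

open scoped ENNReal NNReal

namespace TwoClustering

noncomputable section

/-! ### Distributions and the clustering promise -/

/-- Total variation distance of two distributions on `[n]`. -/
def tv {n : ℕ} (P Q : PMF (Fin n)) : ℝ :=
  (1 / 2) * ∑ x, |(P x).toReal - (Q x).toReal|

/-- `{I, Iᶜ}` is a hidden partition of the `k` distributions `D` into two non-empty clusters:
distributions in the same cluster are equal, and distributions in different clusters are at
total variation distance at least `ε`. -/
structure IsHiddenPartition {k n : ℕ} (ε : ℝ) (D : Fin k → PMF (Fin n))
    (I : Finset (Fin k)) : Prop where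
  nonempty : I.Nonempty
  nonempty_compl : Iᶜ.Nonempty
  eq_of_mem : ∀ a ∈ I, ∀ b ∈ I, D a = D b
  eq_of_mem_compl : ∀ a ∈ Iᶜ, ∀ b ∈ Iᶜ, D a = D b
  le_tv : ∀ a ∈ I, ∀ b ∈ Iᶜ, ε ≤ tv (D a) (D b)

/-- The size of the smaller of the two clusters `I` and `Iᶜ`. -/
def smallerSize {k : ℕ} (I : Finset (Fin k)) : ℕ := min I.card Iᶜ.card

/-! ### Adaptive randomized sampling algorithms -/

/-- An adaptive randomized algorithm with sample access to `k` distributions over `[n]` and output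
in `α`: it stops with an output, or draws a sample from the distribution of its choice, or uses
internal randomness; in the last two cases it continues according to the outcome. -/
inductive SampleAlg (k n : ℕ) (α : Type) : Type 1
  | ret (a : α) : SampleAlg k n α
  | query (i : Fin k) (next : Fin n → SampleAlg k n α) : SampleAlg k n α
  | random {β : Type} (μ : PMF β) (next : β → SampleAlg k n α) : SampleAlg k n α

namespace SampleAlg

variable {k n : ℕ} {α β : Type}

/-- Sequential composition. -/
def bind : SampleAlg k n α → (α → SampleAlg k n β) → SampleAlg k n β
  | ret a, f => f a
  | query i next, f => query i fun x => (next x).bind f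
  | random μ next, f => random μ fun x => (next x).bind f

instance : Monad (SampleAlg k n) where
  pure := ret
  bind := bind

/-- Draw one sample from the `i`-th distribution. -/
def draw (i : Fin k) : SampleAlg k n (Fin n) := query i ret

/-- Draw a value from a known distribution, at no cost in samples. -/
def rand (μ : PMF α) : SampleAlg k n α := random μ ret

/-- Run `A` independently `s` times and collect the results. -/
def iid (A : SampleAlg k n α) : (s : ℕ) → SampleAlg k n (Fin s → α)
  | 0 => pure Fin.elim0
  | s + 1 => do
    let x ← A
    let xs ← iid A s
    pure (Fin.cons x xs)

/-- The joint law of the output of the algorithm and of the number of samples that it draws,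
when the `k` distributions are `D`. -/
def run (D : Fin k → PMF (Fin n)) : SampleAlg k n α → PMF (α × ℕ)
  | ret a => PMF.pure (a, 0)
  | query i next => (D i).bind fun x => (run D (next x)).map fun p => (p.1, p.2 + 1)
  | random μ next => μ.bind fun x => run D (next x)

/-- The probability that the pair (output, number of samples drawn) satisfies `E`. -/
def prob (A : SampleAlg k n α) (D : Fin k → PMF (Fin n)) (E : α → ℕ → Prop) : ℝ≥0∞ :=
  (A.run D).toOuterMeasure {p | E p.1 p.2}

end SampleAlg

open SampleAlg

/-! ### The subroutines used as black boxes -/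

/-- A decision rule for equivalence testing of two distributions on a finite domain `α`. Its
arguments are the distance `ε`, the error probability `δ`, the bound `b` on an `ℓ²` norm, and `s`
samples from each of the two distributions. The answer `true` means "at distance at least `ε`",
`false` means "identical". -/
abbrev EquivalenceTest : Type 1 :=
  ∀ (α : Type) [Fintype α], (ε δ b : ℝ) → (s : ℕ) → (Fin s → α) → (Fin s → α) → PMF Bool

/-- A decision rule for likelihood-free hypothesis testing over `[n]`. Its arguments are the
distance `ε`, the error probability `δ`, `s₁` samples from each of `P` and `Q`, and `s₂` samples
from the distribution to be classified. The answer `true` means `P`, `false` means `Q`. -/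
abbrev LFHTest : Type :=
  ∀ n : ℕ, (ε δ : ℝ) → (s₁ s₂ : ℕ) →
    (Fin s₁ → Fin n) → (Fin s₁ → Fin n) → (Fin s₂ → Fin n) → PMF Bool

/-! ### Stage 1: Find-One-Unknown -/

/-- The expanded domain of the flattening by the multiset `S` of samples: the element `x` is split
into as many copies as one plus the multiplicity of `x` in `S`. -/
abbrev Flat {n s : ℕ} (S : Fin s → Fin n) : Type :=
  Σ x : Fin n, Fin ((Finset.univ.filter fun t => S t = x).card + 1)

/-- Draw one sample from the flattened distribution `D_{i,S}`: draw `x` from `D_i`, then one of the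
copies of `x` uniformly at random. -/
def drawFlat {k n s : ℕ} (S : Fin s → Fin n) (i : Fin k) : SampleAlg k n (Flat S) := do
  let x ← draw i
  let j ← rand (PMF.uniformOfFintype (Fin ((Finset.univ.filter fun t => S t = x).card + 1)))
  pure ⟨x, j⟩

/-- Apply `test` to the listed distributions in turn, and return the first one on which the answer
is `true`, if there is one. -/
def firstDifferent {k n : ℕ} (test : Fin k → SampleAlg k n Bool) :
    List (Fin k) → SampleAlg k n (Option (Fin k))
  | [] => pure none
  | i :: l => do
    let b ← test i
    if b then pure (some i) else firstDifferent test l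

/-- The mean number `s₁ = min (n, (n m / ε²)^{2/3})` of samples used for flattening. -/
def sketchSize (n m : ℕ) (ε : ℝ) : ℝ :=
  min (n : ℝ) ((n * m / ε ^ 2) ^ (2 / 3 : ℝ))

/-- Find-One-Unknown on the `m` distributions formed by the reference `a₁` and `arms`: looks for
an index whose distribution differs from that of `a₁`. The result `none` stands for the answer
"all identical", and for the abortion when the Poisson variable is too large. -/
def findOneUnknown (test : EquivalenceTest) (C : ℝ) {k n : ℕ} (ε : ℝ) (a₁ : Fin k)
    (arms : List (Fin k)) : SampleAlg k n (Option (Fin k)) := do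
  let m : ℕ := arms.length + 1
  let s₁ : ℝ := sketchSize n m ε
  let δ : ℝ := 1 / (30 * m)
  let b : ℝ := √(30 / s₁)
  let s₂ : ℕ := ⌈C * n * s₁ ^ (-(1 / 2) : ℝ) * Real.log (1 / δ) / ε ^ 2⌉₊
  let s ← rand (ProbabilityTheory.poissonMeasure s₁.toNNReal).toPMF
  if 2 * s₁ < s then
    pure none
  else do
    let S ← iid (draw a₁) s
    firstDifferent (fun i => do
      let X ← iid (drawFlat S a₁) s₂
      let Y ← iid (drawFlat S i) s₂
      rand (test (Flat S) ε δ b s₂ X Y)) arms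

/-! ### Stage 2: MultiLFHT -/

/-- Apply `test` to the listed distributions, and return the set of those with answer `true`. -/
def classify {k n : ℕ} (test : Fin k → SampleAlg k n Bool) :
    List (Fin k) → SampleAlg k n (Finset (Fin k))
  | [] => pure ∅
  | i :: l => do
    let b ← test i
    let χ ← classify test l
    pure (if b then insert i χ else χ)

/-- `(n² k log k / ε⁴)^{1/3}`. -/
def costLarge (n k : ℕ) (ε : ℝ) : ℝ :=
  ((n : ℝ) ^ 2 * k * Real.log k / ε ^ 4) ^ (1 / 3 : ℝ)

/-- `√(n k log k) / ε²`. -/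
def costMid (n k : ℕ) (ε : ℝ) : ℝ :=
  √(n * k * Real.log k) / ε ^ 2

/-- `k log k / ε²`. -/
def costSmall (k : ℕ) (ε : ℝ) : ℝ :=
  k * Real.log k / ε ^ 2

/-- The order of the number of samples that MultiLFHT takes from each of the two exemplars,
according to the regime of `n`; each distribution to be classified is sampled `1 / k` times as
often. -/
def lfhtSize (n k : ℕ) (ε : ℝ) : ℝ :=
  if k * Real.log k / ε ^ 4 ≤ n then costLarge n k ε
  else if k * Real.log k ≤ n then costMid n k ε
  else costSmall k ε

/-- MultiLFHT with the exemplars `a₁` and `a₂` of the two clusters: the other `k - 2` distributions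
are classified one by one by the rule `lfht`, with error probability `1 / (9 k)` each, where the
samples from the exemplars are shared. The output is the resulting partition. -/
def multiLFHT (lfht : LFHTest) (C : ℝ) {k n : ℕ} (ε : ℝ) (a₁ a₂ : Fin k) :
    SampleAlg k n (Finset (Finset (Fin k))) := do
  let s₁ : ℕ := ⌈C * lfhtSize n k ε⌉₊
  let s₂ : ℕ := ⌈C * lfhtSize n k ε / k⌉₊
  let X ← iid (draw a₁) s₁
  let Y ← iid (draw a₂) s₁
  let χ ← classify (fun i => do
    let Z ← iid (draw i) s₂
    rand (lfht n ε (1 / (9 * k)) s₁ s₂ X Y Z)) ((Finset.univ.erase a₁).erase a₂).toList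
  pure {insert a₁ χ, (insert a₁ χ)ᶜ}

/-! ### The two-stage algorithm -/

/-- The number of distributions subsampled in Stage 1: `⌈9 k / r⌉`, or all `k` if this is more. -/
def subsetSize (k r : ℕ) : ℕ := min ⌈(9 * k / r : ℝ)⌉₊ k

/-- The uniform law on the sets of `subsetSize k r` of the `k` indices. -/
def randomSubset (k r : ℕ) : PMF (Finset (Fin k)) :=
  PMF.uniformOfFinset (Finset.powersetCard (subsetSize k r) Finset.univ)
    (Finset.powersetCard_nonempty.2 (by simp [subsetSize]))

/-- The two-stage algorithm for smaller cluster size `r`: Find-One-Unknown on the reference `a₁`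
and a random subset of the distributions, followed by MultiLFHT with `a₁` and the index found.
If no index is found, the output is a trivial one. -/
def twoStage (test : EquivalenceTest) (lfht : LFHTest) (C₁ C₂ : ℝ) {k n : ℕ} (r : ℕ) (ε : ℝ)
    (a₁ : Fin k) : SampleAlg k n (Finset (Finset (Fin k))) := do
  let J ← rand (randomSubset k r)
  let found ← findOneUnknown test C₁ ε a₁ (J.erase a₁).toList
  match found with
  | none => pure {Finset.univ, ∅}
  | some a₂ => multiLFHT lfht C₂ ε a₁ a₂

/-! ### The sample complexity -/

/-- `max ((n k / (r ε²))^{2/3}, k √n / (r ε²)) · log k`. -/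
def costFind (n k r : ℕ) (ε : ℝ) : ℝ :=
  max ((n * k / (r * ε ^ 2) : ℝ) ^ (2 / 3 : ℝ)) (k * √n / (r * ε ^ 2)) * Real.log k

/-- The number `N` of samples obeys the bounds of the three regimes of `n`. Here `c` is the constant
hidden in the conditions `≳`, `≲` on `n`, and `C` the constant hidden in `O(·)`. -/
structure SampleBound (c C : ℝ) (n k r : ℕ) (ε : ℝ) (N : ℕ) : Prop where
  large : c * (k * Real.log k / ε ^ 4) ≤ n →
    N ≤ C * (costFind n k r ε + costLarge n k ε)
  mid : c * (k * Real.log k) ≤ n → c * n ≤ k * Real.log k / ε ^ 4 →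
    N ≤ C * (costFind n k r ε + costMid n k ε)
  small : c * n ≤ k * Real.log k →
    N ≤ C * (costFind n k r ε + costSmall k ε)

end

end TwoClustering

open TwoClustering

/-! Both tests learn a linear score from some samples and evaluate it on fresh ones. Given the
score, Chebyshev's inequality bounds the error of one block, and a vote over order `log (1/δ)`
blocks brings the error down to `δ ^ 3` (`pow_votes_le`, `avg_blockCount_le`).

Equivalence test: the score of a block is the difference of the two histograms on its first half.
Between equal distributions, exchanging the two samples flips the sign on the second half, so a
positive value has probability at most 1/2 (`avg_blockPositive_le_half`). Otherwise the sign is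
positive with high probability once `h * N` is large against the ℓ² norm of one distribution and `h
^ 2 * N` is large, where `N` is the squared ℓ² distance and `2 * h` the block length
(`avg_not_blockPositive_le_of_norm`). Flattening keeps total variation, and hence `N ≥ ε²/n`, while
it lowers the expected squared norm of the reference to at most `1/(s+1)` (`avg_inv_count_le`,
`sum_drawFlat_sq`).

Likelihood-free test: the histogram difference is weighted by the inverse of one plus the
multiplicity in a separate sample, which damps the heavy elements (`avg_not_goodWeight_le`). With
`s` exemplar samples per role and `h` samples per vote, a vote is reliable once `s h ε² ≳ n + s` and
`s² h ε⁴ ≳ n (n + s)` (`avg_histScore_event_le`). For `s ≈ T` and `h ≈ T/(k log k)` this asks that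
`T` exceed each of the three costs, and `lfhtSize` is their maximum (`le_lfhtSize`). The exemplar
samples are shared by all classifications: by Markov's inequality they are typically good for both
clusters at once, and the union bound runs over the fresh samples only (`pr_multiLFHT_le`).

For unknown `r`, Stage 1 is run with the guesses `2 ^ i`, from large to small, until it finds an
index. Its costs grow geometrically, so the guess of order `r` dominates. Since the tests err with
probability `δ ^ 3`, the false discoveries at guess `2 ^ i` have probability at most `2 ^ i / (27000
k)`, which sums to a small constant over all guesses, with no assumption on the guess
(`pr_search_fail_le`).

Failure budget: 25/96 for the Poisson abortion, 1/1000 for a bad flattening, 1/54000 for the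
equivalence tests, 1/512 for a subset missing the other cluster, 1/100 for Stage 2, and 1/13500 for
early false discoveries in the search. -/

namespace TwoClustering

open SampleAlg

noncomputable section

/-! ### Probabilities of events as real numbers -/

/-- The probability of an event under a `PMF`, as a real number. -/
def pr {α : Type*} (μ : PMF α) (E : α → Prop) : ℝ := (μ.toOuterMeasure {a | E a}).toReal

section pr

variable {α β : Type*}

lemma toOuterMeasure_ne_top (μ : PMF α) (s : Set α) : μ.toOuterMeasure s ≠ ∞ := by
  rw [PMF.toOuterMeasure_apply]; exact μ.tsum_coe_indicator_ne_top s

lemma toOuterMeasure_le_one (μ : PMF α) (s : Set α) : μ.toOuterMeasure s ≤ 1 := by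
  rw [PMF.toOuterMeasure_apply, ← μ.tsum_coe]
  exact ENNReal.tsum_le_tsum fun a => Set.indicator_le_self' (fun _ _ => zero_le) a

lemma pr_nonneg (μ : PMF α) (E : α → Prop) : 0 ≤ pr μ E := ENNReal.toReal_nonneg

lemma pr_le_one (μ : PMF α) (E : α → Prop) : pr μ E ≤ 1 :=
  ENNReal.toReal_le_of_le_ofReal zero_le_one (by simpa using toOuterMeasure_le_one μ _)

lemma pr_mono {μ : PMF α} {E F : α → Prop} (h : ∀ a ∈ μ.support, E a → F a) : pr μ E ≤ pr μ F :=
  ENNReal.toReal_mono (toOuterMeasure_ne_top _ _)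
    (PMF.toOuterMeasure_mono _ fun a ha => h a ha.2 ha.1)

lemma pr_eq_zero {μ : PMF α} {E : α → Prop} (h : ∀ a ∈ μ.support, ¬ E a) : pr μ E = 0 := by
  have : μ.toOuterMeasure {a | E a} = 0 := by
    rw [PMF.toOuterMeasure_apply_eq_zero_iff, Set.disjoint_left]
    exact h
  simp [pr, this]

lemma pr_map (μ : PMF α) (f : α → β) (E : β → Prop) :
    pr (μ.map f) E = pr μ (fun a => E (f a)) := by
  simp [pr, PMF.toOuterMeasure_map_apply]

lemma pr_pure_of_not {a : α} {E : α → Prop} (h : ¬ E a) : pr (PMF.pure a) E = 0 :=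
  pr_eq_zero fun b hb => by rw [PMF.mem_support_pure_iff] at hb; rwa [hb]

open Classical in
lemma pr_pure (a : α) (E : α → Prop) : pr (PMF.pure a) E = if E a then 1 else 0 := by
  rw [pr, PMF.toOuterMeasure_pure_apply]
  by_cases h : E a <;> simp [h]

lemma pr_eq_tsum_indicator (μ : PMF α) (E : α → Prop) :
    pr μ E = ∑' a, {a | E a}.indicator (fun a => (μ a).toReal) a := by
  rw [pr, PMF.toOuterMeasure_apply, ENNReal.tsum_toReal_eq]
  · refine tsum_congr fun a => ?_
    by_cases h : E a <;> simp [Set.indicator, h]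
  · intro a
    by_cases h : E a <;> simp [Set.indicator, h, μ.apply_ne_top]

lemma pr_bind_eq_tsum (μ : PMF α) (f : α → PMF β) (E : β → Prop) :
    pr (μ.bind f) E = ∑' a, (μ a).toReal * pr (f a) E := by
  rw [pr, PMF.toOuterMeasure_bind_apply, ENNReal.tsum_toReal_eq]
  · simp [pr, ENNReal.toReal_mul]
  · exact fun a => ENNReal.mul_ne_top (μ.apply_ne_top a) (toOuterMeasure_ne_top _ _)

lemma summable_toReal (μ : PMF α) : Summable fun a => (μ a).toReal :=
  ENNReal.summable_toReal μ.tsum_coe_ne_top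

lemma tsum_toReal (μ : PMF α) : ∑' a, (μ a).toReal = 1 := by
  rw [← ENNReal.tsum_toReal_eq fun a => μ.apply_ne_top a, μ.tsum_coe]; rfl

lemma sum_toReal [Fintype α] (μ : PMF α) : ∑ a, (μ a).toReal = 1 := by
  rw [← tsum_toReal μ, tsum_fintype]

lemma summable_toReal_mul_pr (μ : PMF α) (f : α → PMF β) (E : β → Prop) :
    Summable fun a => (μ a).toReal * pr (f a) E :=
  (summable_toReal μ).of_nonneg_of_le
    (fun _ => mul_nonneg ENNReal.toReal_nonneg (pr_nonneg _ _))
    (fun _ => mul_le_of_le_one_right ENNReal.toReal_nonneg (pr_le_one _ _))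

lemma pr_bind_eq_sum [Fintype α] (μ : PMF α) (f : α → PMF β) (E : β → Prop) :
    pr (μ.bind f) E = ∑ a, (μ a).toReal * pr (f a) E := by
  rw [pr_bind_eq_tsum, tsum_fintype]

/-- Needed for the Poisson number of flattening samples, where the bound on the failure depends on
the value drawn. -/
lemma pr_bind_le_tsum {μ : PMF α} {f : α → PMF β} {E : β → Prop} {g : α → ℝ} {c : ℝ}
    (hg : ∀ a, pr (f a) E ≤ g a) (hs : HasSum (fun a => (μ a).toReal * g a) c) :
    pr (μ.bind f) E ≤ c := by
  rw [pr_bind_eq_tsum, ← hs.tsum_eq]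
  exact (summable_toReal_mul_pr μ f E).tsum_le_tsum
    (fun a => mul_le_mul_of_nonneg_left (hg a) ENNReal.toReal_nonneg) hs.summable

/-- The law of total probability as a union bound. -/
lemma pr_bind_le {μ : PMF α} {f : α → PMF β} {E : β → Prop} (G : α → Prop) {c : ℝ} (hc : 0 ≤ c)
    (h : ∀ a ∈ μ.support, ¬ G a → pr (f a) E ≤ c) : pr (μ.bind f) E ≤ pr μ G + c := by
  rw [pr_bind_eq_tsum, pr_eq_tsum_indicator, ← one_mul c, ← tsum_toReal μ, ← tsum_mul_right]
  have h1 : Summable fun a => {a | G a}.indicator (fun a => (μ a).toReal) a :=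
    (summable_toReal μ).indicator _
  have h2 : Summable fun a => (μ a).toReal * c := (summable_toReal μ).mul_right c
  rw [← h1.tsum_add h2]
  refine (summable_toReal_mul_pr μ f E).tsum_le_tsum (fun a => ?_) (h1.add h2)
  by_cases ha : a ∈ μ.support
  · by_cases hG : G a
    · simp only [Set.indicator, Set.mem_ofPred_eq, hG, if_true]
      have := mul_le_of_le_one_right (ENNReal.toReal_nonneg (a := μ a)) (pr_le_one (f a) E)
      have := mul_nonneg (ENNReal.toReal_nonneg (a := μ a)) hc
      linarith
    · simp only [Set.indicator, Set.mem_ofPred_eq, hG, if_false, zero_add]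
      exact mul_le_mul_of_nonneg_left (h a ha hG) ENNReal.toReal_nonneg
  · have : μ a = 0 := by simpa [PMF.mem_support_iff] using ha
    simp [this, Set.indicator]

lemma pr_bind_le_const {μ : PMF α} {f : α → PMF β} {E : β → Prop} {c : ℝ} (hc : 0 ≤ c)
    (h : ∀ a ∈ μ.support, pr (f a) E ≤ c) : pr (μ.bind f) E ≤ c := by
  have := pr_bind_le (μ := μ) (f := f) (E := E) (fun _ => False) hc fun a ha _ => h a ha
  rwa [pr_eq_zero (E := fun _ => False) (fun _ _ => id), zero_add] at this

lemma pr_not (μ : PMF α) (E : α → Prop) : pr μ (fun a => ¬ E a) = 1 - pr μ E := by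
  rw [pr_eq_tsum_indicator, pr_eq_tsum_indicator, eq_sub_iff_add_eq,
    ← ((summable_toReal μ).indicator _).tsum_add ((summable_toReal μ).indicator _),
    ← tsum_toReal μ]
  refine tsum_congr fun a => ?_
  by_cases h : E a <;> simp [Set.indicator, h]

lemma ofReal_le_toOuterMeasure {μ : PMF α} {E : α → Prop} {c : ℝ}
    (h : pr μ (fun a => ¬ E a) ≤ 1 - c) : ENNReal.ofReal c ≤ μ.toOuterMeasure {a | E a} := by
  rw [pr_not] at h
  exact ENNReal.ofReal_le_of_le_toReal (by unfold pr at h; linarith)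

end pr

/-! ### The laws of sampling algorithms -/

/-- The law of the output of an algorithm. -/
def law {k n : ℕ} {α : Type} (D : Fin k → PMF (Fin n)) (A : SampleAlg k n α) : PMF α :=
  (A.run D).map Prod.fst

/-- The law of `s` independent samples. -/
def iidPMF {α : Type} (μ : PMF α) : (s : ℕ) → PMF (Fin s → α)
  | 0 => PMF.pure Fin.elim0
  | s + 1 => μ.bind fun x => (iidPMF μ s).bind fun xs => PMF.pure (Fin.cons x xs)

/-- The algorithm never draws more than `N` samples. -/
def CostLE {k n : ℕ} {α : Type} (D : Fin k → PMF (Fin n)) (A : SampleAlg k n α) (N : ℕ) : Prop :=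
  ∀ p ∈ (A.run D).support, p.2 ≤ N

section law

variable {k n : ℕ} {α β : Type} {D : Fin k → PMF (Fin n)}

lemma monad_bind_eq (A : SampleAlg k n α) (f : α → SampleAlg k n β) : (A >>= f) = A.bind f := rfl

lemma monad_pure_eq (a : α) : (pure a : SampleAlg k n α) = .ret a := rfl

lemma run_bind (A : SampleAlg k n α) (f : α → SampleAlg k n β) :
    (A.bind f).run D =
      (A.run D).bind fun p => ((f p.1).run D).map fun q => (q.1, p.2 + q.2) := by
  induction A with
  | ret a =>
    simp only [SampleAlg.bind, SampleAlg.run, PMF.pure_bind, zero_add, Prod.mk.eta]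
    exact (PMF.map_id _).symm
  | query i next ih =>
    simp only [SampleAlg.bind, SampleAlg.run, ih, PMF.map_bind, PMF.bind_bind, PMF.bind_map,
      PMF.map_comp]
    congr 1; funext x; congr 1; funext p
    simp only [Function.comp_def]
    congr 1; funext q; simp [add_right_comm]
  | random μ next ih => simp only [SampleAlg.bind, SampleAlg.run, ih, PMF.bind_bind]

lemma law_bind (A : SampleAlg k n α) (f : α → SampleAlg k n β) :
    law D (A.bind f) = (law D A).bind fun a => law D (f a) := by
  simp only [law, run_bind, PMF.map_bind, PMF.map_comp, PMF.bind_map, Function.comp_def]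

lemma law_ret (a : α) : law D (.ret a) = PMF.pure a := by simp [law, SampleAlg.run, PMF.pure_map]

lemma law_rand (μ : PMF α) : law D (rand μ) = μ := by
  simp [law, rand, SampleAlg.run, PMF.map_bind, PMF.pure_map]

lemma law_draw (i : Fin k) : law D (draw i) = D i := by
  simp [law, draw, SampleAlg.run, PMF.map_bind, PMF.pure_map]

lemma law_iid (A : SampleAlg k n α) (s : ℕ) : law D (iid A s) = iidPMF (law D A) s := by
  induction s with
  | zero => simp [iid, iidPMF, monad_pure_eq, law_ret]
  | succ s ih => simp [iid, iidPMF, monad_pure_eq, monad_bind_eq, law_bind, law_ret, ih]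

lemma pr_law (A : SampleAlg k n α) (E : α → Prop) :
    pr (law D A) E = pr (A.run D) fun p => E p.1 := by rw [law, pr_map]

lemma mem_support_law {A : SampleAlg k n α} {a : α} :
    a ∈ (law D A).support ↔ ∃ N, (a, N) ∈ (A.run D).support := by
  simp [law]

lemma costLE_ret (a : α) (N : ℕ) : CostLE D (.ret a) N := by
  intro p hp
  simp only [SampleAlg.run, PMF.mem_support_pure_iff] at hp
  simp [hp]

lemma CostLE.mono {A : SampleAlg k n α} {M N : ℕ} (h : CostLE D A M) (hMN : M ≤ N) :
    CostLE D A N := fun p hp => (h p hp).trans hMN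

lemma CostLE.bind {A : SampleAlg k n α} {f : α → SampleAlg k n β} {M N : ℕ} (hA : CostLE D A M)
    (hf : ∀ a ∈ (law D A).support, CostLE D (f a) N) : CostLE D (A.bind f) (M + N) := by
  intro p hp
  rw [run_bind, PMF.mem_support_bind_iff] at hp
  obtain ⟨q, hq, hp⟩ := hp
  rw [PMF.mem_support_map_iff] at hp
  obtain ⟨r, hr, rfl⟩ := hp
  exact add_le_add (hA q hq) (hf q.1 (mem_support_law.2 ⟨q.2, hq⟩) r hr)

lemma costLE_rand (μ : PMF α) : CostLE D (rand μ) 0 := by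
  intro p hp
  simp only [rand, SampleAlg.run, PMF.mem_support_bind_iff, PMF.mem_support_pure_iff] at hp
  obtain ⟨x, -, rfl⟩ := hp
  simp

lemma costLE_rand_bind {μ : PMF α} {f : α → SampleAlg k n β} {N : ℕ}
    (hf : ∀ a ∈ μ.support, CostLE D (f a) N) : CostLE D ((rand μ).bind f) N := by
  have := (costLE_rand (D := D) μ).bind (f := f) (N := N) (by rwa [law_rand])
  rwa [zero_add] at this

lemma costLE_draw (i : Fin k) : CostLE D (draw i) 1 := by
  intro p hp
  simp only [draw, SampleAlg.run, PMF.mem_support_bind_iff, PMF.mem_support_map_iff,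
    PMF.mem_support_pure_iff] at hp
  obtain ⟨x, -, q, rfl, rfl⟩ := hp
  simp

lemma costLE_iid {A : SampleAlg k n α} {N : ℕ} (hA : CostLE D A N) (s : ℕ) :
    CostLE D (iid A s) (s * N) := by
  induction s with
  | zero => exact costLE_ret _ _
  | succ s ih =>
    rw [add_mul, one_mul, add_comm (s * N)]
    exact hA.bind fun x _ => ih.bind (N := 0) fun xs _ => costLE_ret _ _

end law

/-! ### Expectations over lists of independent samples -/

/-- The expectation of `F` over lists of `s` independent samples with weights `p`. -/
def avg {α : Type*} [Fintype α] (p : α → ℝ) : ℕ → (List α → ℝ) → ℝ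
  | 0, F => F []
  | s + 1, F => ∑ x, p x * avg p s fun l => F (x :: l)

/-- `p` is a vector of probabilities. -/
structure IsProb {α : Type*} [Fintype α] (p : α → ℝ) : Prop where
  nonneg : ∀ x, 0 ≤ p x
  sum_eq_one : ∑ x, p x = 1

/-- The indicator of a proposition. -/
def ind (E : Prop) : ℝ := open Classical in if E then 1 else 0

lemma ind_nonneg (E : Prop) : 0 ≤ ind E := by unfold ind; split_ifs <;> norm_num

lemma ind_le_one (E : Prop) : ind E ≤ 1 := by unfold ind; split_ifs <;> norm_num

lemma ind_of {E : Prop} (h : E) : ind E = 1 := by simp [ind, h]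

lemma ind_of_not {E : Prop} (h : ¬ E) : ind E = 0 := by simp [ind, h]

lemma ind_le {E : Prop} {c : ℝ} (hc : 0 ≤ c) (h : E → 1 ≤ c) : ind E ≤ c := by
  by_cases hE : E
  · rw [ind_of hE]; exact h hE
  · rwa [ind_of_not hE]

/-- The probabilities of a `PMF` on a finite type, as real numbers. -/
def wt {α : Type*} (μ : PMF α) (x : α) : ℝ := (μ x).toReal

/-! ### Majority votes over consecutive blocks -/

/-- The number of blocks with property `φ` among the first `R` blocks of length `B`. -/
def blockCount {α : Type*} (φ : List α → Prop) (B : ℕ) : ℕ → List α → ℕ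
  | 0, _ => 0
  | R + 1, l => (open Classical in if φ (l.take B) then 1 else 0) + blockCount φ B R (l.drop B)

lemma blockCount_add_not {α : Type*} (φ : List α → Prop) (B R : ℕ) (l : List α) :
    blockCount φ B R l + blockCount (fun l => ¬ φ l) B R l = R := by
  induction R generalizing l with
  | zero => rfl
  | succ R ih =>
    have := ih (l.drop B)
    by_cases h : φ (l.take B) <;> simp only [blockCount, h, not_true, not_false_iff, if_true,
      if_false] <;> omega

section avg

variable {α β : Type*} [Fintype α] [Fintype β] {p : α → ℝ} {q : β → ℝ}

lemma isProb_wt (μ : PMF α) : IsProb (wt μ) := ⟨fun _ => ENNReal.toReal_nonneg, sum_toReal μ⟩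

/-- The product of two vectors of probabilities. -/
def prodWt (p : α → ℝ) (q : β → ℝ) (z : α × β) : ℝ := p z.1 * q z.2

lemma sum_prodWt_mul (p : α → ℝ) (q : β → ℝ) (F : α × β → ℝ) :
    ∑ z, prodWt p q z * F z = ∑ x, p x * ∑ y, q y * F (x, y) := by
  simp only [prodWt, Fintype.sum_prod_type, Finset.mul_sum, mul_assoc]

lemma IsProb.prodWt (hp : IsProb p) (hq : IsProb q) : IsProb (prodWt p q) where
  nonneg z := mul_nonneg (hp.nonneg _) (hq.nonneg _)
  sum_eq_one := by
    have := sum_prodWt_mul p q fun _ => 1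
    simpa [hq.sum_eq_one, hp.sum_eq_one] using this

lemma avg_zero (F : List α → ℝ) : avg p 0 F = F [] := rfl

lemma avg_succ (s : ℕ) (F : List α → ℝ) :
    avg p (s + 1) F = ∑ x, p x * avg p s fun l => F (x :: l) := rfl

lemma avg_congr {s : ℕ} {F G : List α → ℝ} (h : ∀ l, l.length = s → F l = G l) :
    avg p s F = avg p s G := by
  induction s generalizing F G with
  | zero => exact h [] rfl
  | succ s ih =>
    simp only [avg_succ]
    exact Finset.sum_congr rfl fun x _ => by
      rw [ih fun l hl => h (x :: l) (by simp [hl])]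

lemma avg_mono_of_length (hp : ∀ x, 0 ≤ p x) {s : ℕ} {F G : List α → ℝ}
    (h : ∀ l, l.length = s → F l ≤ G l) : avg p s F ≤ avg p s G := by
  induction s generalizing F G with
  | zero => exact h [] rfl
  | succ s ih =>
    simp only [avg_succ]
    exact Finset.sum_le_sum fun x _ => mul_le_mul_of_nonneg_left
      (ih fun l hl => h (x :: l) (by simp [hl])) (hp x)

lemma avg_mono (hp : ∀ x, 0 ≤ p x) {s : ℕ} {F G : List α → ℝ} (h : ∀ l, F l ≤ G l) :
    avg p s F ≤ avg p s G := avg_mono_of_length hp fun l _ => h l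

lemma avg_add (s : ℕ) (F G : List α → ℝ) :
    avg p s (fun l => F l + G l) = avg p s F + avg p s G := by
  induction s generalizing F G with
  | zero => rfl
  | succ s ih => simp only [avg_succ, ih, mul_add, Finset.sum_add_distrib]

lemma avg_mul_left (s : ℕ) (c : ℝ) (F : List α → ℝ) :
    avg p s (fun l => c * F l) = c * avg p s F := by
  induction s generalizing F with
  | zero => rfl
  | succ s ih => simp only [avg_succ, ih, Finset.mul_sum, mul_left_comm]

lemma avg_mul_right (s : ℕ) (c : ℝ) (F : List α → ℝ) :
    avg p s (fun l => F l * c) = avg p s F * c := by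
  simp only [mul_comm _ c, avg_mul_left]

lemma avg_sub (s : ℕ) (F G : List α → ℝ) :
    avg p s (fun l => F l - G l) = avg p s F - avg p s G := by
  have := avg_add (p := p) s F fun l => (-1) * G l
  rw [avg_mul_left] at this
  simpa [sub_eq_add_neg] using this

lemma avg_const (hp : IsProb p) (s : ℕ) (c : ℝ) : avg p s (fun _ => c) = c := by
  induction s with
  | zero => rfl
  | succ s ih => simp only [avg_succ, ih, ← Finset.sum_mul, hp.sum_eq_one, one_mul]

lemma avg_sum {ι : Type*} (s : ℕ) (t : Finset ι) (F : ι → List α → ℝ) :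
    avg p s (fun l => ∑ i ∈ t, F i l) = ∑ i ∈ t, avg p s (F i) := by
  induction s generalizing F with
  | zero => rfl
  | succ s ih =>
    simp only [avg_succ, ih, Finset.mul_sum]
    rw [Finset.sum_comm]

lemma avg_nonneg (hp : ∀ x, 0 ≤ p x) {s : ℕ} {F : List α → ℝ} (h : ∀ l, 0 ≤ F l) :
    0 ≤ avg p s F := by
  have := avg_mono hp (s := s) h
  have h0 : avg p s (fun _ => (0 : ℝ)) = 0 := by simpa using avg_mul_left (p := p) s 0 fun _ => 0
  rwa [h0] at this

lemma avg_append (a b : ℕ) (F : List α → ℝ) :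
    avg p (a + b) F = avg p a fun l => avg p b fun l' => F (l ++ l') := by
  induction a generalizing F with
  | zero => simp [avg_zero]
  | succ a ih =>
    rw [Nat.add_right_comm]
    simp only [avg_succ, ih, List.cons_append]

/-- Splitting a list of samples after `a` of them. -/
lemma avg_split {a s : ℕ} (h : a ≤ s) (F : List α → List α → ℝ) :
    avg p s (fun l => F (l.take a) (l.drop a)) =
      avg p a fun l => avg p (s - a) fun l' => F l l' := by
  obtain ⟨b, rfl⟩ := Nat.exists_eq_add_of_le h
  rw [avg_append, Nat.add_sub_cancel_left]
  exact avg_congr fun l hl => avg_congr fun l' _ => by simp [← hl]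

lemma avg_take (hp : IsProb p) {a s : ℕ} (h : a ≤ s) (F : List α → ℝ) :
    avg p s (fun l => F (l.take a)) = avg p a F := by
  rw [avg_split h fun l _ => F l]
  simp only [avg_const hp]

lemma avg_comm (s t : ℕ) (F : List α → List β → ℝ) :
    (avg p s fun l => avg q t fun l' => F l l') = avg q t fun l' => avg p s fun l => F l l' := by
  induction s generalizing F with
  | zero => rfl
  | succ s ih =>
    simp only [avg_succ, ih]
    rw [avg_sum]
    simp only [avg_mul_left]

/-- Two independent samples of equal size are one sample of pairs, so a single splitting into blocks
serves both. -/
lemma avg_zip (s : ℕ) (F : List (α × β) → ℝ) :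
    (avg p s fun l => avg q s fun l' => F (l.zip l')) = avg (prodWt p q) s F := by
  induction s generalizing F with
  | zero => rfl
  | succ s ih =>
    simp only [avg_succ, List.zip_cons_cons]
    rw [sum_prodWt_mul]
    refine Finset.sum_congr rfl fun x _ => ?_
    rw [avg_sum]
    simp only [avg_mul_left]
    exact congrArg _ (Finset.sum_congr rfl fun y _ => by rw [← ih])

lemma avg_map_fst (hq : IsProb q) (s : ℕ) (F : List α → ℝ) :
    avg (prodWt p q) s (fun l => F (l.map Prod.fst)) = avg p s F := by
  rw [← avg_zip]
  refine avg_congr fun l hl => ?_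
  rw [← avg_const hq s (F l)]
  exact avg_congr fun l' hl' => by rw [List.map_fst_zip (by omega)]

lemma avg_map_snd (hp : IsProb p) (s : ℕ) (F : List β → ℝ) :
    avg (prodWt p q) s (fun l => F (l.map Prod.snd)) = avg q s F := by
  rw [← avg_zip, avg_comm]
  refine avg_congr fun l hl => ?_
  rw [← avg_const hp s (F l)]
  exact avg_congr fun l' hl' => by rw [List.map_snd_zip (by omega)]

lemma avg_map_equiv (e : α ≃ α) (he : ∀ x, p (e x) = p x) (s : ℕ) (F : List α → ℝ) :
    avg p s (fun l => F (l.map e)) = avg p s F := by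
  induction s generalizing F with
  | zero => rfl
  | succ s ih =>
    simp only [avg_succ, List.map_cons]
    rw [← Equiv.sum_comp e fun x => p x * avg p s fun l => F (x :: l)]
    exact Finset.sum_congr rfl fun x _ => by rw [he, ih fun l => F (e x :: l)]

/-! ### First and second moments of sums -/

lemma avg_sum_map (hp : IsProb p) (s : ℕ) (g : α → ℝ) :
    avg p s (fun l => (l.map g).sum) = s * ∑ x, p x * g x := by
  induction s with
  | zero => simp [avg_zero]
  | succ s ih =>
    simp only [avg_succ, List.map_cons, List.sum_cons, avg_add, avg_const hp, ih, mul_add,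
      Finset.sum_add_distrib, ← Finset.sum_mul, hp.sum_eq_one]
    push_cast; ring

lemma avg_sum_map_sq (hp : IsProb p) (s : ℕ) (g : α → ℝ) :
    avg p s (fun l => (l.map g).sum ^ 2) =
      s * (∑ x, p x * g x ^ 2 - (∑ x, p x * g x) ^ 2) + (s * ∑ x, p x * g x) ^ 2 := by
  induction s with
  | zero => simp [avg_zero]
  | succ s ih =>
    have h : ∀ (x : α) (l : List α), (((x :: l).map g).sum) ^ 2 =
        g x ^ 2 + (2 * g x * (l.map g).sum + (l.map g).sum ^ 2) := by
      intro x l; simp only [List.map_cons, List.sum_cons]; ring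
    simp only [avg_succ, h, avg_add, avg_const hp, avg_mul_left, ih, avg_sum_map hp]
    set m := ∑ x, p x * g x
    have h1 : ∑ x, p x * (g x ^ 2 + (2 * g x * (s * m) +
        (s * (∑ x, p x * g x ^ 2 - m ^ 2) + (s * m) ^ 2))) =
        ∑ x, p x * g x ^ 2 + 2 * (s * m) * (∑ x, p x * g x) +
        (∑ x, p x) * (s * (∑ x, p x * g x ^ 2 - m ^ 2) + (s * m) ^ 2) := by
      simp only [Finset.mul_sum, Finset.sum_mul, ← Finset.sum_add_distrib]
      exact Finset.sum_congr rfl fun x _ => by ring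
    rw [h1, hp.sum_eq_one]
    push_cast; ring

lemma avg_sum_map_sub_sq (hp : IsProb p) (s : ℕ) (g : α → ℝ) :
    avg p s (fun l => ((l.map g).sum - s * ∑ x, p x * g x) ^ 2) =
      s * (∑ x, p x * g x ^ 2 - (∑ x, p x * g x) ^ 2) := by
  set m := ∑ x, p x * g x with hm
  have h : ∀ l : List α, ((l.map g).sum - s * m) ^ 2 =
      (l.map g).sum ^ 2 - (2 * (s * m)) * (l.map g).sum + (s * m) ^ 2 := by intro l; ring
  simp only [h, avg_add, avg_sub, avg_mul_left, avg_const hp, avg_sum_map_sq hp, avg_sum_map hp,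
    ← hm]
  ring

/-! ### Chernoff's bound for majority votes -/

/-- Disjoint blocks are independent, so the generating function of the count is that of a binomial
variable. -/
lemma avg_pow_blockCount (hp : IsProb p) (φ : List α → Prop) (B R : ℕ) {s : ℕ} (hs : B * R ≤ s)
    (x : ℝ) :
    avg p s (fun l => x ^ blockCount φ B R l) =
      (1 + (x - 1) * avg p B fun l => ind (φ l)) ^ R := by
  induction R generalizing s with
  | zero => simp [blockCount, avg_const hp]
  | succ R ih =>
    rw [mul_add, mul_one] at hs
    simp only [blockCount, pow_add]
    rw [avg_split (by omega) fun l l' => x ^ (open Classical in if φ l then 1 else 0) *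
      x ^ blockCount φ B R l']
    simp only [avg_mul_left, avg_mul_right, ih (show B * R ≤ s - B by omega)]
    rw [pow_one, mul_comm]
    congr 1
    have : ∀ l : List α, x ^ (open Classical in if φ l then 1 else 0) =
        1 + (x - 1) * ind (φ l) := by
      intro l; by_cases h : φ l <;> simp [ind, h]
    simp only [this, avg_add, avg_const hp, avg_mul_left]

/-- Chernoff's bound. -/
lemma avg_blockCount_le (hp : IsProb p) (φ : List α → Prop) (B R : ℕ) {s : ℕ} (hs : B * R ≤ s)
    (a b : ℕ) {x : ℝ} (hx : 1 ≤ x) :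
    avg p s (fun l => ind (b * R ≤ a * blockCount φ B R l)) ≤
      ((1 + (x ^ a - 1) * avg p B fun l => ind (φ l)) / x ^ b) ^ R := by
  -- Markov's inequality for `(x ^ a) ^ blockCount` against `(x ^ b) ^ R`; the integers `a`, `b`
  -- encode the fraction `b / a` of positive blocks.
  rw [div_pow, ← avg_pow_blockCount hp φ B R hs, le_div_iff₀ (by positivity), ← avg_mul_right]
  refine avg_mono hp.nonneg fun l => ?_
  by_cases h : b * R ≤ a * blockCount φ B R l
  · rw [ind_of h, one_mul, ← pow_mul, ← pow_mul]
    exact pow_le_pow_right₀ hx h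
  · rw [ind_of_not h, zero_mul]; positivity

end avg

/-! ### From laws to expectations -/

section

variable {α β : Type} [Fintype α]

lemma pr_iid_bind_le (μ : PMF α) {γ : Type} {s : ℕ} {f : (Fin s → α) → PMF γ} {E : γ → Prop}
    {g : List α → ℝ} (h : ∀ X, pr (f X) E ≤ g (List.ofFn X)) :
    pr ((iidPMF μ s).bind f) E ≤ avg (wt μ) s g := by
  induction s generalizing g with
  | zero =>
    rw [iidPMF, PMF.pure_bind]
    simpa [avg_zero] using h Fin.elim0
  | succ s ih =>
    rw [iidPMF, PMF.bind_bind, pr_bind_eq_sum]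
    refine Finset.sum_le_sum fun x _ => mul_le_mul_of_nonneg_left ?_ ENNReal.toReal_nonneg
    rw [PMF.bind_bind]
    refine ih fun X => ?_
    rw [PMF.pure_bind]
    simpa [List.ofFn_succ] using h (Fin.cons x X)

lemma pr_iid_iid_bind_le (μ ν : PMF α) {γ : Type} {s : ℕ}
    {f : (Fin s → α) → (Fin s → α) → PMF γ} {E : γ → Prop} {g : List (α × α) → ℝ}
    (h : ∀ X Y, pr (f X Y) E ≤ g ((List.ofFn X).zip (List.ofFn Y))) :
    pr ((iidPMF μ s).bind fun X => (iidPMF ν s).bind fun Y => f X Y) E ≤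
      avg (prodWt (wt μ) (wt ν)) s g := by
  rw [← avg_zip]
  exact pr_iid_bind_le μ fun X => pr_iid_bind_le ν fun Y => h X Y

end

/-! ### Linear statistics of two samples -/

section

variable {α : Type*}

/-- The sum of `f x - f y` over the pairs `(x, y)` in a list. -/
def diffSum (f : α → ℝ) (l : List (α × α)) : ℝ := (l.map fun a => f a.1 - f a.2).sum

/-- The weighted difference of the histograms of the two samples in a list of pairs. -/
def score (ω : α → ℝ) (l : List (α × α)) (z : α) : ℝ := ω z * diffSum (fun y => ind (y = z)) l

lemma diffSum_nil (f : α → ℝ) : diffSum f [] = 0 := rfl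

lemma diffSum_cons (f : α → ℝ) (a : α × α) (l : List (α × α)) :
    diffSum f (a :: l) = f a.1 - f a.2 + diffSum f l := by simp [diffSum]

lemma diffSum_map_swap (f : α → ℝ) (l : List (α × α)) :
    diffSum f (l.map (Equiv.prodComm α α)) = -diffSum f l := by
  induction l with
  | nil => simp [diffSum]
  | cons a l ih => rw [List.map_cons, diffSum_cons, diffSum_cons, ih]; simp; ring

variable [Fintype α]

lemma sum_mul_ind (f : α → ℝ) (y : α) : ∑ z, f z * ind (y = z) = f y := by
  rw [Finset.sum_eq_single y]
  · simp [ind]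
  · intro z _ hz; simp [ind, hz.symm]
  · simp

lemma sum_score_mul (ω d : α → ℝ) (l : List (α × α)) :
    ∑ z, score ω l z * d z = diffSum (fun z => ω z * d z) l := by
  induction l with
  | nil => simp [score, diffSum_nil]
  | cons a l ih =>
    rw [diffSum_cons, ← ih, ← sum_mul_ind (fun z => ω z * d z) a.1,
      ← sum_mul_ind (fun z => ω z * d z) a.2, ← Finset.sum_sub_distrib, ← Finset.sum_add_distrib]
    refine Finset.sum_congr rfl fun z _ => ?_
    simp only [score, diffSum_cons]
    ring

variable {p q : α → ℝ}

lemma sum_prodWt_sub (hp : IsProb p) (hq : IsProb q) (f g : α → ℝ) :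
    ∑ z, prodWt p q z * (f z.1 + g z.2) = ∑ x, p x * f x + ∑ x, q x * g x := by
  rw [sum_prodWt_mul p q fun z => f z.1 + g z.2]
  simp only [mul_add, Finset.sum_add_distrib, ← Finset.sum_mul, hq.sum_eq_one,
    hp.sum_eq_one, one_mul]

lemma sum_prodWt_add_sq (hp : IsProb p) (hq : IsProb q) (f g : α → ℝ) :
    ∑ z, prodWt p q z * (f z.1 + g z.2) ^ 2 =
      ∑ x, p x * f x ^ 2 + ∑ x, q x * g x ^ 2 + 2 * (∑ x, p x * f x) * ∑ x, q x * g x := by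
  have h : ∀ z : α × α, prodWt p q z * (f z.1 + g z.2) ^ 2 =
      prodWt p q z * (f z.1 ^ 2 + g z.2 ^ 2) + 2 * (prodWt p q z * (f z.1 * g z.2)) := by
    intro z; ring
  simp only [h, Finset.sum_add_distrib, ← Finset.mul_sum]
  rw [sum_prodWt_sub hp hq (fun x => f x ^ 2) (fun x => g x ^ 2),
    sum_prodWt_mul p q fun z => f z.1 * g z.2]
  simp only [mul_left_comm _ (f _), ← Finset.mul_sum, mul_assoc]
  simp only [← mul_assoc, ← Finset.sum_mul]
  simp only [mul_comm (f _) (p _)]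

/-- The mean square deviation of a linear statistic of two samples. -/
lemma avg_pair_deviation_le (hp : IsProb p) (hq : IsProb q) (s : ℕ) (f g : α → ℝ) :
    avg (prodWt p q) s (fun l => ((l.map fun a => f a.1 + g a.2).sum -
      s * (∑ x, p x * f x + ∑ x, q x * g x)) ^ 2) ≤
      s * (∑ x, p x * f x ^ 2 + ∑ x, q x * g x ^ 2) := by
  have h := avg_sum_map_sub_sq (hp.prodWt hq) s fun z : α × α => f z.1 + g z.2
  rw [sum_prodWt_sub hp hq, sum_prodWt_add_sq hp hq] at h
  rw [h]
  refine mul_le_mul_of_nonneg_left ?_ s.cast_nonneg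
  nlinarith [sq_nonneg (∑ x, p x * f x), sq_nonneg (∑ x, q x * g x)]

lemma avg_diffSum_deviation_le (hp : IsProb p) (hq : IsProb q) (s : ℕ) (f : α → ℝ) :
    avg (prodWt p q) s (fun l => (diffSum f l - s * ∑ x, (p x - q x) * f x) ^ 2) ≤
      s * ∑ x, (p x + q x) * f x ^ 2 := by
  have h := avg_pair_deviation_le hp hq s f fun x => -f x
  simpa only [diffSum, sub_eq_add_neg, add_mul, Finset.sum_add_distrib, neg_mul, mul_neg,
    neg_sq] using h

lemma avg_diffSum (hp : IsProb p) (hq : IsProb q) (s : ℕ) (f : α → ℝ) :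
    avg (prodWt p q) s (fun l => diffSum f l) = s * ∑ x, (p x - q x) * f x := by
  have h := avg_sum_map (hp.prodWt hq) s fun z : α × α => f z.1 + -f z.2
  rw [sum_prodWt_sub hp hq f fun x => -f x] at h
  simpa only [diffSum, sub_eq_add_neg, add_mul, Finset.sum_add_distrib, neg_mul, mul_neg] using h

lemma avg_diffSum_sq_le (hp : IsProb p) (hq : IsProb q) (s : ℕ) (f : α → ℝ) :
    avg (prodWt p q) s (fun l => diffSum f l ^ 2) ≤
      s * ∑ x, (p x + q x) * f x ^ 2 + (s * ∑ x, (p x - q x) * f x) ^ 2 := by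
  have h := avg_diffSum_deviation_le hp hq s f
  set m := s * ∑ x, (p x - q x) * f x with hm
  have h1 : ∀ l : List (α × α), diffSum f l ^ 2 =
      (diffSum f l - m) ^ 2 + ((2 * m) * diffSum f l + -m ^ 2) := by intro l; ring
  simp only [h1]
  rw [avg_add, avg_add, avg_mul_left, avg_diffSum hp hq, ← hm, avg_const (hp.prodWt hq)]
  linarith

/-- The weighted squared distance of `p` and `q`. -/
def sqDist (ω p q : α → ℝ) : ℝ := ∑ z, ω z * (p z - q z) ^ 2

/-- The variance of a single sample in the direction of `p - q`. -/
def varDir (ω p q : α → ℝ) : ℝ := ∑ z, ω z ^ 2 * (p z + q z) * (p z - q z) ^ 2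

/-- The weighted squared norm of `p + q`. -/
def sqNorm (ω p q : α → ℝ) : ℝ := ∑ z, ω z ^ 2 * (p z + q z) ^ 2

lemma varDir_nonneg (hp : IsProb p) (hq : IsProb q) (ω : α → ℝ) : 0 ≤ varDir ω p q :=
  Finset.sum_nonneg fun z _ => mul_nonneg
    (mul_nonneg (sq_nonneg _) (add_nonneg (hp.nonneg z) (hq.nonneg z))) (sq_nonneg _)

lemma sqNorm_nonneg (ω : α → ℝ) : 0 ≤ sqNorm ω p q :=
  Finset.sum_nonneg fun _ _ => mul_nonneg (sq_nonneg _) (sq_nonneg _)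

/-- The gap between the means of a score under `p` and under `q`. -/
def gap (p q f : α → ℝ) : ℝ := ∑ z, f z * (p z - q z)

/-- The second moment of a score under `p + q`. -/
def energy (p q f : α → ℝ) : ℝ := ∑ z, (p z + q z) * f z ^ 2

lemma energy_nonneg (hp : IsProb p) (hq : IsProb q) (f : α → ℝ) : 0 ≤ energy p q f :=
  Finset.sum_nonneg fun z _ => mul_nonneg (add_nonneg (hp.nonneg z) (hq.nonneg z)) (sq_nonneg _)

/-- The gap of a trained score is itself a linear statistic of the training pairs, with coefficient
`ω z * (p z - q z)` at `z`. -/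
lemma avg_gap_le (hp : IsProb p) (hq : IsProb q) (ω : α → ℝ) (h : ℕ) :
    avg (prodWt p q) h (fun l => (gap p q (score ω l) - h * sqDist ω p q) ^ 2) ≤
      h * varDir ω p q := by
  have := avg_diffSum_deviation_le hp hq h fun z => ω z * (p z - q z)
  simp only [gap, sum_score_mul]
  convert this using 6
  · exact Finset.sum_congr rfl fun z _ => by ring
  · exact Finset.sum_congr rfl fun z _ => by ring

/-- Each coordinate of the score is `ω z` times a difference of two counts, whose second moment is
at most `h (p + q) + h² (p - q)²`; summing against `p + q` gives the two terms. -/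
lemma avg_energy_le (hp : IsProb p) (hq : IsProb q) (ω : α → ℝ) (h : ℕ) :
    avg (prodWt p q) h (fun l => energy p q (score ω l)) ≤
      h * sqNorm ω p q + h ^ 2 * varDir ω p q := by
  simp only [energy, avg_sum, avg_mul_left, score, mul_pow, sqNorm, varDir, Finset.mul_sum,
    ← Finset.sum_add_distrib]
  refine Finset.sum_le_sum fun z _ => ?_
  have h1 := avg_diffSum_sq_le hp hq h fun y => ind (y = z)
  have h2 : ∑ x, (p x + q x) * ind (x = z) ^ 2 = p z + q z := by
    rw [Finset.sum_eq_single z] <;> simp +contextual [ind]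
  have h3 : ∑ x, (p x - q x) * ind (x = z) = p z - q z := by
    rw [Finset.sum_eq_single z] <;> simp +contextual [ind]
  rw [h2, h3] at h1
  have h4 : 0 ≤ p z + q z := add_nonneg (hp.nonneg z) (hq.nonneg z)
  have h5 := mul_le_mul_of_nonneg_left h1 (mul_nonneg h4 (sq_nonneg (ω z)))
  nlinarith [h5]

/-- A weak form of Chebyshev's inequality for events that fail unless the gap is large. -/
lemma avg_score_event_le (hp : IsProb p) (hq : IsProb q) {ω : α → ℝ} {h : ℕ} (hh : 0 < h)
    (hN : 0 < sqDist ω p q) {G : (α → ℝ) → ℝ} {K : ℝ} (hK : 0 ≤ K) (hG : ∀ f, G f ≤ 1)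
    (hG' : ∀ f, 0 < gap p q f → G f ≤ K * energy p q f / gap p q f ^ 2) :
    avg (prodWt p q) h (fun l => G (score ω l)) ≤
      4 * varDir ω p q / (h * sqDist ω p q ^ 2) +
        4 * K * (sqNorm ω p q / h + varDir ω p q) / sqDist ω p q ^ 2 := by
  set N := sqDist ω p q
  have hh' : (0 : ℝ) < h := by exact_mod_cast hh
  have hpt : ∀ f, G f ≤ 4 / (h * N) ^ 2 * (gap p q f - h * N) ^ 2 +
      4 * K / (h * N) ^ 2 * energy p q f := by
    intro f
    have he := energy_nonneg hp hq f
    -- The mean gap is `h * N`. Below half of it, the squared deviation alone makes the first term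
    -- at least 1; above it, the assumption on `G` yields the second.
    by_cases hg : gap p q f ≤ h * N / 2
    · refine (hG f).trans ?_
      have h1 : 1 ≤ 4 / (h * N) ^ 2 * (gap p q f - h * N) ^ 2 := by
        rw [div_mul_eq_mul_div, le_div_iff₀ (by positivity)]
        nlinarith [mul_pos hh' hN]
      have h2 : 0 ≤ 4 * K / (h * N) ^ 2 * energy p q f := by positivity
      linarith
    · push Not at hg
      have hpos : 0 < h * N / 2 := by positivity
      refine (hG' f (hpos.trans hg)).trans ?_
      have h1 : 0 ≤ 4 / (h * N) ^ 2 * (gap p q f - h * N) ^ 2 := by positivity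
      have h2 : K * energy p q f / gap p q f ^ 2 ≤ K * energy p q f / (h * N / 2) ^ 2 := by
        gcongr
      have h3 : K * energy p q f / (h * N / 2) ^ 2 = 4 * K / (h * N) ^ 2 * energy p q f := by
        field_simp; ring
      linarith
  refine (avg_mono (hp.prodWt hq).nonneg fun l => hpt (score ω l)).trans ?_
  rw [avg_add, avg_mul_left, avg_mul_left]
  have h1 := mul_le_mul_of_nonneg_left (avg_gap_le hp hq ω h)
    (show 0 ≤ 4 / (h * N) ^ 2 by positivity)
  have h2 := mul_le_mul_of_nonneg_left (avg_energy_le hp hq ω h)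
    (show 0 ≤ 4 * K / (h * N) ^ 2 by positivity)
  refine (add_le_add h1 h2).trans (le_of_eq ?_)
  field_simp

/-! ### One block of the equivalence test -/

/-- Train a score on the first `h` pairs and evaluate it on the others. -/
def blockPositive (h : ℕ) (l : List (α × α)) : Prop :=
  0 < diffSum (score (fun _ => 1) (l.take h)) (l.drop h)

/-- With the trained score fixed, exchanging the two components of every evaluation pair preserves
the law and negates the statistic. The events "positive" and "negative" are disjoint and equally
likely. -/
lemma avg_blockPositive_le_half (hp : IsProb p) (h : ℕ) :
    avg (prodWt p p) (2 * h) (fun l => ind (blockPositive h l)) ≤ 1 / 2 := by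
  have hpp := hp.prodWt hp
  unfold blockPositive
  rw [avg_split (by omega) fun l l' => ind (0 < diffSum (score (fun _ => 1) l) l')]
  rw [← avg_const hpp h (1 / 2)]
  refine avg_mono hpp.nonneg fun l => ?_
  set f := score (fun _ => 1) l
  have h1 := avg_map_equiv (p := prodWt p p) (Equiv.prodComm α α)
    (fun x => by simp [prodWt, mul_comm]) (2 * h - h) fun l' => ind (0 < diffSum f l')
  simp only [diffSum_map_swap] at h1
  have h2 : avg (prodWt p p) (2 * h - h) (fun l' => ind (0 < -diffSum f l') +
      ind (0 < diffSum f l')) ≤ 1 := by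
    rw [← avg_const hpp (2 * h - h) 1]
    refine avg_mono hpp.nonneg fun l' => ?_
    by_cases h3 : 0 < diffSum f l'
    · rw [ind_of h3, ind_of_not (by linarith)]; simp
    · rw [ind_of_not h3]; simpa using ind_le_one _
  rw [avg_add, h1] at h2
  linarith

/-- Given the score `f`, the evaluation has mean `h * gap` and variance at most `h * energy`, so
Chebyshev's inequality provides the hypothesis of `avg_score_event_le` with `K = 1 / h`. -/
lemma avg_not_blockPositive_le (hp : IsProb p) (hq : IsProb q) {h : ℕ} (hh : 0 < h)
    (hN : 0 < sqDist (fun _ => 1) p q) :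
    avg (prodWt p q) (2 * h) (fun l => ind (¬ blockPositive h l)) ≤
      8 * varDir (fun _ => 1) p q / (h * sqDist (fun _ => 1) p q ^ 2) +
        4 * sqNorm (fun _ => 1) p q / (h ^ 2 * sqDist (fun _ => 1) p q ^ 2) := by
  have hpq := hp.prodWt hq
  have hh' : (0 : ℝ) < h := by exact_mod_cast hh
  unfold blockPositive
  rw [avg_split (by omega) fun l l' => ind (¬ 0 < diffSum (score (fun _ => 1) l) l'),
    show 2 * h - h = h by omega]
  refine (avg_score_event_le hp hq hh hN (K := 1 / h)
    (G := fun f => avg (prodWt p q) h fun l => ind (¬ 0 < diffSum f l)) (by positivity)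
    (fun f => ?_) fun f hf => ?_).trans (le_of_eq ?_)
  · rw [← avg_const hpq h 1]
    exact avg_mono hpq.nonneg fun l => ind_le_one _
  · have h1 := avg_diffSum_deviation_le hp hq h f
    have h2 : ∀ l : List (α × α), ind (¬ 0 < diffSum f l) ≤
        1 / (h * gap p q f) ^ 2 * (diffSum f l - h * gap p q f) ^ 2 := by
      intro l
      refine ind_le (by positivity) fun hl => ?_
      rw [one_div_mul_eq_div, one_le_div (by positivity)]
      nlinarith [mul_pos hh' hf]
    refine (avg_mono hpq.nonneg h2).trans ?_
    rw [avg_mul_left]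
    have h3 : gap p q f = ∑ x, (p x - q x) * f x := Finset.sum_congr rfl fun z _ => by ring
    rw [← h3] at h1
    refine (mul_le_mul_of_nonneg_left h1 (by positivity)).trans (le_of_eq ?_)
    change _ * (h * energy p q f) = _
    field_simp
  · field_simp; ring

/-! ### One block of the likelihood-free test -/

/-- Compare the sum of the score over `Z` with the average of the sums over the two samples. -/
def vote (f : α → ℝ) (s h : ℕ) (l : List (α × α)) (Z : List α) : Prop :=
  h * (l.map fun a => f a.1 + f a.2).sum ≤ 2 * s * (Z.map f).sum

/-- The common part of the two error bounds for a vote, `u` being `p` or `q`. By `hW`, an error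
forces the threshold sample to deviate by `s * gap / 2` or the classified sample by `h * gap / 4`;
Chebyshev's inequality bounds both. The bound `u ≤ p + q` makes `energy` dominate all variances. -/
lemma avg_vote_error_le (hp : IsProb p) (hq : IsProb q) {u : α → ℝ} (hu : IsProb u)
    (hupq : ∀ x, u x ≤ p x + q x) {f : α → ℝ} (hg : 0 < gap p q f) {s h : ℕ} (hs : 0 < s)
    (hh : 0 < h) {W : List (α × α) → List α → Prop}
    (hW : ∀ l Z, W l Z →
      |(l.map fun a => f a.1 + f a.2).sum - s * (∑ x, p x * f x + ∑ x, q x * f x)| <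
        s * gap p q f / 2 →
      h * gap p q f / 4 ≤ |(Z.map f).sum - h * ∑ x, u x * f x|) :
    (avg (prodWt p q) s fun l => avg u h fun Z => ind (W l Z)) ≤
      (16 / h + 4 / s) * energy p q f / gap p q f ^ 2 := by
  have hpq := hp.prodWt hq
  have hh' : (0 : ℝ) < h := by exact_mod_cast hh
  have hs' : (0 : ℝ) < s := by exact_mod_cast hs
  set g := gap p q f
  have h1 : ∀ l Z, ind (W l Z) ≤
      4 / (s * g) ^ 2 * ((l.map fun a => f a.1 + f a.2).sum -
        s * (∑ x, p x * f x + ∑ x, q x * f x)) ^ 2 +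
      16 / (h * g) ^ 2 * ((Z.map f).sum - h * ∑ x, u x * f x) ^ 2 := by
    intro l Z
    refine ind_le (by positivity) fun hl => ?_
    set A := (l.map fun a => f a.1 + f a.2).sum - s * (∑ x, p x * f x + ∑ x, q x * f x)
    set B := (Z.map f).sum - h * ∑ x, u x * f x
    by_cases hA : |A| < s * g / 2
    · have hB := hW l Z hl hA
      have h2 : 1 ≤ 16 / (h * g) ^ 2 * B ^ 2 := by
        rw [div_mul_eq_mul_div, one_le_div (by positivity), ← sq_abs B]
        nlinarith [mul_pos hh' hg, abs_nonneg B]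
      have : 0 ≤ 4 / (s * g) ^ 2 * A ^ 2 := by positivity
      linarith
    · push Not at hA
      have h2 : 1 ≤ 4 / (s * g) ^ 2 * A ^ 2 := by
        rw [div_mul_eq_mul_div, one_le_div (by positivity), ← sq_abs A]
        nlinarith [mul_pos hs' hg, abs_nonneg A]
      have : 0 ≤ 16 / (h * g) ^ 2 * B ^ 2 := by positivity
      linarith
  refine (avg_mono hpq.nonneg fun l => avg_mono hu.nonneg (h1 l)).trans ?_
  simp only [avg_add, avg_const hu, avg_mul_left, avg_const hpq]
  have h2 := avg_pair_deviation_le hp hq s f f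
  have h3 := avg_sum_map_sub_sq hu h f
  have h4 : ∑ x, p x * f x ^ 2 + ∑ x, q x * f x ^ 2 = energy p q f := by
    simp only [energy, add_mul, Finset.sum_add_distrib]
  have h5 : ∑ x, u x * f x ^ 2 ≤ energy p q f :=
    Finset.sum_le_sum fun x _ => mul_le_mul_of_nonneg_right (hupq x) (sq_nonneg _)
  have h6 : avg u h (fun l => ((l.map f).sum - h * ∑ x, u x * f x) ^ 2) ≤ h * energy p q f := by
    rw [h3]
    exact mul_le_mul_of_nonneg_left (by nlinarith [sq_nonneg (∑ x, u x * f x)]) hh'.le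
  rw [h4] at h2
  refine (add_le_add (mul_le_mul_of_nonneg_left h2 (by positivity))
    (mul_le_mul_of_nonneg_left h6 (by positivity))).trans (le_of_eq ?_)
  field_simp; ring

lemma gap_eq (p q f : α → ℝ) : gap p q f = ∑ x, p x * f x - ∑ x, q x * f x := by
  rw [← Finset.sum_sub_distrib]
  exact Finset.sum_congr rfl fun z _ => by ring

lemma avg_not_vote_le (hp : IsProb p) (hq : IsProb q) {f : α → ℝ} (hg : 0 < gap p q f)
    {s h : ℕ} (hs : 0 < s) (hh : 0 < h) :
    (avg (prodWt p q) s fun l => avg p h fun Z => ind (¬ vote f s h l Z)) ≤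
      (16 / h + 4 / s) * energy p q f / gap p q f ^ 2 := by
  refine avg_vote_error_le hp hq hp (fun x => by linarith [hq.nonneg x]) hg hs hh
    fun l Z hv hA => ?_
  have hh' : (0 : ℝ) < h := by exact_mod_cast hh
  have hs' : (0 : ℝ) < s := by exact_mod_cast hs
  unfold vote at hv
  by_contra! hB
  rw [abs_lt] at hA hB
  rw [gap_eq] at *
  -- The means of the two sides of `vote` differ by `s * h * gap`. Each of the two deviations moves
  -- its side by less than half of this.
  nlinarith [mul_lt_mul_of_pos_left hA.2 hh', mul_lt_mul_of_pos_left hB.1 hs']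

lemma avg_vote_le (hp : IsProb p) (hq : IsProb q) {f : α → ℝ} (hg : 0 < gap p q f)
    {s h : ℕ} (hs : 0 < s) (hh : 0 < h) :
    (avg (prodWt p q) s fun l => avg q h fun Z => ind (vote f s h l Z)) ≤
      (16 / h + 4 / s) * energy p q f / gap p q f ^ 2 := by
  refine avg_vote_error_le hp hq hq (fun x => by linarith [hp.nonneg x]) hg hs hh
    fun l Z hv hA => ?_
  have hh' : (0 : ℝ) < h := by exact_mod_cast hh
  have hs' : (0 : ℝ) < s := by exact_mod_cast hs
  unfold vote at hv
  by_contra! hB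
  rw [abs_lt] at hA hB
  rw [gap_eq] at *
  nlinarith [mul_lt_mul_of_pos_left hA.1 hh', mul_lt_mul_of_pos_left hB.2 hs']

end

/-! ### Weights from the histogram of two samples -/

section

variable {α : Type*} [DecidableEq α]

/-- The multiplicity of `z` in both samples of a list of pairs. -/
def pairCount (l : List (α × α)) (z : α) : ℕ := (l.map Prod.fst).count z + (l.map Prod.snd).count z

/-- The weight of `z` given by a list of pairs of samples: the inverse of one plus the
multiplicity. -/
def histWeight (l : List (α × α)) (z : α) : ℝ := 1 / ((pairCount l z : ℝ) + 1)

lemma histWeight_pos (l : List (α × α)) (z : α) : 0 < histWeight l z := by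
  unfold histWeight; positivity

end

section

variable {α : Type*} [Fintype α] {p q : α → ℝ}

/-- The squared distance of `p` and `q` for the idealized weights. -/
def idealDist (s : ℕ) (p q : α → ℝ) : ℝ := ∑ z, (p z - q z) ^ 2 / (s * (p z + q z) + 1)

/-- Cauchy–Schwarz with the weights `s (p + q) + 1`, whose sum is `n + 2 s ≤ 2 (n + s)`. -/
lemma le_idealDist (hp : IsProb p) (hq : IsProb q) (s : ℕ) {ε : ℝ} (hε : 0 ≤ ε)
    (h : 2 * ε ≤ ∑ z, |p z - q z|) :
    2 * ε ^ 2 ≤ (Fintype.card α + s) * idealDist s p q := by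
  have h1 : (∑ z, |p z - q z|) ^ 2 ≤ (∑ z, (s * (p z + q z) + 1)) * idealDist s p q := by
    rw [mul_comm]
    refine Finset.sum_sq_le_sum_mul_sum_of_sq_le_mul _ (fun z _ => ?_) (fun z _ => ?_)
      fun z _ => ?_
    · have := hp.nonneg z; have := hq.nonneg z; positivity
    · have := hp.nonneg z; have := hq.nonneg z; positivity
    · have := hp.nonneg z; have := hq.nonneg z
      rw [sq_abs, div_mul_cancel₀ _ (by positivity)]
  have h2 : ∑ z, (s * (p z + q z) + 1) = 2 * s + (Fintype.card α : ℝ) := by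
    rw [Finset.sum_add_distrib, ← Finset.mul_sum, Finset.sum_add_distrib, hp.sum_eq_one,
      hq.sum_eq_one]
    simp; ring
  have h3 : (2 * ε) ^ 2 ≤ (∑ z, |p z - q z|) ^ 2 := pow_le_pow_left₀ (by positivity) h 2
  have h4 : 0 ≤ idealDist s p q := Finset.sum_nonneg fun z _ => by
    have := hp.nonneg z; have := hq.nonneg z; positivity
  rw [h2] at h1
  nlinarith [mul_nonneg (Nat.cast_nonneg (α := ℝ) (Fintype.card α)) h4]

end

/-! ### Negative moments of multiplicities -/

section

variable {α : Type*} [Fintype α] [DecidableEq α] {p q : α → ℝ}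

lemma avg_count_succ (hp : IsProb p) (z : α) (s : ℕ) (g : ℕ → ℝ) :
    avg p (s + 1) (fun l => g (l.count z)) =
      p z * avg p s (fun l => g (l.count z + 1)) + (1 - p z) * avg p s fun l => g (l.count z) := by
  have h : ∀ x, p x * avg p s (fun l => g ((x :: l).count z)) =
      p x * avg p s (fun l => g (l.count z)) + (if x = z then p z *
        (avg p s (fun l => g (l.count z + 1)) - avg p s fun l => g (l.count z)) else 0) := by
    intro x
    by_cases hx : x = z
    · subst hx; simp; ring
    · simp [hx]
  rw [avg_succ, Finset.sum_congr rfl fun x _ => h x, Finset.sum_add_distrib, ← Finset.sum_mul,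
    hp.sum_eq_one]
  simp
  ring

/-- Size biasing of a binomial variable: a factor `count` singles out one of the `s + 1` samples
that equals `z`. Choosing `g` of negative order gives the negative moments. -/
lemma avg_count_mul (hp : IsProb p) (z : α) (s : ℕ) (g : ℕ → ℝ) :
    avg p (s + 1) (fun l => l.count z * g (l.count z)) =
      (s + 1) * p z * avg p s fun l => g (l.count z + 1) := by
  induction s generalizing g with
  | zero =>
    rw [avg_count_succ hp z 0 fun c => (c : ℝ) * g c]
    simp [avg_zero]
  | succ s ih =>
    have h1 : avg p (s + 1) (fun l => ((l.count z + 1 : ℕ) : ℝ) * g (l.count z + 1)) =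
        avg p (s + 1) (fun l => l.count z * g (l.count z + 1)) +
          avg p (s + 1) fun l => g (l.count z + 1) := by
      rw [← avg_add]
      exact avg_congr fun l _ => by push_cast; ring
    rw [avg_count_succ hp z (s + 1) fun c => (c : ℝ) * g c, h1, ih g, ih fun c => g (c + 1),
      avg_count_succ hp z s fun c => g (c + 1)]
    push_cast
    ring

/-- Size biasing with `g c = 1 / c`: the left-hand side becomes the mean of `c / c`, which is 0 at
`c = 0` and 1 elsewhere. -/
lemma avg_inv_count_le (hp : IsProb p) (z : α) (s : ℕ) :
    (s + 1) * p z * avg p s (fun l => 1 / ((l.count z : ℝ) + 1)) ≤ 1 := by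
  have h := avg_count_mul hp z s fun c => 1 / (c : ℝ)
  push_cast at h
  refine h ▸ le_trans ?_ (avg_const hp (s + 1) 1).le
  refine avg_mono hp.nonneg fun l => ?_
  rw [mul_one_div]
  exact div_self_le_one _

/-- Size biasing with `g c = 1 / (c (c + 1))` reduces the bound to `avg_inv_count_le` for one more
sample; at `c = 0` the value `1 / 0 = 0` only helps. -/
lemma avg_inv_count_mul_le (hp : IsProb p) (z : α) (s : ℕ) :
    (s + 1) * (s + 2) * p z ^ 2 *
      avg p s (fun l => 1 / (((l.count z : ℝ) + 1) * ((l.count z : ℝ) + 2))) ≤ 1 := by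
  have h := avg_count_mul hp z s fun c => 1 / ((c : ℝ) * (c + 1))
  push_cast at h
  have h0 : ∀ c : ℝ, c + 1 + 1 = c + 2 := fun c => by ring
  simp only [h0] at h
  have h1 : avg p (s + 1) (fun l => (l.count z : ℝ) * (1 / (l.count z * (l.count z + 1)))) ≤
      avg p (s + 1) fun l => 1 / ((l.count z : ℝ) + 1) := by
    refine avg_mono hp.nonneg fun l => ?_
    rcases (l.count z).eq_zero_or_pos with hc | hc
    · simp [hc]
    · have : (0 : ℝ) < l.count z := by exact_mod_cast hc
      exact le_of_eq (by field_simp)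
  have h2 := avg_inv_count_le hp z (s + 1)
  push_cast at h2
  have h3 : 0 ≤ ((s : ℝ) + 2) * p z := mul_nonneg (by positivity) (hp.nonneg z)
  have h4 := mul_le_mul_of_nonneg_left h1 h3
  rw [h] at h4
  nlinarith [h4, h2]

lemma avg_inv_count_sq_le (hp : IsProb p) (z : α) (s : ℕ) :
    avg p s (fun l => (1 / ((l.count z : ℝ) + 1)) ^ 2) ≤ 8 / (s * p z + 1) ^ 2 := by
  have hz := hp.nonneg z
  have hsz : 0 ≤ s * p z := by positivity
  -- For `s p ≤ 1` the right-hand side is at least 2. For `s p > 1`, a factor 2 comes from `1/(c+1)²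
  -- ≤ 2/((c+1)(c+2))` and a factor 4 from `(s p + 1)² ≤ 4 (s p)²`.
  by_cases h : s * p z ≤ 1
  · calc avg p s (fun l => (1 / ((l.count z : ℝ) + 1)) ^ 2) ≤ avg p s fun _ => 1 :=
          avg_mono hp.nonneg fun l => pow_le_one₀ (by positivity) (by
            rw [div_le_one (by positivity)]; linarith [(l.count z).cast_nonneg (α := ℝ)])
      _ = 1 := avg_const hp s 1
      _ ≤ 8 / (s * p z + 1) ^ 2 := by
          rw [one_le_div (by positivity)]; nlinarith
  · push Not at h
    have h1 := avg_inv_count_mul_le hp z s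
    set A := avg p s fun l => 1 / (((l.count z : ℝ) + 1) * ((l.count z : ℝ) + 2))
    have h2 : avg p s (fun l => (1 / ((l.count z : ℝ) + 1)) ^ 2) ≤ 2 * A := by
      rw [← avg_mul_left]
      refine avg_mono hp.nonneg fun l => ?_
      rw [one_div_pow, mul_one_div, div_le_div_iff₀ (by positivity) (by positivity)]
      nlinarith [(l.count z).cast_nonneg (α := ℝ)]
    have hA : 0 ≤ A := avg_nonneg hp.nonneg fun l => by positivity
    have h3 : (s * p z) ^ 2 * A ≤ 1 := by
      refine le_trans (mul_le_mul_of_nonneg_right ?_ hA) h1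
      nlinarith [sq_nonneg (p z), (s.cast_nonneg : (0 : ℝ) ≤ s)]
    rw [le_div_iff₀ (by positivity)]
    nlinarith [mul_le_mul_of_nonneg_left h2 (sq_nonneg (s * p z + 1)), mul_nonneg hA hsz,
      mul_nonneg hA (show 0 ≤ (s * p z - 1) * (3 * (s * p z) + 1) by nlinarith)]

/-- Only the multiplicity in the sample with the larger probability of `z` is kept; that probability
is at least half of `p z + q z`, which turns 8 into 32. -/
lemma avg_histWeight_sq_le (hp : IsProb p) (hq : IsProb q) (s : ℕ) (z : α) :
    avg (prodWt p q) s (fun l => histWeight l z ^ 2) ≤ 32 / (s * (p z + q z) + 1) ^ 2 := by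
  have hpq := hp.prodWt hq
  have h1 : avg (prodWt p q) s (fun l => histWeight l z ^ 2) ≤ 8 / (s * p z + 1) ^ 2 := by
    refine le_trans (avg_mono hpq.nonneg fun l => ?_)
      ((avg_map_fst hq s fun l => (1 / ((l.count z : ℝ) + 1)) ^ 2).le.trans
        (avg_inv_count_sq_le hp z s))
    unfold histWeight pairCount
    gcongr
    simp
  have h2 : avg (prodWt p q) s (fun l => histWeight l z ^ 2) ≤ 8 / (s * q z + 1) ^ 2 := by
    refine le_trans (avg_mono hpq.nonneg fun l => ?_)
      ((avg_map_snd hp s fun l => (1 / ((l.count z : ℝ) + 1)) ^ 2).le.trans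
        (avg_inv_count_sq_le hq z s))
    unfold histWeight pairCount
    gcongr
    simp
  have hp0 := hp.nonneg z
  have hq0 := hq.nonneg z
  have hs : (0 : ℝ) ≤ s := s.cast_nonneg
  rcases le_total (p z) (q z) with h | h
  · refine h2.trans ?_
    rw [div_le_div_iff₀ (by positivity) (by positivity)]
    have : s * (p z + q z) + 1 ≤ 2 * (s * q z + 1) := by nlinarith
    have := pow_le_pow_left₀ (by positivity) this 2
    nlinarith
  · refine h1.trans ?_
    rw [div_le_div_iff₀ (by positivity) (by positivity)]
    have : s * (p z + q z) + 1 ≤ 2 * (s * p z + 1) := by nlinarith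
    have := pow_le_pow_left₀ (by positivity) this 2
    nlinarith

lemma avg_count (hp : IsProb p) (s : ℕ) (z : α) :
    avg p s (fun l => (l.count z : ℝ)) = s * p z := by
  cases s with
  | zero => simp [avg_zero]
  | succ s =>
    have := avg_count_mul hp z s fun _ => 1
    simpa [avg_const hp] using this

lemma avg_pairCount (hp : IsProb p) (hq : IsProb q) (s : ℕ) (z : α) :
    avg (prodWt p q) s (fun l => (pairCount l z : ℝ)) = s * (p z + q z) := by
  simp only [pairCount, Nat.cast_add, avg_add]
  rw [avg_map_fst hq s fun l => (l.count z : ℝ), avg_map_snd hp s fun l => (l.count z : ℝ),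
    avg_count hp, avg_count hq]
  ring

/-! ### Quality of the histogram weights, and the error of scores trained with them. -/

/-- The histogram weights do their duty. -/
structure GoodWeight (K : ℝ) (s : ℕ) (p q ω : α → ℝ) : Prop where
  sqDist_ge : idealDist s p q ≤ K * sqDist ω p q
  varDir_le : s * varDir ω p q ≤ K * idealDist s p q
  sqNorm_le : s * (Fintype.card α + s) * sqNorm ω p q ≤ K * Fintype.card α

/-- Cauchy–Schwarz turns a lower bound on the weighted distance into an upper bound on a sum that is
linear in the multiplicities. The mean of that sum is exactly `idealDist`, so Markov's inequality
suffices and no lower tail of the weights is needed. -/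
lemma idealDist_sq_le (hp : IsProb p) (hq : IsProb q) (s : ℕ) (l : List (α × α)) :
    idealDist s p q ^ 2 ≤ sqDist (histWeight l) p q *
      ∑ z, (p z - q z) ^ 2 / (s * (p z + q z) + 1) ^ 2 * ((pairCount l z : ℝ) + 1) := by
  refine Finset.sum_sq_le_sum_mul_sum_of_sq_le_mul _ (fun z _ => ?_) (fun z _ => ?_)
    fun z _ => ?_
  · have := histWeight_pos l z; positivity
  · positivity
  · have := hp.nonneg z; have := hq.nonneg z
    have : (0 : ℝ) < s * (p z + q z) + 1 := by positivity
    unfold histWeight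
    exact le_of_eq (by field_simp)

/-- Markov's inequality for each of the three conditions, whose normalized means are at most 1, 32
and 96; their sum is 129. -/
lemma avg_not_goodWeight_le (hp : IsProb p) (hq : IsProb q) {s : ℕ} (hs : 0 < s)
    (hL : 0 < idealDist s p q) {K : ℝ} (hK : 0 < K) :
    avg (prodWt p q) s (fun l => ind (¬ GoodWeight K s p q (histWeight l))) ≤ 129 / K := by
  have hpq := hp.prodWt hq
  set L := idealDist s p q with hLdef
  have hs' : (0 : ℝ) < s := by exact_mod_cast hs
  have hpz := hp.nonneg
  have hqz := hq.nonneg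
  have hden : ∀ z, 0 < s * (p z + q z) + 1 := fun z => by have := hpz z; have := hqz z; positivity
  have hcard : (0 : ℝ) < Fintype.card α := by
    have : Nonempty α := by
      by_contra hne
      rw [not_nonempty_iff] at hne
      have := hp.sum_eq_one
      simp at this
    exact_mod_cast Fintype.card_pos
  set n : ℝ := (Fintype.card α : ℝ) with hn
  let Y := fun l : List (α × α) =>
    ∑ z, (p z - q z) ^ 2 / (s * (p z + q z) + 1) ^ 2 * ((pairCount l z : ℝ) + 1)
  have hYavg : avg (prodWt p q) s Y = L := by
    simp only [Y, avg_sum, avg_mul_left, avg_add, avg_const hpq, avg_pairCount hp hq]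
    refine Finset.sum_congr rfl fun z _ => ?_
    have := hden z
    field_simp
  have hY0 : ∀ l, 0 ≤ Y l := fun l => Finset.sum_nonneg fun z _ => by positivity
  have hV1avg : avg (prodWt p q) s (fun l => varDir (histWeight l) p q) ≤ 32 * L / s := by
    simp only [varDir, avg_sum, avg_mul_right]
    rw [hLdef, idealDist, Finset.mul_sum, Finset.sum_div]
    refine Finset.sum_le_sum fun z _ => ?_
    have h1 := avg_histWeight_sq_le hp hq s z
    have h2 := hden z
    have h3 : 0 ≤ p z + q z := add_nonneg (hpz z) (hqz z)
    calc _ ≤ 32 / (s * (p z + q z) + 1) ^ 2 * (p z + q z) * (p z - q z) ^ 2 := by gcongr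
      _ ≤ 32 * ((p z - q z) ^ 2 / (s * (p z + q z) + 1)) / s := by
        have h4 : (p z + q z) / (s * (p z + q z) + 1) ≤ 1 / s := by
          rw [div_le_div_iff₀ h2 hs']; nlinarith
        have h5 : 0 ≤ 32 * (p z - q z) ^ 2 / (s * (p z + q z) + 1) := by positivity
        have h6 := mul_le_mul_of_nonneg_left h4 h5
        refine le_trans (le_of_eq ?_) (h6.trans (le_of_eq ?_)) <;> field_simp
  have hV2avg : avg (prodWt p q) s (fun l => sqNorm (histWeight l) p q) ≤
      96 * n / (s * (n + s)) := by
    simp only [sqNorm, avg_sum, avg_mul_right]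
    have h0 : ∀ z, avg (prodWt p q) s (fun l => histWeight l z ^ 2) * (p z + q z) ^ 2 ≤
        32 * ((p z + q z) / (s * (p z + q z) + 1)) ^ 2 := by
      intro z
      have := mul_le_mul_of_nonneg_right (avg_histWeight_sq_le hp hq s z) (sq_nonneg (p z + q z))
      refine this.trans (le_of_eq ?_)
      have := hden z
      field_simp
    refine (Finset.sum_le_sum fun z _ => h0 z).trans ?_
    rw [← Finset.mul_sum]
    have h3 : ∀ z, 0 ≤ p z + q z := fun z => add_nonneg (hpz z) (hqz z)
    have h4 : ∀ z, (p z + q z) / (s * (p z + q z) + 1) ≤ 1 / s := fun z => by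
      rw [div_le_div_iff₀ (hden z) hs']; nlinarith
    have h5 : ∀ z, (p z + q z) / (s * (p z + q z) + 1) ≤ p z + q z := fun z =>
      div_le_self (h3 z) (by have := h3 z; nlinarith)
    have h6 : ∀ z, 0 ≤ (p z + q z) / (s * (p z + q z) + 1) := fun z =>
      div_nonneg (h3 z) (hden z).le
    have ha : ∑ z, ((p z + q z) / (s * (p z + q z) + 1)) ^ 2 ≤ n / s ^ 2 := by
      refine (Finset.sum_le_sum fun z _ => pow_le_pow_left₀ (h6 z) (h4 z) 2).trans (le_of_eq ?_)
      simp [hn]; ring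
    have hb : ∑ z, ((p z + q z) / (s * (p z + q z) + 1)) ^ 2 ≤ 2 / (s : ℝ) := by
      have : ∀ z ∈ Finset.univ, ((p z + q z) / (s * (p z + q z) + 1)) ^ 2 ≤
          (p z + q z) * (1 / s) := fun z _ => by
        rw [sq]; exact mul_le_mul (h5 z) (h4 z) (h6 z) (h3 z)
      refine (Finset.sum_le_sum this).trans (le_of_eq ?_)
      rw [← Finset.sum_mul, Finset.sum_add_distrib, hp.sum_eq_one, hq.sum_eq_one]
      ring
    -- The bound `n / s²` is the better one for `n` small against `s`, the bound `2 / s` for `n`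
    -- large; the case distinction at `n = 2 s` gives the constant 3.
    have hc : ∑ z, ((p z + q z) / (s * (p z + q z) + 1)) ^ 2 ≤ 3 * n / (s * (n + s)) := by
      rcases le_total n (2 * s) with h | h
      · refine ha.trans ?_
        rw [div_le_div_iff₀ (by positivity) (by positivity)]
        nlinarith [mul_pos hs' hcard, mul_pos (mul_pos hs' hs') hcard,
          mul_nonneg (mul_nonneg hs'.le hcard.le) (sub_nonneg.2 h)]
      · refine hb.trans ?_
        rw [div_le_div_iff₀ (by positivity) (by positivity)]
        nlinarith [mul_nonneg hs'.le (sub_nonneg.2 h)]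
    calc _ ≤ 32 * (3 * n / (s * (n + s))) := by gcongr
      _ = _ := by ring
  have hpt : ∀ l, ind (¬ GoodWeight K s p q (histWeight l)) ≤
      1 / (K * L) * Y l + (s / (K * L) * varDir (histWeight l) p q +
        s * (n + s) / (K * n) * sqNorm (histWeight l) p q) := by
    intro l
    have hv1 := varDir_nonneg hp hq (histWeight l)
    have hv2 := sqNorm_nonneg (p := p) (q := q) (histWeight l)
    have t1 : 0 ≤ 1 / (K * L) * Y l := mul_nonneg (by positivity) (hY0 l)
    have t2 : 0 ≤ s / (K * L) * varDir (histWeight l) p q := by positivity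
    have t3 : 0 ≤ s * (n + s) / (K * n) * sqNorm (histWeight l) p q := by positivity
    refine ind_le (by positivity) fun hl => ?_
    by_contra! hlt
    refine hl ⟨?_, ?_, ?_⟩
    · have h1 : 1 / (K * L) * Y l < 1 := by linarith
      rw [one_div_mul_eq_div, div_lt_one (by positivity)] at h1
      have h2 := idealDist_sq_le hp hq s l
      have hN : 0 ≤ sqDist (histWeight l) p q := Finset.sum_nonneg fun z _ => by
        have := histWeight_pos l z; positivity
      have h3 : L ^ 2 ≤ sqDist (histWeight l) p q * (K * L) :=
        h2.trans (mul_le_mul_of_nonneg_left h1.le hN)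
      have h4 : L * L ≤ L * (K * sqDist (histWeight l) p q) := by nlinarith
      exact le_of_mul_le_mul_left h4 hL
    · have h1 : s / (K * L) * varDir (histWeight l) p q < 1 := by linarith
      rw [div_mul_eq_mul_div, div_lt_one (by positivity)] at h1
      exact h1.le
    · have h1 : s * (n + s) / (K * n) * sqNorm (histWeight l) p q < 1 := by linarith
      rw [div_mul_eq_mul_div, div_lt_one (by positivity)] at h1
      exact h1.le
  refine (avg_mono hpq.nonneg hpt).trans ?_
  rw [avg_add, avg_add, avg_mul_left, avg_mul_left, avg_mul_left, hYavg]
  have h1 := mul_le_mul_of_nonneg_left hV1avg (show 0 ≤ s / (K * L) by positivity)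
  have h2 := mul_le_mul_of_nonneg_left hV2avg (show 0 ≤ s * (n + s) / (K * n) by positivity)
  have h3 : 1 / (K * L) * L + (s / (K * L) * (32 * L / s) +
      s * (n + s) / (K * n) * (96 * n / (s * (n + s)))) = 129 / K := by
    field_simp; norm_num
  linarith

/-- Here `m = n + s`. The chain is `V / (h N²) ≤ K³ / (s h L) ≤ K³ m / (2 s h ε²) ≤ K³ / (2 M)`. -/
lemma div_le_of_varDir_le {s h m M N K L V ε : ℝ} (hs : 0 < s) (hh : 0 < h) (hm : 0 < m)
    (hM : 0 < M) (hN : 0 < N) (hK : 1 ≤ K) (hL : 0 < L) (hLN : L ≤ K * N)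
    (hVL : s * V ≤ K * L) (h1 : M * m ≤ s * h * ε ^ 2) (h0 : 2 * ε ^ 2 ≤ m * L) :
    84 * V / (h * N ^ 2) ≤ 42 * K ^ 3 / M := by
  have hLN2 : L ^ 2 ≤ K ^ 2 * N ^ 2 := by
    rw [← mul_pow]; exact pow_le_pow_left₀ hL.le hLN 2
  rw [div_le_div_iff₀ (by positivity) hM]
  have a1 := mul_le_mul hVL h1 (by positivity) (by positivity)
  have a2 := mul_le_mul_of_nonneg_left h0 (show 0 ≤ K * L * (s * h) by positivity)
  have a3 := mul_le_mul_of_nonneg_left hLN2 (show 0 ≤ K * (s * h) * m by positivity)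
  have a4 : (s * m) * (84 * V * M) ≤ (s * m) * (42 * K ^ 3 * (h * N ^ 2)) := by
    linarith
  exact le_of_mul_le_mul_left a4 (by positivity)

/-- The chain is `V / (s h N²) ≤ K³ n / (s² h m L²) ≤ K³ n m / (4 s² h ε⁴) ≤ K³ / (4 M)`. -/
lemma div_le_of_sqNorm_le {s h n m M N K L V ε : ℝ} (hs : 0 < s) (hh : 0 < h) (hm : 0 < m)
    (hM : 0 < M) (hN : 0 < N) (hK : 1 ≤ K) (hL : 0 < L)
    (hLN : L ≤ K * N) (hVn : s * m * V ≤ K * n) (h2 : M * (n * m) ≤ s ^ 2 * h * ε ^ 4)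
    (h0 : 2 * ε ^ 2 ≤ m * L) :
    80 * V / (s * h * N ^ 2) ≤ 20 * K ^ 3 / M := by
  have hLN2 : L ^ 2 ≤ K ^ 2 * N ^ 2 := by
    rw [← mul_pow]; exact pow_le_pow_left₀ hL.le hLN 2
  rw [div_le_div_iff₀ (by positivity) hM]
  have b1 := mul_le_mul_of_nonneg_right hVn (show 0 ≤ M * m by positivity)
  have b2 := mul_le_mul_of_nonneg_left h2 (show 0 ≤ K by positivity)
  have a2 := pow_le_pow_left₀ (by positivity) h0 2
  have a3 := mul_le_mul_of_nonneg_left hLN2 (sq_nonneg m)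
  have a4 : 4 * ε ^ 4 ≤ m ^ 2 * (K ^ 2 * N ^ 2) := by linarith
  have a5 := mul_le_mul_of_nonneg_left a4 (show 0 ≤ K * (s ^ 2 * h) by positivity)
  have a6 : (s * m ^ 2) * (80 * V * M) ≤ (s * m ^ 2) * (20 * K ^ 3 * (s * h * N ^ 2)) := by
    linarith
  exact le_of_mul_le_mul_left a6 (by positivity)

/-- An event that fails unless a score trained with histogram weights has a large gap is
unlikely. -/
lemma avg_histScore_event_le (hp : IsProb p) (hq : IsProb q) {s h : ℕ} (hh : 0 < h) (hhs : h ≤ s)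
    {ε : ℝ} (hε : 0 < ε) (hd : 2 * ε ≤ ∑ z, |p z - q z|) {K M : ℝ} (hK : 1 ≤ K) (hM : 0 < M)
    (h1 : M * (Fintype.card α + s) ≤ s * h * ε ^ 2)
    (h2 : M * (Fintype.card α * (Fintype.card α + s)) ≤ s ^ 2 * h * ε ^ 4)
    {G : (α → ℝ) → ℝ} (hG : ∀ f, G f ≤ 1)
    (hG' : ∀ f, 0 < gap p q f → G f ≤ (16 / h + 4 / s) * energy p q f / gap p q f ^ 2) :
    (avg (prodWt p q) s fun l => avg (prodWt p q) s fun l' => G (score (histWeight l) l')) ≤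
      129 / K + 62 * K ^ 3 / M := by
  have hpq := hp.prodWt hq
  have hs : 0 < s := hh.trans_le hhs
  have hs' : (0 : ℝ) < s := by exact_mod_cast hs
  have hh' : (0 : ℝ) < h := by exact_mod_cast hh
  have hhs' : (h : ℝ) ≤ s := by exact_mod_cast hhs
  have hL0 := le_idealDist hp hq s hε.le hd
  set n : ℝ := (Fintype.card α : ℝ) with hn
  have hn0 : 0 ≤ n := Nat.cast_nonneg _
  have hns : 0 < n + s := by positivity
  have hL : 0 < idealDist s p q := by
    by_contra! h0
    nlinarith [pow_pos hε 2]
  have hpt : ∀ l, avg (prodWt p q) s (fun l' => G (score (histWeight l) l')) ≤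
      ind (¬ GoodWeight K s p q (histWeight l)) + 62 * K ^ 3 / M := by
    intro l
    by_cases hl : GoodWeight K s p q (histWeight l)
    · rw [ind_of_not (not_not.2 hl), zero_add]
      obtain ⟨g1, g2, g3⟩ := hl
      have hv1 := varDir_nonneg hp hq (histWeight l)
      have hv2 := sqNorm_nonneg (p := p) (q := q) (histWeight l)
      set L := idealDist s p q
      set N := sqDist (histWeight l) p q
      set V1 := varDir (histWeight l) p q
      set V2 := sqNorm (histWeight l) p q
      have hN : 0 < N := by
        by_contra! h0
        nlinarith
      -- Since `h ≤ s`, every `1 / s` in the variance terms may be replaced by `1 / h`: 84 is `4 + 4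
      -- * 20`, and 80 is `4 * 20`.
      refine (avg_score_event_le hp hq hs hN (K := 16 / h + 4 / s) (by positivity) hG hG').trans ?_
      have e0 : 16 / (h : ℝ) + 4 / s ≤ 20 / h := by
        have : 4 / (s : ℝ) ≤ 4 / h := by gcongr
        calc 16 / (h : ℝ) + 4 / s ≤ 16 / h + 4 / h := by linarith
          _ = 20 / h := by ring
      have e1 : 4 * V1 / (s * N ^ 2) ≤ 4 * V1 / (h * N ^ 2) := by gcongr
      have e2 : 4 * (16 / (h : ℝ) + 4 / s) * (V2 / s + V1) / N ^ 2 ≤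
          4 * (20 / h) * (V2 / s + V1) / N ^ 2 := by gcongr
      have e3 : 4 * V1 / (h * N ^ 2) + 4 * (20 / h) * (V2 / s + V1) / N ^ 2 =
          84 * V1 / (h * N ^ 2) + 80 * V2 / (s * h * N ^ 2) := by field_simp; ring
      have e4 := div_le_of_varDir_le hs' hh' hns hM hN hK hL g1 g2 h1 hL0
      have e5 := div_le_of_sqNorm_le hs' hh' hns hM hN hK hL g1 g3 h2 hL0
      calc _ ≤ 84 * V1 / (h * N ^ 2) + 80 * V2 / (s * h * N ^ 2) := by linarith
        _ ≤ 42 * K ^ 3 / M + 20 * K ^ 3 / M := add_le_add e4 e5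
        _ = 62 * K ^ 3 / M := by ring
    · rw [ind_of hl]
      have : avg (prodWt p q) s (fun l' => G (score (histWeight l) l')) ≤ 1 := by
        rw [← avg_const hpq s 1]
        exact avg_mono hpq.nonneg fun l' => hG _
      have : 0 ≤ 62 * K ^ 3 / M := by positivity
      linarith
  refine (avg_mono hpq.nonneg hpt).trans ?_
  rw [avg_add, avg_const hpq]
  gcongr
  exact avg_not_goodWeight_le hp hq hs hL (by linarith)

end

/-! ### The two tests -/

/-- The number of votes taken to reach error probability `δ`. -/
def votes (δ : ℝ) : ℕ := ⌈30 * Real.log (1 / δ)⌉₊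

/-- The factor 30 in `votes` is 3 times 10, as `9/10 ≤ exp (-1/10)`. The cube leaves slack in the
union bounds: a number of tests of order `1 / δ` still fails with probability of order `δ ^ 2`. -/
lemma pow_votes_le {δ : ℝ} (hδ : 0 < δ) : (9 / 10 : ℝ) ^ votes δ ≤ δ ^ 3 := by
  have h1 : 30 * Real.log (1 / δ) ≤ votes δ := Nat.le_ceil _
  have h2 : (9 / 10 : ℝ) ≤ Real.exp (-(1 / 10)) := by
    have := Real.add_one_le_exp (-(1 / 10) : ℝ); linarith
  calc (9 / 10 : ℝ) ^ votes δ ≤ Real.exp (-(1 / 10)) ^ votes δ := by gcongr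
    _ = Real.exp (votes δ * -(1 / 10)) := (Real.exp_nat_mul _ _).symm
    _ ≤ Real.exp (3 * Real.log δ) := by
        refine Real.exp_le_exp.2 ?_
        rw [one_div, Real.log_inv] at h1
        linarith
    _ = δ ^ 3 := by
        rw [show (3 : ℝ) = (3 : ℕ) by norm_num, Real.exp_nat_mul, Real.exp_log hδ]

/-- The equivalence test: at least three quarters of the blocks are positive. -/
def equivTest : EquivalenceTest := fun _ _ _ δ _ s X Y =>
  PMF.pure (open Classical in decide (3 * votes δ ≤
    4 * blockCount (blockPositive (s / (2 * votes δ))) (2 * (s / (2 * votes δ))) (votes δ)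
      ((List.ofFn X).zip (List.ofFn Y))))

lemma two_mul_div_mul_le (s R : ℕ) : 2 * (s / (2 * R)) * R ≤ s :=
  calc 2 * (s / (2 * R)) * R = s / (2 * R) * (2 * R) := by ring
    _ ≤ s := Nat.div_mul_le_self _ _

/-- Symmetry alone controls false positives, so nothing is required of the sample size or of the
norm of `μ`. The search over guesses of the cluster size depends on this. -/
lemma pr_equivTest_null_le {α : Type} [Fintype α] (μ : PMF α) (ε b : ℝ) {δ : ℝ} (hδ : 0 < δ)
    (s : ℕ) :
    pr ((iidPMF μ s).bind fun X => (iidPMF μ s).bind fun Y => equivTest α ε δ b s X Y)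
      (fun o => o = true) ≤ δ ^ 3 := by
  have hp := isProb_wt μ
  set R := votes δ with hR
  set h := s / (2 * R)
  refine le_trans ?_ (pow_votes_le hδ)
  -- Chernoff's bound at `x = 3/2` has the base `(1 + (x⁴ - 1)/2) / x³ = 97/108`, just below `9/10`.
  refine (pr_iid_iid_bind_le μ μ (g := fun l =>
    ind (3 * R ≤ 4 * blockCount (blockPositive h) (2 * h) R l)) fun X Y => ?_).trans
    ((avg_blockCount_le (hp.prodWt hp) (blockPositive h) (2 * h) R (two_mul_div_mul_le s R) 4 3
      (x := 3 / 2) (by norm_num)).trans ?_)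
  · rw [equivTest, pr_pure]
    refine ind_le (E := _) (ind_nonneg _) fun h2 => ?_
    rw [ind_of]
    simpa only [decide_eq_true_eq] using h2
  · have h1 := avg_blockPositive_le_half hp h
    have h0 : 0 ≤ avg (prodWt (wt μ) (wt μ)) (2 * h) fun l => ind (blockPositive h l) :=
      avg_nonneg (hp.prodWt hp).nonneg fun l => ind_nonneg _
    refine pow_le_pow_left₀ ?_ ?_ R
    · refine div_nonneg ?_ (by norm_num)
      norm_num; positivity
    · rw [div_le_iff₀ (by norm_num)]
      norm_num
      linarith

lemma pr_equivTest_alt_le {α : Type} [Fintype α] (μ ν : PMF α) (ε b : ℝ) {δ : ℝ} (hδ : 0 < δ)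
    (s : ℕ) (hs : avg (prodWt (wt μ) (wt ν)) (2 * (s / (2 * votes δ)))
      (fun l => ind (¬ blockPositive (s / (2 * votes δ)) l)) ≤ 1 / 30) :
    pr ((iidPMF μ s).bind fun X => (iidPMF ν s).bind fun Y => equivTest α ε δ b s X Y)
      (fun o => o ≠ true) ≤ δ ^ 3 := by
  have hp := isProb_wt μ
  have hq := isProb_wt ν
  set R := votes δ with hR
  set h := s / (2 * R)
  refine le_trans ?_ (pow_votes_le hδ)
  -- A wrong answer leaves at least a quarter of the blocks not positive; at `x = 2` the base is at
  -- most `(1 + 15/30) / 2 = 3/4`.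
  refine (pr_iid_iid_bind_le μ ν (g := fun l =>
    ind (1 * R ≤ 4 * blockCount (fun l => ¬ blockPositive h l) (2 * h) R l)) fun X Y => ?_).trans
    ((avg_blockCount_le (hp.prodWt hq) (fun l => ¬ blockPositive h l) (2 * h) R
      (two_mul_div_mul_le s R) 4 1 (x := 2) (by norm_num)).trans ?_)
  · rw [equivTest, pr_pure]
    have h1 := blockCount_add_not (blockPositive h) (2 * h) R ((List.ofFn X).zip (List.ofFn Y))
    refine ind_le (E := _) (ind_nonneg _) fun h2 => ?_
    rw [ind_of]
    simp only [ne_eq, decide_eq_true_eq, ← hR] at h2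
    change ¬ 3 * R ≤ 4 * blockCount (blockPositive h) (2 * h) R _ at h2
    omega
  · have h0 : 0 ≤ avg (prodWt (wt μ) (wt ν)) (2 * h) fun l => ind (¬ blockPositive h l) :=
      avg_nonneg (hp.prodWt hq).nonneg fun l => ind_nonneg _
    refine pow_le_pow_left₀ ?_ ?_ R
    · refine div_nonneg ?_ (by norm_num)
      norm_num; positivity
    · rw [div_le_iff₀ (by norm_num)]
      norm_num
      linarith

/-- One vote of the likelihood-free test: weights, score and threshold are found from the first,
second and third `s` pairs in the list `l`. -/
def lfhtVote {α : Type*} [DecidableEq α] (s h : ℕ) (l : List (α × α)) (Z : List α) : Prop :=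
  vote (score (histWeight (l.take s)) ((l.drop s).take s)) s h (((l.drop s).drop s).take s) Z

/-- The likelihood-free hypothesis test: a majority of votes. -/
def lfhtTest : LFHTest := fun _ _ δ s₁ s₂ X Y Z =>
  PMF.pure (open Classical in decide (votes δ < 2 * blockCount
    (lfhtVote (s₁ / 3) (s₂ / votes δ) ((List.ofFn X).zip (List.ofFn Y))) (s₂ / votes δ) (votes δ)
    (List.ofFn Z)))

lemma majority_le {α : Type*} [Fintype α] {p : α → ℝ} (hp : IsProb p) (φ : List α → Prop)
    {B R s : ℕ} (hs : B * R ≤ s) (h : avg p B (fun l => ind (φ l)) ≤ 1 / 30) :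
    avg p s (fun l => ind (1 * R ≤ 2 * blockCount φ B R l)) ≤ (9 / 10) ^ R := by
  refine (avg_blockCount_le hp φ B R hs 2 1 (x := 2) (by norm_num)).trans ?_
  have h0 : 0 ≤ avg p B fun l => ind (φ l) := avg_nonneg hp.nonneg fun l => ind_nonneg _
  refine pow_le_pow_left₀ ?_ ?_ R
  · refine div_nonneg ?_ (by norm_num)
    norm_num; positivity
  · rw [div_le_iff₀ (by norm_num)]
    norm_num
    linarith

section

variable {n : ℕ}

/-- The exemplar samples `X`, `Y` are frozen; given them the votes are independent, being functions
of disjoint blocks of `Z`. -/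
lemma pr_lfhtTest_true_le (μ : PMF (Fin n)) (ε : ℝ) {δ : ℝ} (hδ : 0 < δ) {s₁ s₂ : ℕ}
    (X Y : Fin s₁ → Fin n)
    (h : avg (wt μ) (s₂ / votes δ) (fun Z => ind (lfhtVote (s₁ / 3) (s₂ / votes δ)
      ((List.ofFn X).zip (List.ofFn Y)) Z)) ≤ 1 / 30) :
    pr ((iidPMF μ s₂).bind fun Z => lfhtTest n ε δ s₁ s₂ X Y Z) (fun o => o ≠ false) ≤ δ ^ 3 := by
  refine le_trans ?_ (pow_votes_le hδ)
  refine (pr_iid_bind_le μ (g := fun l => ind (1 * votes δ ≤ 2 * blockCount (lfhtVote (s₁ / 3)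
    (s₂ / votes δ) ((List.ofFn X).zip (List.ofFn Y))) (s₂ / votes δ) (votes δ) l))
    fun Z => ?_).trans (majority_le (isProb_wt μ) _ (Nat.div_mul_le_self _ _) h)
  rw [lfhtTest, pr_pure]
  refine ind_le (E := _) (ind_nonneg _) fun h2 => ?_
  rw [ind_of]
  simp only [ne_eq, decide_eq_false_iff_not, not_not] at h2
  omega

lemma pr_lfhtTest_false_le (μ : PMF (Fin n)) (ε : ℝ) {δ : ℝ} (hδ : 0 < δ) {s₁ s₂ : ℕ}
    (X Y : Fin s₁ → Fin n)
    (h : avg (wt μ) (s₂ / votes δ) (fun Z => ind (¬ lfhtVote (s₁ / 3) (s₂ / votes δ)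
      ((List.ofFn X).zip (List.ofFn Y)) Z)) ≤ 1 / 30) :
    pr ((iidPMF μ s₂).bind fun Z => lfhtTest n ε δ s₁ s₂ X Y Z) (fun o => o ≠ true) ≤ δ ^ 3 := by
  refine le_trans ?_ (pow_votes_le hδ)
  refine (pr_iid_bind_le μ (g := fun l => ind (1 * votes δ ≤ 2 * blockCount (fun Z =>
    ¬ lfhtVote (s₁ / 3) (s₂ / votes δ) ((List.ofFn X).zip (List.ofFn Y)) Z) (s₂ / votes δ)
    (votes δ) l)) fun Z => ?_).trans (majority_le (isProb_wt μ) _ (Nat.div_mul_le_self _ _) h)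
  rw [lfhtTest, pr_pure]
  have h1 := blockCount_add_not (lfhtVote (s₁ / 3) (s₂ / votes δ)
    ((List.ofFn X).zip (List.ofFn Y))) (s₂ / votes δ) (votes δ) (List.ofFn Z)
  refine ind_le (E := _) (ind_nonneg _) fun h2 => ?_
  rw [ind_of]
  simp only [ne_eq, decide_eq_true_eq] at h2
  omega

end

section

variable {α : Type*} [Fintype α] [DecidableEq α] {p q : α → ℝ}

/-- Averaging a function of the weights, the score and the threshold sample. -/
lemma avg_three_stages (hp : IsProb p) (hq : IsProb q) {s S : ℕ} (hS : 3 * s ≤ S)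
    (H : (α → ℝ) → List (α × α) → ℝ) :
    avg (prodWt p q) S (fun l => H (score (histWeight (l.take s)) ((l.drop s).take s))
      (((l.drop s).drop s).take s)) =
    avg (prodWt p q) s fun l => avg (prodWt p q) s fun l' =>
      avg (prodWt p q) s (H (score (histWeight l) l')) := by
  rw [avg_split (a := s) (by omega) fun l l' => H (score (histWeight l) (l'.take s))
    ((l'.drop s).take s)]
  refine avg_congr fun l _ => ?_
  rw [avg_split (a := s) (by omega) fun l' l'' => H (score (histWeight l) l') (l''.take s)]
  exact avg_congr fun l' _ => avg_take (hp.prodWt hq) (by omega) _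

/-- The error of a single vote, averaged over everything, for the constants used below. -/
lemma avg_lfhtVote_error_le (hp : IsProb p) (hq : IsProb q) {s h S : ℕ} (hS : 3 * s ≤ S)
    (hh : 0 < h) (hhs : h ≤ s) {ε : ℝ} (hε : 0 < ε) (hd : 2 * ε ≤ ∑ z, |p z - q z|)
    (h1 : 10 ^ 28 * ((Fintype.card α : ℝ) + s) ≤ s * h * ε ^ 2)
    (h2 : 10 ^ 28 * ((Fintype.card α : ℝ) * (Fintype.card α + s)) ≤ s ^ 2 * h * ε ^ 4) :
    avg (prodWt p q) S (fun l => avg p h fun Z => ind (¬ lfhtVote s h l Z)) ≤ 1 / 50000 ∧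
    avg (prodWt p q) S (fun l => avg q h fun Z => ind (lfhtVote s h l Z)) ≤ 1 / 50000 := by
  have hpq := hp.prodWt hq
  have hs : 0 < s := hh.trans_le hhs
  unfold lfhtVote
  constructor
  · rw [avg_three_stages hp hq hS fun f l => avg p h fun Z => ind (¬ vote f s h l Z)]
    -- `129/K` and `62 K³/M` are `1.29e-5` and `6.2e-6`, together below `1/50000`.
    refine (avg_histScore_event_le hp hq hh hhs hε hd (K := 10 ^ 7) (M := 10 ^ 28) (by norm_num)
      (by norm_num) h1 h2 (G := fun f => avg (prodWt p q) s fun l => avg p h fun Z =>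
        ind (¬ vote f s h l Z)) (fun f => ?_) fun f hf => avg_not_vote_le hp hq hf hs hh).trans
      (by norm_num)
    rw [← avg_const hpq s 1]
    refine avg_mono hpq.nonneg fun l => ?_
    rw [← avg_const hp h 1]
    exact avg_mono hp.nonneg fun l => ind_le_one _
  · rw [avg_three_stages hp hq hS fun f l => avg q h fun Z => ind (vote f s h l Z)]
    refine (avg_histScore_event_le hp hq hh hhs hε hd (K := 10 ^ 7) (M := 10 ^ 28) (by norm_num)
      (by norm_num) h1 h2 (G := fun f => avg (prodWt p q) s fun l => avg q h fun Z =>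
        ind (vote f s h l Z)) (fun f => ?_) fun f hf => avg_vote_le hp hq hf hs hh).trans
      (by norm_num)
    rw [← avg_const hpq s 1]
    refine avg_mono hpq.nonneg fun l => ?_
    rw [← avg_const hq h 1]
    exact avg_mono hq.nonneg fun l => ind_le_one _

end

/-! ### MultiLFHT -/

section

variable {k n : ℕ} {D : Fin k → PMF (Fin n)}

lemma pr_classify_le {test : Fin k → SampleAlg k n Bool} (P : Fin k → Prop) [DecidablePred P]
    {η : ℝ} (hη : 0 ≤ η) (l : List (Fin k))
    (h : ∀ i ∈ l, pr (law D (test i)) (fun o => o ≠ decide (P i)) ≤ η) :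
    pr (law D (classify test l)) (fun χ => χ ≠ (l.filter (fun i => decide (P i))).toFinset) ≤
      l.length * η := by
  induction l with
  | nil =>
    rw [classify, monad_pure_eq, law_ret, pr_pure_of_not (by simp)]
    simp
  | cons i l ih =>
    have ih := ih fun j hj => h j (List.mem_cons_of_mem _ hj)
    have hi := h i List.mem_cons_self
    rw [classify, monad_bind_eq, law_bind, List.length_cons]
    have hl : 0 ≤ (l.length : ℝ) * η := by positivity
    refine (pr_bind_le (fun o => o ≠ decide (P i)) hl fun o _ ho => ?_).trans
      (by push_cast; linarith)
    rw [monad_bind_eq, law_bind]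
    refine (pr_bind_le (fun χ => χ ≠ (l.filter (fun i => decide (P i))).toFinset) le_rfl
      fun χ _ hχ => ?_).trans (by linarith)
    rw [monad_pure_eq, law_ret, pr_pure_of_not]
    simp only [ne_eq, not_not] at ho hχ ⊢
    subst ho hχ
    by_cases hP : P i <;> simp [hP]

/-- The samples of MultiLFHT suffice. -/
lemma pr_multiLFHT_le {ε C : ℝ} {I : Finset (Fin k)} (hε : 0 < ε) (hI : IsHiddenPartition ε D I)
    {a₁ a₂ : Fin k} (h₁ : a₁ ∈ I) (h₂ : a₂ ∈ Iᶜ) {s h : ℕ}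
    (hs : s = ⌈C * lfhtSize n k ε⌉₊ / 3)
    (hh : h = ⌈C * lfhtSize n k ε / k⌉₊ / votes (1 / (9 * k))) (hh0 : 0 < h) (hhs : h ≤ s)
    (h1 : 10 ^ 28 * ((n : ℝ) + s) ≤ s * h * ε ^ 2)
    (h2 : 10 ^ 28 * ((n : ℝ) * (n + s)) ≤ s ^ 2 * h * ε ^ 4) :
    pr (law D (multiLFHT lfhtTest C ε a₁ a₂)) (fun o => o ≠ {I, Iᶜ}) ≤ 1 / 100 := by
  have hk : 0 < k := Fin.pos a₁
  have hk' : (1 : ℝ) ≤ k := by exact_mod_cast hk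
  set δ : ℝ := 1 / (9 * k) with hδ
  have hδ0 : 0 < δ := by positivity
  have hp := isProb_wt (D a₁)
  have hq := isProb_wt (D a₂)
  have hpq := hp.prodWt hq
  simp only [multiLFHT, monad_bind_eq, law_bind, law_iid, law_draw]
  set s₁ := ⌈C * lfhtSize n k ε⌉₊
  set s₂ := ⌈C * lfhtSize n k ε / k⌉₊
  have hd : 2 * ε ≤ ∑ z, |wt (D a₁) z - wt (D a₂) z| := by
    have := hI.le_tv a₁ h₁ a₂ h₂
    unfold tv at this
    unfold wt
    linarith
  obtain ⟨e1, e2⟩ := avg_lfhtVote_error_le hp hq (S := s₁) (by omega) hh0 hhs hε hd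
    (by simpa using h1) (by simpa using h2)
  set β₁ := fun l => avg (wt (D a₁)) h fun Z => ind (¬ lfhtVote s h l Z)
  set β₂ := fun l => avg (wt (D a₂)) h fun Z => ind (lfhtVote s h l Z)
  have hβ₁ : ∀ l, 0 ≤ β₁ l := fun l => avg_nonneg hp.nonneg fun _ => ind_nonneg _
  have hβ₂ : ∀ l, 0 ≤ β₂ l := fun l => avg_nonneg hq.nonneg fun _ => ind_nonneg _
  -- Every distribution equals one of the two exemplars, so only the conditional vote errors `β₁`
  -- and `β₂` matter for all `k` tests. Exemplar samples with a vote error above 1/30 are paid for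
  -- by Markov's inequality, through `30 * β₁ + 30 * β₂`; given the others, the union bound costs `k
  -- δ³ ≤ 1/200`.
  refine (pr_iid_iid_bind_le (D a₁) (D a₂)
    (g := fun l => 30 * β₁ l + (30 * β₂ l + 1 / 200)) fun X Y => ?_).trans ?_
  · by_cases hg : 1 / 30 < β₁ ((List.ofFn X).zip (List.ofFn Y)) ∨
        1 / 30 < β₂ ((List.ofFn X).zip (List.ofFn Y))
    · refine (pr_le_one _ _).trans ?_
      have := hβ₁ ((List.ofFn X).zip (List.ofFn Y))
      have := hβ₂ ((List.ofFn X).zip (List.ofFn Y))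
      rcases hg with hg | hg <;> linarith
    · push Not at hg
      set L := ((Finset.univ.erase a₁).erase a₂).toList with hL
      have hcl := pr_classify_le (D := D) (test := fun i => (iid (draw i) s₂).bind fun Z =>
        rand (lfhtTest n ε δ s₁ s₂ X Y Z)) (fun i => i ∈ I) (η := δ ^ 3) (by positivity) L
        (fun i _ => by
          rw [law_bind, law_iid, law_draw]
          simp only [law_rand]
          by_cases hi : i ∈ I
          · rw [hI.eq_of_mem i hi a₁ h₁, decide_eq_true hi]
            refine pr_lfhtTest_false_le (D a₁) ε hδ0 X Y ?_
            rw [← hs, ← hh]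
            exact hg.1
          · have hi' : i ∈ Iᶜ := Finset.mem_compl.2 hi
            rw [hI.eq_of_mem_compl i hi' a₂ h₂, decide_eq_false hi]
            refine pr_lfhtTest_true_le (D a₂) ε hδ0 X Y ?_
            rw [← hs, ← hh]
            exact hg.2)
      have hlen : L.length ≤ k := by
        rw [hL, Finset.length_toList]
        exact (Finset.card_le_univ _).trans_eq (Fintype.card_fin k)
      have hlen' : (L.length : ℝ) ≤ k := by exact_mod_cast hlen
      refine (pr_bind_le (fun χ => χ ≠ (L.filter (fun i => decide (i ∈ I))).toFinset) le_rfl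
        fun χ _ hχ => ?_).trans (le_trans (b := 1 / 200 + 0) ?_ ?_)
      · rw [monad_pure_eq, law_ret, pr_pure_of_not]
        simp only [ne_eq, not_not] at hχ ⊢
        have : insert a₁ χ = I := by
          rw [hχ]
          ext i
          simp only [Finset.mem_insert, List.mem_toFinset, List.mem_filter, hL,
            Finset.mem_toList, Finset.mem_erase, Finset.mem_univ, and_true, decide_eq_true_eq]
          constructor
          · rintro (rfl | h)
            · exact h₁
            · exact h.2
          · intro hi
            by_cases h : i = a₁
            · exact Or.inl h
            · refine Or.inr ⟨⟨?_, h⟩, hi⟩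
              rintro rfl
              exact Finset.mem_compl.1 h₂ hi
        rw [this]
      · refine add_le_add (hcl.trans ?_) le_rfl
        calc (L.length : ℝ) * δ ^ 3 ≤ (k : ℝ) * δ ^ 3 := by gcongr
          _ = 1 / (729 * (k : ℝ) ^ 2) := by rw [hδ]; field_simp; norm_num
          _ ≤ (1 : ℝ) / 200 := by
            refine one_div_le_one_div_of_le (by norm_num) ?_
            nlinarith
      · have := hβ₁ ((List.ofFn X).zip (List.ofFn Y))
        have := hβ₂ ((List.ofFn X).zip (List.ofFn Y))
        linarith
  · rw [avg_add, avg_add, avg_mul_left, avg_mul_left, avg_const hpq]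
    linarith

end

/-! ### The three regimes of MultiLFHT -/

section

variable {n k : ℕ} {ε : ℝ}

lemma costLarge_pow (n k : ℕ) (ε : ℝ) :
    costLarge n k ε ^ 3 = (n : ℝ) ^ 2 * k * Real.log k / ε ^ 4 := by
  have h : 0 ≤ (n : ℝ) ^ 2 * k * Real.log k / ε ^ 4 := by
    have := Real.log_natCast_nonneg k; positivity
  rw [costLarge, ← Real.rpow_natCast, ← Real.rpow_mul h]
  norm_num

lemma costMid_pow (n k : ℕ) (ε : ℝ) :
    costMid n k ε ^ 2 = (n : ℝ) * k * Real.log k / ε ^ 4 := by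
  have h : 0 ≤ (n : ℝ) * k * Real.log k := by
    have := Real.log_natCast_nonneg k; positivity
  rw [costMid, div_pow, Real.sq_sqrt h, ← pow_mul]

lemma costLarge_nonneg (n k : ℕ) (ε : ℝ) : 0 ≤ costLarge n k ε := by
  have := Real.log_natCast_nonneg k
  unfold costLarge; positivity

lemma costMid_nonneg (n k : ℕ) (ε : ℝ) : 0 ≤ costMid n k ε := by
  unfold costMid; positivity

lemma costSmall_nonneg (k : ℕ) (ε : ℝ) : 0 ≤ costSmall k ε := by
  have := Real.log_natCast_nonneg k
  unfold costSmall; positivity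

lemma le_mul_of_mul_pow_le {x y c M : ℝ} {j : ℕ} (hj : j ≠ 0) (hc : 0 < c) (hx : 0 ≤ x)
    (hy : 0 ≤ y) (hM : 1 ≤ M) (hMc : 1 ≤ M * c) (h : c * x ^ j ≤ y ^ j) : x ≤ M * y := by
  refine le_of_pow_le_pow_left₀ hj (by positivity) ?_
  have h1 : M ≤ M ^ j := le_self_pow₀ hM hj
  have h2 : M * (c * x ^ j) ≤ M ^ j * y ^ j := mul_le_mul h1 h (by positivity) (by positivity)
  have h3 : 1 * x ^ j ≤ M * c * x ^ j := mul_le_mul_of_nonneg_right hMc (by positivity)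
  rw [mul_pow]
  linarith

variable {c M : ℝ}

/-- Sixth powers clear the square and cube roots: the ratio `(costLarge / costMid) ^ 6` is `n ε⁴ /
(k log k)`, precisely the quantity that separates the regimes. -/
lemma costMid_le_costLarge (hε : 0 < ε) (hc : 0 < c) (hM : 1 ≤ M) (hMc : 1 ≤ M * c)
    (h : c * (k * Real.log k / ε ^ 4) ≤ n) : costMid n k ε ≤ M * costLarge n k ε := by
  have hl := Real.log_natCast_nonneg k
  refine le_mul_of_mul_pow_le (j := 6) (by norm_num) hc (costMid_nonneg _ _ _)
    (costLarge_nonneg _ _ _) hM hMc ?_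
  rw [show costMid n k ε ^ 6 = (costMid n k ε ^ 2) ^ 3 by ring,
    show costLarge n k ε ^ 6 = (costLarge n k ε ^ 3) ^ 2 by ring, costMid_pow, costLarge_pow]
  have := mul_le_mul_of_nonneg_left h
    (show 0 ≤ (n : ℝ) ^ 3 * (k * Real.log k) ^ 2 / ε ^ 8 by positivity)
  refine le_trans (le_of_eq ?_) (this.trans (le_of_eq ?_))
  · field_simp
  · field_simp

lemma costLarge_le_costMid (hε : 0 < ε) (hc : 0 < c) (hM : 1 ≤ M) (hMc : 1 ≤ M * c)
    (h : c * n ≤ k * Real.log k / ε ^ 4) : costLarge n k ε ≤ M * costMid n k ε := by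
  have hl := Real.log_natCast_nonneg k
  refine le_mul_of_mul_pow_le (j := 6) (by norm_num) hc (costLarge_nonneg _ _ _)
    (costMid_nonneg _ _ _) hM hMc ?_
  rw [show costMid n k ε ^ 6 = (costMid n k ε ^ 2) ^ 3 by ring,
    show costLarge n k ε ^ 6 = (costLarge n k ε ^ 3) ^ 2 by ring, costMid_pow, costLarge_pow]
  have := mul_le_mul_of_nonneg_left h
    (show 0 ≤ (n : ℝ) ^ 3 * (k * Real.log k) ^ 2 / ε ^ 8 by positivity)
  refine le_trans (le_of_eq ?_) (this.trans (le_of_eq ?_))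
  · field_simp
  · field_simp

lemma costSmall_le_costMid (hc : 0 < c) (hM : 1 ≤ M) (hMc : 1 ≤ M * c)
    (h : c * (k * Real.log k) ≤ n) : costSmall k ε ≤ M * costMid n k ε := by
  have hl := Real.log_natCast_nonneg k
  refine le_mul_of_mul_pow_le (j := 2) (by norm_num) hc (costSmall_nonneg _ _)
    (costMid_nonneg _ _ _) hM hMc ?_
  rw [costMid_pow, costSmall]
  have := mul_le_mul_of_nonneg_left h (show 0 ≤ (k * Real.log k) / ε ^ 4 by positivity)
  refine le_trans (le_of_eq ?_) (this.trans (le_of_eq ?_)) <;> ring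

lemma costMid_le_costSmall (hc : 0 < c) (hM : 1 ≤ M) (hMc : 1 ≤ M * c)
    (h : c * n ≤ k * Real.log k) : costMid n k ε ≤ M * costSmall k ε := by
  have hl := Real.log_natCast_nonneg k
  refine le_mul_of_mul_pow_le (j := 2) (by norm_num) hc (costMid_nonneg _ _ _)
    (costSmall_nonneg _ _) hM hMc ?_
  rw [costMid_pow, costSmall]
  have := mul_le_mul_of_nonneg_left h (show 0 ≤ (k * Real.log k) / ε ^ 4 by positivity)
  refine le_trans (le_of_eq ?_) (this.trans (le_of_eq ?_)) <;> ring

lemma le_div_pow_four (hε : 0 < ε) (hε1 : ε ≤ 1) : k * Real.log k ≤ k * Real.log k / ε ^ 4 := by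
  have hl := Real.log_natCast_nonneg k
  rw [le_div_iff₀ (by positivity)]
  exact mul_le_of_le_one_right (by positivity) (pow_le_one₀ hε.le hε1)

/-- The thresholds between regimes are where consecutive costs cross, so `lfhtSize` is the maximum
of the three. -/
lemma le_lfhtSize (hε : 0 < ε) (hε1 : ε ≤ 1) : costLarge n k ε ≤ lfhtSize n k ε ∧
    costMid n k ε ≤ lfhtSize n k ε ∧ costSmall k ε ≤ lfhtSize n k ε := by
  have h4 := le_div_pow_four (k := k) hε hε1
  unfold lfhtSize
  split_ifs with h1 h2
  · have a1 := costMid_le_costLarge (n := n) (k := k) (c := 1) (M := 1) hε one_pos le_rfl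
      (by norm_num) (by linarith)
    have a2 := costSmall_le_costMid (n := n) (k := k) (ε := ε) (c := 1) (M := 1) one_pos le_rfl
      (by norm_num) (by linarith)
    refine ⟨le_rfl, ?_, ?_⟩ <;> linarith
  · have a1 := costLarge_le_costMid (n := n) (k := k) (c := 1) (M := 1) hε one_pos le_rfl
      (by norm_num) (by linarith)
    have a2 := costSmall_le_costMid (n := n) (k := k) (ε := ε) (c := 1) (M := 1) one_pos le_rfl
      (by norm_num) (by linarith)
    refine ⟨?_, le_rfl, ?_⟩ <;> linarith
  · have a1 := costLarge_le_costMid (n := n) (k := k) (c := 1) (M := 1) hε one_pos le_rfl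
      (by norm_num) (by linarith)
    have a2 := costMid_le_costSmall (n := n) (k := k) (ε := ε) (c := 1) (M := 1) one_pos le_rfl
      (by norm_num) (by linarith)
    refine ⟨?_, ?_, le_rfl⟩ <;> linarith

lemma lfhtSize_le {x : ℝ} (hl : costLarge n k ε ≤ x) (hm : costMid n k ε ≤ x)
    (hs : costSmall k ε ≤ x) : lfhtSize n k ε ≤ x := by
  unfold lfhtSize; split_ifs <;> assumption

/-- A number of samples of the order of `costFind + lfhtSize` obeys the bounds, for any choice of
the constants in the conditions on `n`. -/
lemma sampleBound_of_le (hε : 0 < ε) (hε1 : ε ≤ 1) (hc : 0 < c) {A : ℝ} (hA : 0 ≤ A) {r N : ℕ}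
    (hf : 0 ≤ costFind n k r ε)
    (hN : (N : ℝ) ≤ A * (costFind n k r ε + lfhtSize n k ε)) :
    SampleBound c (A * max 1 (1 / c) ^ 2) n k r ε N := by
  set M := max 1 (1 / c) with hMdef
  have hM : 1 ≤ M := le_max_left _ _
  have hMc : 1 ≤ M * c := by
    have : 1 / c ≤ M := le_max_right _ _
    rwa [div_le_iff₀ hc] at this
  have hM2 : 1 ≤ M ^ 2 := one_le_pow₀ hM
  have hMM : M ≤ M ^ 2 := by nlinarith
  have hlog := Real.log_natCast_nonneg k
  have h4 := le_div_pow_four (k := k) hε hε1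
  have hcl := costLarge_nonneg n k ε
  have hcm := costMid_nonneg n k ε
  have hcs := costSmall_nonneg k ε
  -- Moving a threshold by the factor `c` costs a factor `M` per comparison of neighbouring regimes;
  -- at most two comparisons are chained, whence `M ^ 2`.
  have key : ∀ x, lfhtSize n k ε ≤ M ^ 2 * x →
      (N : ℝ) ≤ A * M ^ 2 * (costFind n k r ε + x) := by
    intro x hx
    have h1 : costFind n k r ε + lfhtSize n k ε ≤ M ^ 2 * (costFind n k r ε + x) := by nlinarith
    have h2 := mul_le_mul_of_nonneg_left h1 hA
    linarith
  refine ⟨fun h => key _ ?_, fun h h' => key _ ?_, fun h => key _ ?_⟩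
  · have a1 := costMid_le_costLarge hε hc hM hMc h
    have a2 := costSmall_le_costMid (ε := ε) hc hM hMc
      ((mul_le_mul_of_nonneg_left h4 hc.le).trans h)
    refine lfhtSize_le ?_ ?_ ?_ <;> nlinarith
  · have a1 := costLarge_le_costMid hε hc hM hMc h'
    have a2 := costSmall_le_costMid (ε := ε) hc hM hMc h
    refine lfhtSize_le ?_ ?_ ?_ <;> nlinarith
  · have a1 := costLarge_le_costMid hε hc hM hMc (h.trans h4)
    have a2 := costMid_le_costSmall (ε := ε) hc hM hMc h
    refine lfhtSize_le ?_ ?_ ?_ <;> nlinarith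

lemma one_half_le_log (hk : 2 ≤ k) : 1 / 2 ≤ Real.log k := by
  have h1 : Real.log 2 ≤ Real.log k := Real.log_le_log (by norm_num) (by exact_mod_cast hk)
  have := Real.log_two_gt_d9
  linarith

/-- The three lower bounds on the number of samples of MultiLFHT. -/
lemma lfhtSize_lower (hε : 0 < ε) (hε1 : ε ≤ 1) :
    k * Real.log k ≤ lfhtSize n k ε * ε ^ 2 ∧
    n * (k * Real.log k) ≤ lfhtSize n k ε ^ 2 * ε ^ 4 ∧
    n ^ 2 * (k * Real.log k) ≤ lfhtSize n k ε ^ 3 * ε ^ 4 := by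
  obtain ⟨h1, h2, h3⟩ := le_lfhtSize (n := n) (k := k) hε hε1
  refine ⟨?_, ?_, ?_⟩
  · rw [← div_le_iff₀ (by positivity)]
    exact h3
  · rw [← div_le_iff₀ (by positivity)]
    have := pow_le_pow_left₀ (costMid_nonneg n k ε) h2 2
    rw [costMid_pow] at this
    rwa [← mul_assoc]
  · rw [← div_le_iff₀ (by positivity)]
    have := pow_le_pow_left₀ (costLarge_nonneg n k ε) h1 3
    rw [costLarge_pow] at this
    rwa [← mul_assoc]

/-- This makes the block size `h` of order `T / (k log k)`; the additive constants are absorbed by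
`log k ≥ 1/2`. -/
lemma votes_ninth_le (hk : 2 ≤ k) : (votes (1 / (9 * k)) : ℝ) ≤ 200 * Real.log k := by
  have h1 := one_half_le_log hk
  have hk' : (0 : ℝ) < k := by positivity
  have h2 : Real.log 9 ≤ 2.21 := by
    have h3 : Real.log 9 ≤ Real.log (2 ^ 3 * (9 / 8)) := by norm_num
    rw [Real.log_mul (by norm_num) (by norm_num), Real.log_pow] at h3
    have h4 := Real.log_le_sub_one_of_pos (show (0 : ℝ) < 9 / 8 by norm_num)
    have := Real.log_two_lt_d9
    norm_num at h3 h4 ⊢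
    linarith
  have h3 : 30 * Real.log (1 / (1 / (9 * k))) = 30 * (Real.log 9 + Real.log k) := by
    rw [one_div_one_div, Real.log_mul (by norm_num) hk'.ne']
  have h4 := Nat.ceil_lt_add_one (a := 30 * Real.log (1 / (1 / (9 * (k : ℝ)))))
    (by rw [h3]; have := Real.log_nonneg (show (1 : ℝ) ≤ 9 by norm_num); positivity)
  change (⌈_⌉₊ : ℝ) ≤ _
  rw [h3] at h4 ⊢
  linarith

lemma three_le_votes_ninth (hk : 2 ≤ k) : 3 ≤ votes (1 / (9 * k)) := by
  have hk' : (2 : ℝ) ≤ k := by exact_mod_cast hk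
  have h1 : Real.log 2 ≤ Real.log (9 * k) := Real.log_le_log (by norm_num) (by linarith)
  have := Real.log_two_gt_d9
  have h2 : 30 * Real.log (1 / (1 / (9 * (k : ℝ)))) ≤ votes (1 / (9 * k)) := Nat.le_ceil _
  rw [one_div_one_div] at h2
  have : (3 : ℝ) ≤ votes (1 / (9 * k)) := by linarith
  exact_mod_cast this

lemma sub_one_le_natDiv (a b : ℕ) (hb : 0 < b) : (a : ℝ) / b - 1 ≤ (a / b : ℕ) := by
  have h1 : a < b * (a / b + 1) := by
    have := Nat.lt_div_mul_add (a := a) hb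
    linarith [mul_comm b (a / b)]
  have h2 : (a : ℝ) < b * ((a / b : ℕ) + 1) := by exact_mod_cast h1
  have hb' : (0 : ℝ) < b := by exact_mod_cast hb
  rw [sub_le_iff_le_add, div_le_iff₀ hb']
  linarith

/-- The constant of MultiLFHT. -/
def lfhtConst : ℝ := 10 ^ 31

variable {D : Fin k → PMF (Fin n)}

lemma pr_multiLFHT_lfhtConst_le {I : Finset (Fin k)} (hε : 0 < ε) (hε1 : ε ≤ 1)
    (hI : IsHiddenPartition ε D I) {a₁ a₂ : Fin k} (h₁ : a₁ ∈ I) (h₂ : a₂ ∈ Iᶜ) :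
    pr (law D (multiLFHT lfhtTest lfhtConst ε a₁ a₂)) (fun o => o ≠ {I, Iᶜ}) ≤ 1 / 100 := by
  have hk : 2 ≤ k := by
    by_contra! hlt
    have : a₁ = a₂ := by ext; omega
    exact Finset.mem_compl.1 h₂ (this ▸ h₁)
  have hk' : (2 : ℝ) ≤ k := by exact_mod_cast hk
  have hlog := one_half_le_log hk
  obtain ⟨t1, t2, t3⟩ := lfhtSize_lower (n := n) (k := k) hε hε1
  set T := lfhtSize n k ε with hT
  set ℓ := k * Real.log k with hℓ
  have hℓ1 : 1 ≤ ℓ := by rw [hℓ]; nlinarith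
  have hTℓ : ℓ ≤ T := by
    have h5 : T * ε ^ 2 ≤ T := by
      have h6 : 0 < T := by
        by_contra! h0
        have := mul_nonpos_of_nonpos_of_nonneg h0 (sq_nonneg ε)
        linarith
      exact mul_le_of_le_one_right h6.le (pow_le_one₀ hε.le hε1)
    linarith
  have hT0 : 0 < T := by linarith
  set R := votes (1 / (9 * k)) with hR
  have hR1 := votes_ninth_le hk
  have hR3 := three_le_votes_ninth hk
  rw [← hR] at hR1 hR3
  set s₁ := ⌈lfhtConst * T⌉₊ with hs₁
  set s₂ := ⌈lfhtConst * T / k⌉₊ with hs₂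
  have hs : 10 ^ 29 * T ≤ ((s₁ / 3 : ℕ) : ℝ) := by
    have h5 := sub_one_le_natDiv s₁ 3 (by norm_num)
    have h6 : lfhtConst * T ≤ s₁ := Nat.le_ceil _
    unfold lfhtConst at h6
    push_cast at h5
    linarith
  -- `10 ^ 31 / 200` is `5 * 10 ^ 28`, and the 1 lost to integer division is absorbed since `T / ℓ ≥
  -- 1`.
  have hh : 10 ^ 28 * 2 * (T / ℓ) ≤ ((s₂ / R : ℕ) : ℝ) := by
    have h5 := sub_one_le_natDiv s₂ R (by omega)
    have h6 : lfhtConst * T / k ≤ s₂ := Nat.le_ceil _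
    have hR0 : (0 : ℝ) < R := by exact_mod_cast (by omega : 0 < R)
    have h7 : lfhtConst * T / k / (200 * Real.log k) ≤ s₂ / R := by
      unfold lfhtConst at *
      gcongr
    have h8 : lfhtConst * T / k / (200 * Real.log k) = 5 * 10 ^ 28 * (T / ℓ) := by
      rw [hℓ, lfhtConst]; field_simp; norm_num
    have h9 : 1 ≤ T / ℓ := by rwa [one_le_div (by linarith)]
    linarith
  have h9 : 1 ≤ T / ℓ := by rwa [one_le_div (by linarith)]
  have hhs : s₂ / R ≤ s₁ / 3 := by
    refine Nat.div_le_div (Nat.ceil_mono ?_) hR3 (by norm_num)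
    refine div_le_self ?_ (by linarith)
    unfold lfhtConst; positivity
  set s := s₁ / 3
  set h := s₂ / R
  have hs0 : (0 : ℝ) ≤ s := Nat.cast_nonneg _
  have hh0 : (0 : ℝ) < h := by linarith
  have hh00 : 0 < h := by exact_mod_cast hh0
  have hn0 : (0 : ℝ) ≤ n := Nat.cast_nonneg _
  -- The bounds `e1`, `e2`, `e3` come from the small, middle and large cost respectively. Each has a
  -- spare factor 2 over `M = 10 ^ 28`, so that two of them can be averaged to bound a sum such as
  -- `n + s`.
  have e1 : 10 ^ 28 * 2 ≤ h * ε ^ 2 := by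
    have h10 : ℓ / ℓ ≤ T * ε ^ 2 / ℓ := by gcongr
    rw [div_self (by linarith)] at h10
    have h11 := mul_le_mul_of_nonneg_right hh (sq_nonneg ε)
    have h12 : 10 ^ 28 * 2 * (T / ℓ) * ε ^ 2 = 10 ^ 28 * 2 * (T * ε ^ 2 / ℓ) := by ring
    linarith
  have e2 : 10 ^ 28 * 2 * n ≤ s * h * ε ^ 4 := by
    have h10 : n * ℓ / ℓ ≤ T ^ 2 * ε ^ 4 / ℓ := by gcongr
    rw [mul_div_cancel_right₀ _ (by linarith)] at h10
    have h11 : 10 ^ 29 * T * (10 ^ 28 * 2 * (T / ℓ)) * ε ^ 4 ≤ s * h * ε ^ 4 := by gcongr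
    have h12 : 10 ^ 29 * T * (10 ^ 28 * 2 * (T / ℓ)) * ε ^ 4 =
        10 ^ 57 * 2 * (T ^ 2 * ε ^ 4 / ℓ) := by ring
    linarith
  have e3 : 10 ^ 28 * 2 * n ^ 2 ≤ s ^ 2 * h * ε ^ 4 := by
    have h10 : n ^ 2 * ℓ / ℓ ≤ T ^ 3 * ε ^ 4 / ℓ := by gcongr
    rw [mul_div_cancel_right₀ _ (by linarith)] at h10
    have h11 : (10 ^ 29 * T) ^ 2 * (10 ^ 28 * 2 * (T / ℓ)) * ε ^ 4 ≤ s ^ 2 * h * ε ^ 4 := by gcongr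
    have h12 : (10 ^ 29 * T) ^ 2 * (10 ^ 28 * 2 * (T / ℓ)) * ε ^ 4 =
        10 ^ 86 * 2 * (T ^ 3 * ε ^ 4 / ℓ) := by ring
    have h13 : (0 : ℝ) ≤ n ^ 2 := by positivity
    linarith
  refine pr_multiLFHT_le (s := s) (h := h) hε hI h₁ h₂ rfl rfl hh00 hhs ?_ ?_
  · have h10 : s * h * ε ^ 4 ≤ s * h * ε ^ 2 := by
      have : ε ^ 4 ≤ ε ^ 2 := pow_le_pow_of_le_one hε.le hε1 (by norm_num)
      gcongr
    have h11 := mul_le_mul_of_nonneg_left e1 hs0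
    linarith
  · have h11 := mul_le_mul_of_nonneg_left e2 hs0
    linarith

lemma costLE_classify {test : Fin k → SampleAlg k n Bool} {N : ℕ}
    (h : ∀ i, CostLE D (test i) N) (l : List (Fin k)) :
    CostLE D (classify test l) (l.length * N) := by
  induction l with
  | nil => exact costLE_ret _ _
  | cons i l ih =>
    rw [List.length_cons, add_mul, one_mul, add_comm (_ * _)]
    exact (h i).bind fun b _ => ih.bind (N := 0) fun χ _ => costLE_ret _ _

lemma exists_costLE_multiLFHT (hε : 0 < ε) (hε1 : ε ≤ 1) (hk : 2 ≤ k) (a₁ a₂ : Fin k) :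
    ∃ N : ℕ, CostLE D (multiLFHT lfhtTest lfhtConst ε a₁ a₂) N ∧
      (N : ℝ) ≤ 10 ^ 32 * lfhtSize n k ε := by
  set s₁ := ⌈lfhtConst * lfhtSize n k ε⌉₊ with hs₁
  set s₂ := ⌈lfhtConst * lfhtSize n k ε / k⌉₊ with hs₂
  refine ⟨s₁ * 1 + (s₁ * 1 + (k * (s₂ * 1) + 0)), ?_, ?_⟩
  · refine (costLE_iid (costLE_draw a₁) s₁).bind fun X _ =>
      (costLE_iid (costLE_draw a₂) s₁).bind fun Y _ => CostLE.bind ?_ fun χ _ => costLE_ret _ _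
    refine (costLE_classify (N := s₂ * 1) (fun i => ?_) _).mono (Nat.mul_le_mul_right _ ?_)
    · exact (costLE_iid (costLE_draw i) s₂).bind (N := 0) fun Z _ => costLE_rand _
    · rw [Finset.length_toList]
      exact (Finset.card_le_univ _).trans_eq (Fintype.card_fin k)
  · have hk' : (2 : ℝ) ≤ k := by exact_mod_cast hk
    have hlog := one_half_le_log hk
    obtain ⟨t1, -, -⟩ := lfhtSize_lower (n := n) (k := k) hε hε1
    set T := lfhtSize n k ε
    have hℓ1 : k / 2 ≤ k * Real.log k := by nlinarith
    have hT0 : 0 < T := by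
      by_contra! h0
      have := mul_nonpos_of_nonpos_of_nonneg h0 (sq_nonneg ε)
      linarith
    have h5 : T * ε ^ 2 ≤ T := mul_le_of_le_one_right hT0.le (pow_le_one₀ hε.le hε1)
    have hC : (0 : ℝ) ≤ lfhtConst := by unfold lfhtConst; positivity
    have h6 : (s₁ : ℝ) < lfhtConst * T + 1 := Nat.ceil_lt_add_one (by positivity)
    have h7 : (s₂ : ℝ) < lfhtConst * T / k + 1 := Nat.ceil_lt_add_one (by positivity)
    have h8 : (k : ℝ) * s₂ ≤ k * (lfhtConst * T / k + 1) := by gcongr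
    have h9 : k * (lfhtConst * T / k + 1) = lfhtConst * T + k := by field_simp
    push_cast
    unfold lfhtConst at *
    linarith

end

/-! ### The equivalence test for a distribution of small norm -/

section

variable {α : Type*} [Fintype α] {p q : α → ℝ}

/-- The norm of `q` is traded for the distance, through `8 p² + 2 (p - q)² - (p + q)² = (3 p - q)²`.
Hence flattening has to tame only the reference distribution. -/
lemma sqNorm_one_le (p q : α → ℝ) :
    sqNorm (fun _ => 1) p q ≤ 8 * ∑ z, p z ^ 2 + 2 * sqDist (fun _ => 1) p q := by
  simp only [sqNorm, sqDist, Finset.mul_sum, ← Finset.sum_add_distrib]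
  exact Finset.sum_le_sum fun z _ => by nlinarith [sq_nonneg (3 * p z - q z)]

/-- Cauchy–Schwarz, followed by the comparison of the ℓ⁴ and ℓ² norms of `p - q`. -/
lemma varDir_one_sq_le (p q : α → ℝ) :
    varDir (fun _ => 1) p q ^ 2 ≤ sqNorm (fun _ => 1) p q * sqDist (fun _ => 1) p q ^ 2 := by
  have h1 : varDir (fun _ => 1) p q ^ 2 ≤
      (∑ z, (p z + q z) ^ 2) * ∑ z, ((p z - q z) ^ 2) ^ 2 := by
    have := Finset.sum_mul_sq_le_sq_mul_sq Finset.univ (fun z => p z + q z)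
      fun z => (p z - q z) ^ 2
    simpa [varDir] using this
  have h2 : ∑ z, ((p z - q z) ^ 2) ^ 2 ≤ (∑ z, (p z - q z) ^ 2) ^ 2 :=
    Finset.sum_sq_le_sq_sum_of_nonneg fun z _ => sq_nonneg _
  have h3 : 0 ≤ ∑ z, (p z + q z) ^ 2 := Finset.sum_nonneg fun z _ => sq_nonneg _
  simpa [sqNorm, sqDist] using h1.trans (mul_le_mul_of_nonneg_left h2 h3)

lemma avg_not_blockPositive_le_of_norm (hp : IsProb p) (hq : IsProb q) {h : ℕ} (hh : 0 < h)
    (hN : 0 < sqDist (fun _ => 1) p q)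
    (h1 : 10 ^ 6 * (8 * ∑ z, p z ^ 2 + 2 * sqDist (fun _ => 1) p q) ≤
      h ^ 2 * sqDist (fun _ => 1) p q ^ 2) :
    avg (prodWt p q) (2 * h) (fun l => ind (¬ blockPositive h l)) ≤ 1 / 30 := by
  refine (avg_not_blockPositive_le hp hq hh hN).trans ?_
  have h2 := sqNorm_one_le p q
  have h3 := varDir_one_sq_le p q
  have h4 := varDir_nonneg hp hq fun _ => 1
  have h5 := sqNorm_nonneg (p := p) (q := q) fun _ => 1
  have hh' : (0 : ℝ) < h := by exact_mod_cast hh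
  set N := sqDist (fun _ => 1) p q
  set V1 := varDir (fun _ => 1) p q
  set V2 := sqNorm (fun _ => 1) p q
  have h6 : 10 ^ 6 * V2 ≤ h ^ 2 * N ^ 2 := by linarith
  have h7 : 1000 * V1 ≤ h * N ^ 2 := by
    refine le_of_pow_le_pow_left₀ two_ne_zero (by positivity) ?_
    have := mul_le_mul_of_nonneg_right h6 (sq_nonneg N)
    nlinarith
  have h8 : 8 * V1 / (h * N ^ 2) ≤ 8 / 1000 := by
    rw [div_le_div_iff₀ (by positivity) (by norm_num)]; linarith
  have h9 : 4 * V2 / (h ^ 2 * N ^ 2) ≤ 4 / 10 ^ 6 := by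
    rw [div_le_div_iff₀ (by positivity) (by norm_num)]; linarith
  norm_num at *
  linarith

end

/-! ### Flattening -/

section

variable {k n s : ℕ} {D : Fin k → PMF (Fin n)}

/-- The multiplicity of `x` among the samples. -/
abbrev mult (S : Fin s → Fin n) (x : Fin n) : ℕ := (Finset.univ.filter fun t => S t = x).card

lemma mult_eq_count (S : Fin s → Fin n) (x : Fin n) : mult S x = (List.ofFn S).count x := by
  rw [List.count, List.countP_eq_length_filter, List.ofFn_eq_map, List.filter_map,
    List.length_map, mult]
  rw [← List.toFinset_card_of_nodup ((List.nodup_finRange s).filter _)]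
  congr 1
  ext t
  simp

lemma sum_mult (S : Fin s → Fin n) : ∑ x, mult S x = s := by
  have := Finset.card_eq_sum_card_fiberwise (s := (Finset.univ : Finset (Fin s)))
    (t := Finset.univ) (f := S) (by simp)
  simpa using this.symm

lemma wt_drawFlat (S : Fin s → Fin n) (i : Fin k) (z : Flat S) :
    wt (law D (drawFlat S i)) z = wt (D i) z.1 / ((mult S z.1 : ℝ) + 1) := by
  obtain ⟨x, j⟩ := z
  simp only [drawFlat, monad_bind_eq, monad_pure_eq, law_bind, law_draw, law_rand, law_ret, wt]
  have h : ∀ x', ((PMF.uniformOfFintype (Fin (mult S x' + 1))).bind fun j' =>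
      PMF.pure (⟨x', j'⟩ : Flat S)) ⟨x, j⟩ =
      if x' = x then ((mult S x : ℝ≥0∞) + 1)⁻¹ else 0 := by
    intro x'
    rw [PMF.bind_apply, tsum_fintype]
    by_cases hx : x' = x
    · subst hx
      rw [Finset.sum_eq_single j]
      · simp
      · intro j' _ hj
        rw [PMF.pure_apply_of_ne, mul_zero]
        intro h0
        simp only [Sigma.mk.injEq, heq_eq_eq, true_and] at h0
        exact hj h0.symm
      · simp
    · rw [if_neg hx]
      refine Finset.sum_eq_zero fun j' _ => ?_
      rw [PMF.pure_apply_of_ne, mul_zero]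
      intro h0
      exact hx (congrArg Sigma.fst h0).symm
  rw [PMF.bind_apply, tsum_fintype, Finset.sum_eq_single x]
  · rw [h, if_pos rfl, ENNReal.toReal_mul, ENNReal.toReal_inv, div_eq_mul_inv,
      ENNReal.toReal_add (ENNReal.natCast_ne_top _) ENNReal.one_ne_top]
    simp
  · intro x' _ hx
    rw [h, if_neg hx, mul_zero]
  · simp

lemma sum_flat (S : Fin s → Fin n) (F : Fin n → ℝ) :
    ∑ z : Flat S, F z.1 = ∑ x, ((mult S x : ℝ) + 1) * F x := by
  rw [Fintype.sum_sigma]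
  exact Finset.sum_congr rfl fun x _ => by simp

lemma sum_drawFlat_sq (S : Fin s → Fin n) (i : Fin k) :
    ∑ z, wt (law D (drawFlat S i)) z ^ 2 =
      ∑ x, wt (D i) x ^ 2 * (1 / (((List.ofFn S).count x : ℝ) + 1)) := by
  simp only [wt_drawFlat]
  rw [sum_flat S fun x => (wt (D i) x / ((mult S x : ℝ) + 1)) ^ 2]
  refine Finset.sum_congr rfl fun x _ => ?_
  rw [← mult_eq_count]
  have : (mult S x : ℝ) + 1 ≠ 0 := by positivity
  field_simp

/-- Splitting elements into equally likely copies keeps the ℓ¹ distance, and the flattened domain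
has `n + s` elements; Cauchy–Schwarz does the rest. -/
lemma le_sqDist_drawFlat (S : Fin s → Fin n) {i j : Fin k} {ε : ℝ} (hε : 0 ≤ ε)
    (h : ε ≤ tv (D i) (D j)) :
    4 * ε ^ 2 ≤ (n + s) *
      sqDist (fun _ => 1) (wt (law D (drawFlat S i))) (wt (law D (drawFlat S j))) := by
  set p := wt (law D (drawFlat S i)) with hp
  set q := wt (law D (drawFlat S j)) with hq
  have h1 : ∑ z, |p z - q z| = ∑ x, |wt (D i) x - wt (D j) x| := by
    simp only [hp, hq, wt_drawFlat]
    rw [sum_flat S fun x => |wt (D i) x / ((mult S x : ℝ) + 1) - wt (D j) x / ((mult S x : ℝ) + 1)|]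
    refine Finset.sum_congr rfl fun x _ => ?_
    have : (0 : ℝ) < (mult S x : ℝ) + 1 := by positivity
    rw [← sub_div, abs_div, abs_of_pos this]
    field_simp
  have h2 : ∑ z : Flat S, (1 : ℝ) ^ 2 = n + s := by
    simp only [one_pow]
    rw [sum_flat S fun _ => 1]
    simp only [mul_one, Finset.sum_add_distrib, ← Nat.cast_sum, sum_mult]
    simp [add_comm]
  have h3 : (∑ z, |p z - q z|) ^ 2 ≤ (n + s) * sqDist (fun _ => 1) p q := by
    have := Finset.sum_mul_sq_le_sq_mul_sq Finset.univ (fun _ : Flat S => (1 : ℝ))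
      fun z => |p z - q z|
    rw [h2] at this
    simpa [sqDist, sq_abs] using this
  have h4 : 2 * ε ≤ ∑ z, |p z - q z| := by
    rw [h1]
    unfold tv at h
    unfold wt
    linarith
  have h5 := pow_le_pow_left₀ (by positivity) h4 2
  linarith

end

/-! ### The Poisson variable -/

section

lemma wt_poisson {r : ℝ} (hr : 0 ≤ r) (s : ℕ) :
    ((ProbabilityTheory.poissonMeasure r.toNNReal).toPMF s).toReal =
      Real.exp (-r) * r ^ s / s.factorial := by
  rw [MeasureTheory.Measure.toPMF_apply, ← MeasureTheory.measureReal_def,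
    ProbabilityTheory.poissonMeasure_real_singleton, Real.coe_toNNReal _ hr]

lemma hasSum_pow_div_factorial (r : ℝ) :
    HasSum (fun s : ℕ => r ^ s / s.factorial) (Real.exp r) := by
  rw [Real.exp_eq_exp_ℝ]
  exact NormedSpace.expSeries_div_hasSum_exp r

lemma hasSum_poisson_one (r : ℝ) :
    HasSum (fun s => ((ProbabilityTheory.poissonMeasure r.toNNReal).toPMF s).toReal) 1 := by
  have := (summable_toReal (ProbabilityTheory.poissonMeasure r.toNNReal).toPMF).hasSum
  rwa [tsum_toReal] at this

/-- The third factorial moment of a Poisson variable. -/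
lemma hasSum_poisson_descFactorial {r : ℝ} (hr : 0 ≤ r) :
    HasSum (fun s => ((ProbabilityTheory.poissonMeasure r.toNNReal).toPMF s).toReal *
      (s.descFactorial 3 : ℝ)) (r ^ 3) := by
  simp only [wt_poisson hr]
  -- The terms at 0, 1, 2 vanish, and the shifted series is `r ^ 3` times the exponential one.
  rw [← hasSum_nat_add_iff' 3]
  have h := ((hasSum_pow_div_factorial r).mul_left (r ^ 3 * Real.exp (-r)))
  rw [mul_assoc, ← Real.exp_add, neg_add_cancel, Real.exp_zero, mul_one] at h
  convert h using 1
  · rfl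
  · funext s
    have h1 : ((s + 3).factorial : ℝ) = s.factorial * (s + 3).descFactorial 3 := by
      have := Nat.factorial_mul_descFactorial (n := s + 3) (k := 3) (by omega)
      rw [Nat.add_sub_cancel] at this
      exact_mod_cast this.symm
    have h2 : ((s + 3).descFactorial 3 : ℝ) ≠ 0 := by
      have : 0 < (s + 3).descFactorial 3 := Nat.descFactorial_pos.2 (by omega)
      exact_mod_cast this.ne'
    have h3 : (s.factorial : ℝ) ≠ 0 := by exact_mod_cast s.factorial_ne_zero
    rw [h1]
    field_simp
    ring
  · simp [Finset.sum_range_succ, Nat.descFactorial]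

lemma hasSum_poisson_inv {r : ℝ} (hr : 0 < r) :
    HasSum (fun s => ((ProbabilityTheory.poissonMeasure r.toNNReal).toPMF s).toReal *
      (1 / ((s : ℝ) + 1))) ((1 - Real.exp (-r)) / r) := by
  simp only [wt_poisson hr.le]
  have h := (hasSum_nat_add_iff' 1).2 (hasSum_pow_div_factorial r)
  have h := h.mul_left (Real.exp (-r) / r)
  convert h using 1
  · rfl
  · funext s
    rw [Nat.factorial_succ]
    have h3 : (s.factorial : ℝ) ≠ 0 := by exact_mod_cast s.factorial_ne_zero
    push_cast
    field_simp
    ring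
  · simp only [Finset.range_one, Finset.sum_singleton, pow_zero, Nat.factorial_zero, Nat.cast_one,
      div_one]
    rw [Real.exp_neg]
    have := Real.exp_ne_zero r
    field_simp

/-- A bound on the indicator of the event that a Poisson variable is more than twice its mean. -/
lemma exists_descFactorial_bound {r : ℝ} (hr : 2 ≤ r) :
    ∃ J : ℝ, 0 < J ∧ r ^ 3 / J ≤ 25 / 96 ∧ ∀ s : ℕ, 2 * r < s → 1 ≤ (s.descFactorial 3 : ℝ) / J := by
  set j := ⌊2 * r⌋₊ + 1 with hj
  have h1 : 2 * r < j := by rw [hj]; exact_mod_cast Nat.lt_floor_add_one (2 * r)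
  have h4 : 4 ≤ ⌊2 * r⌋₊ := Nat.le_floor (by push_cast; linarith)
  have h5 : 5 ≤ j := by omega
  have h5' : (5 : ℝ) ≤ j := by exact_mod_cast h5
  have hJ : (j.descFactorial 3 : ℝ) = j * (j - 1) * (j - 2) := by
    simp only [Nat.descFactorial_succ, Nat.descFactorial_zero, Nat.cast_mul, Nat.sub_zero]
    rw [Nat.cast_sub (by omega), Nat.cast_sub (by omega)]
    push_cast; ring
  have hJ0 : (0 : ℝ) < j.descFactorial 3 := by
    exact_mod_cast Nat.descFactorial_pos.2 (show 3 ≤ j by omega)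
  refine ⟨j.descFactorial 3, hJ0, ?_, fun s hs => ?_⟩
  · rw [div_le_div_iff₀ hJ0 (by norm_num), hJ]
    have h6 : (2 * r) ^ 3 ≤ (j : ℝ) ^ 3 := pow_le_pow_left₀ (by linarith) h1.le 3
    -- Equality holds at `j = 5`, the least value allowed by `r ≥ 2`. With `(2 r)³ ≤ j³` this gives
    -- `25 / (8 * 12) = 25 / 96`.
    have h7 : 12 * (j : ℝ) ^ 2 ≤ 25 * ((j - 1) * (j - 2)) := by nlinarith
    have h8 := mul_le_mul_of_nonneg_left h7 (show (0 : ℝ) ≤ j by linarith)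
    nlinarith
  · rw [one_le_div hJ0]
    have : j ≤ s := by
      rw [hj, Nat.succ_le_iff, Nat.floor_lt (by linarith)]
      exact hs
    exact_mod_cast Nat.descFactorial_le 3 this

end

/-! ### Find-One-Unknown -/

section

variable {k n : ℕ} {D : Fin k → PMF (Fin n)}

lemma pr_firstDifferent_ne_le {test : Fin k → SampleAlg k n Bool} (P : Fin k → Prop)
    [DecidablePred P] {η : ℝ} (hη : 0 ≤ η) (l : List (Fin k))
    (h : ∀ i ∈ l, pr (law D (test i)) (fun o => o ≠ decide (P i)) ≤ η) :
    pr (law D (firstDifferent test l)) (fun o => o ≠ l.find? (fun i => decide (P i))) ≤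
      l.length * η := by
  induction l with
  | nil =>
    rw [firstDifferent, monad_pure_eq, law_ret, pr_pure_of_not (by simp)]
    simp
  | cons i l ih =>
    have ih := ih fun j hj => h j (List.mem_cons_of_mem _ hj)
    have hi := h i List.mem_cons_self
    rw [firstDifferent, monad_bind_eq, law_bind, List.length_cons]
    have hl : 0 ≤ (l.length : ℝ) * η := by positivity
    refine (pr_bind_le (fun o => o ≠ decide (P i)) hl fun o _ ho => ?_).trans
      (by push_cast; linarith)
    simp only [ne_eq, not_not] at ho
    subst ho
    by_cases hP : P i
    · simp only [hP, decide_true, if_true, monad_pure_eq, law_ret, List.find?_cons_of_pos]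
      rw [pr_pure_of_not (by simp)]
      exact hl
    · simpa [hP, List.find?_cons_of_neg] using ih

/-- The tests on indices with `P` may answer anything: stopping there is never a false discovery. -/
lemma pr_firstDifferent_false_le {test : Fin k → SampleAlg k n Bool} (P : Fin k → Prop) {η : ℝ}
    (hη : 0 ≤ η) (l : List (Fin k))
    (h : ∀ i ∈ l, ¬ P i → pr (law D (test i)) (fun o => o = true) ≤ η) :
    pr (law D (firstDifferent test l)) (fun o => ∃ j, o = some j ∧ ¬ P j) ≤ l.length * η := by
  induction l with
  | nil =>
    rw [firstDifferent, monad_pure_eq, law_ret, pr_pure_of_not (by simp)]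
    simp
  | cons i l ih =>
    have ih := ih fun j hj => h j (List.mem_cons_of_mem _ hj)
    rw [firstDifferent, monad_bind_eq, law_bind, List.length_cons]
    have hl : 0 ≤ (l.length : ℝ) * η := by positivity
    by_cases hP : P i
    · refine (pr_bind_le_const hl fun o _ => ?_).trans (by push_cast; linarith)
      cases o with
      | true =>
        simp only [if_true, monad_pure_eq, law_ret]
        rw [pr_pure_of_not (by simpa using hP)]
        exact hl
      | false => simpa using ih
    · have hi := h i List.mem_cons_self hP
      refine (pr_bind_le (fun o => o = true) hl fun o _ ho => ?_).trans (by push_cast; linarith)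
      simpa [ho] using ih

lemma costLE_firstDifferent {test : Fin k → SampleAlg k n Bool} {N : ℕ}
    (h : ∀ i, CostLE D (test i) N) (l : List (Fin k)) :
    CostLE D (firstDifferent test l) (l.length * N) := by
  induction l with
  | nil => exact costLE_ret _ _
  | cons i l ih =>
    rw [List.length_cons, add_mul, one_mul, add_comm (_ * _)]
    refine (h i).bind fun b _ => ?_
    cases b with
    | true => exact costLE_ret _ _
    | false => simpa using ih

/-- The equivalence test of Find-One-Unknown, for a given flattening. -/
def armTest {s : ℕ} (S : Fin s → Fin n) (ε δ b : ℝ) (s₂ : ℕ) (a₁ i : Fin k) :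
    SampleAlg k n Bool :=
  (iid (drawFlat S a₁) s₂).bind fun X => (iid (drawFlat S i) s₂).bind fun Y =>
    rand (equivTest (Flat S) ε δ b s₂ X Y)

/-- The error probability of each equivalence test. -/
def testError (m : ℕ) : ℝ := 1 / (30 * m)

/-- The number of samples of each equivalence test. -/
def testSize (C : ℝ) (n m : ℕ) (ε : ℝ) : ℕ :=
  ⌈C * n * sketchSize n m ε ^ (-(1 / 2) : ℝ) * Real.log (1 / testError m) / ε ^ 2⌉₊

lemma findOneUnknown_eq (C ε : ℝ) (a₁ : Fin k) (arms : List (Fin k)) :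
    (findOneUnknown equivTest C ε a₁ arms : SampleAlg k n (Option (Fin k))) =
      (rand (ProbabilityTheory.poissonMeasure
        (sketchSize n (arms.length + 1) ε).toNNReal).toPMF).bind fun s =>
      if 2 * sketchSize n (arms.length + 1) ε < s then .ret none else
        (iid (draw a₁) s).bind fun S => firstDifferent (armTest S ε (testError (arms.length + 1))
          (√(30 / sketchSize n (arms.length + 1) ε)) (testSize C n (arms.length + 1) ε) a₁) arms :=
  rfl

lemma law_armTest {s : ℕ} (S : Fin s → Fin n) (ε δ b : ℝ) (s₂ : ℕ) (a₁ i : Fin k) :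
    law D (armTest S ε δ b s₂ a₁ i) =
      (iidPMF (law D (drawFlat S a₁)) s₂).bind fun X =>
        (iidPMF (law D (drawFlat S i)) s₂).bind fun Y => equivTest (Flat S) ε δ b s₂ X Y := by
  simp only [armTest, law_bind, law_iid, law_rand]

lemma law_drawFlat_congr {s : ℕ} (S : Fin s → Fin n) {i j : Fin k} (h : D i = D j) :
    law D (drawFlat S i) = law D (drawFlat S j) := by
  simp only [drawFlat, monad_bind_eq, law_bind, law_draw, h]

lemma testError_pos {m : ℕ} (hm : 0 < m) : 0 < testError m := by
  unfold testError; positivity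

/-- The union bound over all arms still gains a factor `1 / m`. As `m` is at least `k / r` in Stage
1, this becomes the bound `r / (27000 k)` of `pr_findStage_false_le`. -/
lemma mul_testError_le {l : ℕ} : (l : ℝ) * testError (l + 1) ^ 3 ≤ 1 / (27000 * (l + 1)) := by
  unfold testError
  push_cast
  have h0 : (0 : ℝ) ≤ l := l.cast_nonneg
  rw [div_pow, one_pow, mul_one_div, div_le_div_iff₀ (by positivity) (by positivity)]
  nlinarith [mul_nonneg h0 h0, mul_nonneg (mul_nonneg h0 h0) h0]

/-- False positives are unlikely, whatever the distributions. -/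
lemma pr_findOneUnknown_false_le (C ε : ℝ) (a₁ : Fin k) (arms : List (Fin k)) :
    pr (law D (findOneUnknown equivTest C ε a₁ arms)) (fun o => ∃ j, o = some j ∧ D j = D a₁) ≤
      1 / (27000 * (arms.length + 1)) := by
  rw [findOneUnknown_eq, law_bind]
  have hδ := testError_pos (m := arms.length + 1) (by omega)
  refine pr_bind_le_const (by positivity) fun s _ => ?_
  split_ifs with h
  · rw [law_ret, pr_pure_of_not (by simp)]; positivity
  · rw [law_bind]
    refine pr_bind_le_const (by positivity) fun S _ => le_trans ?_ mul_testError_le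
    have := pr_firstDifferent_false_le (D := D) (test := armTest S ε (testError (arms.length + 1))
      (√(30 / sketchSize n (arms.length + 1) ε)) (testSize C n (arms.length + 1) ε) a₁)
      (fun i => D i ≠ D a₁) (η := testError (arms.length + 1) ^ 3) (by positivity) arms
      (fun i _ hi => by
        rw [law_armTest, law_drawFlat_congr S (not_not.1 hi)]
        exact pr_equivTest_null_le _ _ _ hδ _)
    simpa using this

variable {ε : ℝ}

lemma two_le_sketchSize {m : ℕ} (hε : 0 < ε) (hε1 : ε ≤ 1) (hn : 2 ≤ n) (hm : 2 ≤ m) :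
    2 ≤ sketchSize n m ε := by
  have hn' : (2 : ℝ) ≤ n := by exact_mod_cast hn
  have hm' : (2 : ℝ) ≤ m := by exact_mod_cast hm
  refine le_min hn' ?_
  have h1 : (4 : ℝ) ≤ n * m / ε ^ 2 := by
    rw [le_div_iff₀ (by positivity)]
    have : ε ^ 2 ≤ 1 := pow_le_one₀ hε.le hε1
    nlinarith
  calc (2 : ℝ) ≤ 4 ^ (2 / 3 : ℝ) := by
        refine le_of_pow_le_pow_left₀ (n := 3) (by norm_num) (by positivity) ?_
        rw [← Real.rpow_natCast (4 ^ (2 / 3 : ℝ)), ← Real.rpow_mul (by norm_num)]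
        norm_num
    _ ≤ _ := Real.rpow_le_rpow (by norm_num) h1 (by norm_num)

lemma sketchSize_rpow_neg_half {x : ℝ} (hx : 0 ≤ x) : x ^ (-(1 / 2) : ℝ) = 1 / √x := by
  rw [Real.rpow_neg hx, ← Real.sqrt_eq_rpow, one_div]

lemma three_le_log {m : ℕ} (hm : 2 ≤ m) : 3 ≤ Real.log (1 / testError m) := by
  have hm' : (2 : ℝ) ≤ m := by exact_mod_cast hm
  rw [testError, one_div_one_div]
  have h1 : Real.log (2 ^ 5) ≤ Real.log (30 * m) := Real.log_le_log (by norm_num) (by linarith)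
  rw [Real.log_pow] at h1
  have := Real.log_two_gt_d9
  push_cast at h1
  linarith

/-- The constant of Find-One-Unknown. -/
def findConst : ℝ := 10 ^ 9

lemma le_testSize_div {m : ℕ} (hε : 0 < ε) (hε1 : ε ≤ 1) (hn : 2 ≤ n) (hm : 2 ≤ m) :
    10 ^ 7 * (n / (√(sketchSize n m ε) * ε ^ 2)) ≤
      (testSize findConst n m ε / (2 * votes (testError m)) : ℕ) ∧
    √n ≤ n / (√(sketchSize n m ε) * ε ^ 2) := by
  have hs := two_le_sketchSize hε hε1 hn hm
  have hsn : sketchSize n m ε ≤ n := min_le_left _ _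
  have hn' : (2 : ℝ) ≤ n := by exact_mod_cast hn
  set s₁ := sketchSize n m ε with hs₁
  have hlog := three_le_log hm
  set Λ := Real.log (1 / testError m) with hΛ
  have hq : 0 < √s₁ := Real.sqrt_pos.2 (by linarith)
  have h1 : √n ≤ n / (√s₁ * ε ^ 2) := by
    rw [le_div_iff₀ (by positivity)]
    have h2 : √s₁ ≤ √n := Real.sqrt_le_sqrt hsn
    have h3 : ε ^ 2 ≤ 1 := pow_le_one₀ hε.le hε1
    have h4 := Real.mul_self_sqrt (show (0 : ℝ) ≤ n by linarith)
    have h5 : √s₁ * ε ^ 2 ≤ √n := (mul_le_of_le_one_right hq.le h3).trans h2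
    nlinarith [Real.sqrt_nonneg n]
  refine ⟨?_, h1⟩
  have hv : (votes (testError m) : ℝ) ≤ 31 * Λ := by
    have : (votes (testError m) : ℝ) < 30 * Λ + 1 := Nat.ceil_lt_add_one (by positivity)
    linarith
  have hv0 : (0 : ℝ) < votes (testError m) :=
    lt_of_lt_of_le (show (0 : ℝ) < 30 * Λ by positivity) (Nat.le_ceil _)
  have hv0' : 0 < votes (testError m) := by exact_mod_cast hv0
  have h2 := sub_one_le_natDiv (testSize findConst n m ε) (2 * votes (testError m)) (by omega)
  have h3 : findConst * n * (1 / √s₁) * Λ / ε ^ 2 ≤ testSize findConst n m ε := by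
    rw [← sketchSize_rpow_neg_half (by linarith)]
    exact Nat.le_ceil _
  push_cast at h2
  have h4 : findConst * n * (1 / √s₁) * Λ / ε ^ 2 / (2 * (31 * Λ)) ≤
      testSize findConst n m ε / (2 * votes (testError m)) := by
    unfold findConst at *
    gcongr
  have h5 : findConst * n * (1 / √s₁) * Λ / ε ^ 2 / (2 * (31 * Λ)) =
      findConst / 62 * (n / (√s₁ * ε ^ 2)) := by field_simp; ring
  have h6 : 1 ≤ n / (√s₁ * ε ^ 2) := by
    refine le_trans ?_ h1
    rw [Real.one_le_sqrt]; linarith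
  have h7 : findConst / 62 * (n / (√s₁ * ε ^ 2)) = 10 ^ 9 / 62 * (n / (√s₁ * ε ^ 2)) := rfl
  rw [h5, h7] at h4
  linarith

/-- With a good flattening, the equivalence tests succeed on the other cluster. -/
lemma pr_armTest_alt_le {m s : ℕ} (S : Fin s → Fin n) {a₁ i : Fin k} (b : ℝ) (hε : 0 < ε)
    (hε1 : ε ≤ 1) (hn : 2 ≤ n) (hm : 2 ≤ m) (htv : ε ≤ tv (D a₁) (D i))
    (hs : s ≤ 2 * sketchSize n m ε)
    (hQ : ∑ z, wt (law D (drawFlat S a₁)) z ^ 2 ≤ 1000 / sketchSize n m ε) :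
    pr (law D (armTest S ε (testError m) b (testSize findConst n m ε) a₁ i))
      (fun o => o ≠ true) ≤ testError m ^ 3 := by
  rw [law_armTest]
  refine pr_equivTest_alt_le _ _ _ _ (testError_pos (by omega)) _ ?_
  obtain ⟨h1, h2⟩ := le_testSize_div hε hε1 hn hm
  have hs2 := two_le_sketchSize hε hε1 hn hm
  have hsn : sketchSize n m ε ≤ n := min_le_left _ _
  have hN0 := le_sqDist_drawFlat S hε.le htv
  have hn' : (2 : ℝ) ≤ n := by exact_mod_cast hn
  set h := testSize findConst n m ε / (2 * votes (testError m))
  set s₁ := sketchSize n m ε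
  set N := sqDist (fun _ => 1) (wt (law D (drawFlat S a₁))) (wt (law D (drawFlat S i)))
  set Q := ∑ z, wt (law D (drawFlat S a₁)) z ^ 2
  have hNn : 4 * ε ^ 2 ≤ 3 * n * N := by
    -- Without abortion `s ≤ 2 s₁ ≤ 2 n`, so the flattened domain has at most `3 n` elements.
    have hNneg : 0 ≤ N := by
      by_contra! h0
      nlinarith [pow_pos hε 2, (Nat.cast_nonneg s : (0 : ℝ) ≤ s)]
    have : ((n : ℝ) + s) * N ≤ 3 * n * N := by
      refine mul_le_mul_of_nonneg_right ?_ hNneg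
      linarith
    linarith
  have hε2 : 0 < ε ^ 2 := by positivity
  have hN : ε ^ 2 / n ≤ N := by
    rw [div_le_iff₀ (by linarith)]
    linarith
  have hNpos : 0 < N := lt_of_lt_of_le (by positivity) hN
  have hq : 0 < √s₁ := Real.sqrt_pos.2 (by linarith)
  have hn0 : (0 : ℝ) < n := by linarith
  have hh : (0 : ℝ) < h := lt_of_lt_of_le (by positivity) h1
  have e1 : 10 ^ 7 / √s₁ ≤ h * N := by
    calc 10 ^ 7 / √s₁ = 10 ^ 7 * (n / (√s₁ * ε ^ 2)) * (ε ^ 2 / n) := by field_simp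
      _ ≤ h * N := by gcongr
  have e2 : 10 ^ 14 / s₁ ≤ h ^ 2 * N ^ 2 := by
    have := pow_le_pow_left₀ (by positivity) e1 2
    rw [div_pow, Real.sq_sqrt (by linarith)] at this
    rw [← mul_pow]
    norm_num at this ⊢
    linarith
  -- `e2` dominates the norm of the reference, and `e3` the part of the norm that was traded for the
  -- distance; `e3` amounts to `h² N ≥ 10 ^ 14`, from `s₁ ε² ≤ n`.
  have e3 : 10 ^ 14 * N ≤ h ^ 2 * N ^ 2 := by
    have a1 : (10 ^ 7 * √n) ^ 2 ≤ (h : ℝ) ^ 2 :=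
      pow_le_pow_left₀ (by positivity) ((mul_le_mul_of_nonneg_left h2 (by norm_num)).trans h1) 2
    rw [mul_pow, Real.sq_sqrt hn0.le] at a1
    have a2 : 10 ^ 7 / (√s₁) * (10 ^ 7 * (n / (√s₁ * ε ^ 2))) ≤ h * N * h := by gcongr
    have a3 : 10 ^ 7 / (√s₁) * (10 ^ 7 * (n / (√s₁ * ε ^ 2))) = 10 ^ 14 * (n / (s₁ * ε ^ 2)) := by
      have : √s₁ * √s₁ = s₁ := Real.mul_self_sqrt (by linarith)
      rw [← this]; field_simp; norm_num
    have a4 : 1 ≤ n / (s₁ * ε ^ 2) := by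
      rw [one_le_div (by positivity)]
      exact (mul_le_of_le_one_right (by linarith) (pow_le_one₀ hε.le hε1)).trans hsn
    have a5 : 10 ^ 14 ≤ h ^ 2 * N := by nlinarith
    nlinarith [mul_le_mul_of_nonneg_right a5 hNpos.le]
  refine avg_not_blockPositive_le_of_norm (isProb_wt _) (isProb_wt _) (by exact_mod_cast hh)
    hNpos ?_
  have e4 : 10 ^ 14 / s₁ = 10 ^ 11 * (1000 / s₁) := by ring
  have e5 : 0 ≤ 1000 / s₁ := by positivity
  change 10 ^ 6 * (8 * Q + 2 * N) ≤ _
  linarith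

/-- Find-One-Unknown succeeds if the other cluster is represented. -/
lemma pr_findOneUnknown_fail_le {I : Finset (Fin k)} (hε : 0 < ε) (hε1 : ε ≤ 1) (hn : 2 ≤ n)
    (hI : IsHiddenPartition ε D I) {a₁ : Fin k} (h₁ : a₁ ∈ I) {arms : List (Fin k)}
    (harms : ∃ i ∈ arms, i ∈ Iᶜ) :
    pr (law D (findOneUnknown equivTest findConst ε a₁ arms))
      (fun o => ¬ ∃ j ∈ Iᶜ, o = some j) ≤ 0.262 := by
  obtain ⟨i₀, hi₀, hi₀'⟩ := harms
  have hlen : 1 ≤ arms.length := List.length_pos_of_mem hi₀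
  set m := arms.length + 1 with hm
  have hm2 : 2 ≤ m := by omega
  have hδ := testError_pos (m := m) (by omega)
  have hs₁ := two_le_sketchSize hε hε1 hn hm2
  rw [findOneUnknown_eq, law_bind, law_rand, ← hm]
  set s₁ := sketchSize n m ε
  have hs₁0 : 0 < s₁ := by linarith
  obtain ⟨J, hJ, hJ1, hJ2⟩ := exists_descFactorial_bound hs₁
  set η := (arms.length : ℝ) * testError m ^ 3 with hη
  have hη0 : 0 ≤ η := by positivity
  have hp := isProb_wt (D a₁)
  -- For each value `s`, the three summands bound the probabilities of abortion, of a flattened norm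
  -- above `1000 / s₁`, and of a wrong test.
  have hsum : HasSum (fun s => ((ProbabilityTheory.poissonMeasure s₁.toNNReal).toPMF s).toReal *
      ((s.descFactorial 3 : ℝ) / J + (s₁ / 1000 * (1 / ((s : ℝ) + 1)) + η)))
      (s₁ ^ 3 / J + (s₁ / 1000 * ((1 - Real.exp (-s₁)) / s₁) + η)) := by
    have a1 := (hasSum_poisson_descFactorial hs₁0.le).div_const J
    have a2 := (hasSum_poisson_inv hs₁0).mul_left (s₁ / 1000)
    have a3 := (hasSum_poisson_one s₁).mul_right η
    rw [one_mul] at a3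
    refine (a1.add (a2.add a3)).congr_fun ?_
    intro s
    ring
  refine (pr_bind_le_tsum (fun s => ?_) hsum).trans ?_
  · have hd : 0 ≤ (s.descFactorial 3 : ℝ) / J := by positivity
    have hi : 0 ≤ s₁ / 1000 * (1 / ((s : ℝ) + 1)) := by positivity
    split_ifs with h
    · refine (pr_le_one _ _).trans ?_
      have := hJ2 s h
      linarith
    · rw [law_bind, law_iid, law_draw]
      push Not at h
      have key : ∀ S : Fin s → Fin n, pr (law D (firstDifferent (armTest S ε (testError m)
          (√(30 / s₁)) (testSize findConst n m ε) a₁) arms)) (fun o => ¬ ∃ j ∈ Iᶜ, o = some j) ≤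
          s₁ / 1000 * (∑ x, wt (D a₁) x ^ 2 * (1 / (((List.ofFn S).count x : ℝ) + 1))) + η := by
        intro S
        rw [← sum_drawFlat_sq]
        set Q := ∑ z, wt (law D (drawFlat S a₁)) z ^ 2 with hQdef
        have hQ0 : 0 ≤ Q := Finset.sum_nonneg fun z _ => sq_nonneg _
        -- Markov's inequality in pointwise form: if the norm is too large, then `s₁ / 1000 * Q`
        -- exceeds 1.
        by_cases hQ : Q ≤ 1000 / s₁
        · refine (pr_mono fun o _ ho => ?_).trans ((pr_firstDifferent_ne_le (D := D)
            (fun i => i ∈ Iᶜ) (η := testError m ^ 3) (by positivity) arms fun i _ => ?_).trans ?_)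
          · intro h0
            apply ho
            cases hf : arms.find? (fun i => decide (i ∈ Iᶜ)) with
            | none =>
              rw [List.find?_eq_none] at hf
              exact absurd (decide_eq_true hi₀') (hf i₀ hi₀)
            | some j => exact ⟨j, by simpa using List.find?_some hf, h0.trans hf⟩
          · by_cases hiI : i ∈ Iᶜ
            · rw [decide_eq_true hiI]
              exact pr_armTest_alt_le S _ hε hε1 hn hm2 (hI.le_tv a₁ h₁ i hiI) h hQ
            · rw [decide_eq_false hiI, law_armTest,
                law_drawFlat_congr S (hI.eq_of_mem i (by simpa using hiI) a₁ h₁)]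
              refine (pr_mono fun o _ ho => ?_).trans (pr_equivTest_null_le _ _ _ hδ _)
              simpa using ho
          · have : 0 ≤ s₁ / 1000 * Q := by positivity
            linarith
        · push Not at hQ
          refine (pr_le_one _ _).trans ?_
          rw [div_lt_iff₀ hs₁0] at hQ
          have : 1 ≤ s₁ / 1000 * Q := by linarith
          linarith
      refine (pr_iid_bind_le (D a₁) (g := fun l => s₁ / 1000 * (∑ x, wt (D a₁) x ^ 2 *
        (1 / ((l.count x : ℝ) + 1))) + η) key).trans ?_
      rw [avg_add, avg_mul_left, avg_const hp, avg_sum]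
      simp only [avg_mul_left]
      -- One factor `p x` cancels against the mean of `1 / (count + 1)`, which leaves `1 / (s + 1)`
      -- in total, whatever the distribution.
      have h2 : ∑ x, wt (D a₁) x ^ 2 * avg (wt (D a₁)) s (fun l => 1 / ((l.count x : ℝ) + 1)) ≤
          ∑ x, wt (D a₁) x * (1 / ((s : ℝ) + 1)) := by
        refine Finset.sum_le_sum fun x _ => ?_
        have h3 := avg_inv_count_le hp x s
        have h4 := mul_le_mul_of_nonneg_left h3 (hp.nonneg x)
        rw [mul_one_div, le_div_iff₀ (by positivity)]
        linarith
      rw [← Finset.sum_mul, hp.sum_eq_one, one_mul] at h2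
      have h3 := mul_le_mul_of_nonneg_left h2 (show 0 ≤ s₁ / 1000 by positivity)
      linarith
  · have h1 : s₁ / 1000 * ((1 - Real.exp (-s₁)) / s₁) ≤ 1 / 1000 := by
      have h2 : s₁ / 1000 * ((1 - Real.exp (-s₁)) / s₁) = (1 - Real.exp (-s₁)) / 1000 := by
        field_simp
      rw [h2]
      have := Real.exp_pos (-s₁)
      gcongr
      linarith
    have h2 : η ≤ 1 / 54000 := by
      refine (mul_testError_le (l := arms.length)).trans ?_
      refine one_div_le_one_div_of_le (by norm_num) ?_
      have : (1 : ℝ) ≤ arms.length := by exact_mod_cast hlen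
      linarith
    norm_num at *
    linarith

end

/-! ### The random subset -/

section

lemma descFactorial_mul_pow_le (k b t : ℕ) :
    (k - b).descFactorial t * k ^ t ≤ k.descFactorial t * (k - b) ^ t := by
  induction t with
  | zero => simp
  | succ t ih =>
    have h : (k - b - t) * k ≤ (k - t) * (k - b) := by
      rcases le_total (k - b) t with h1 | h1
      · rw [Nat.sub_eq_zero_of_le h1, zero_mul]; exact Nat.zero_le _
      · rcases le_total k b with h2 | h2
        · rw [Nat.sub_eq_zero_of_le h2]; simp
        · obtain ⟨c, rfl⟩ := Nat.exists_eq_add_of_le h2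
          rw [Nat.add_sub_cancel_left] at h1 ⊢
          obtain ⟨d, rfl⟩ := Nat.exists_eq_add_of_le h1
          rw [Nat.add_sub_cancel_left, show b + (t + d) - t = b + d by omega]
          nlinarith
    rw [Nat.descFactorial_succ, Nat.descFactorial_succ, pow_succ, pow_succ]
    calc (k - b - t) * (k - b).descFactorial t * (k ^ t * k)
        = (k - b - t) * k * ((k - b).descFactorial t * k ^ t) := by ring
      _ ≤ (k - t) * (k - b) * (k.descFactorial t * (k - b) ^ t) := Nat.mul_le_mul h ih
      _ = _ := by ring

/-- Sampling without replacement misses a set at most as often as sampling with replacement; factor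
by factor, `(k - b - i) / (k - i) ≤ (k - b) / k`. -/
lemma choose_mul_pow_le (k b t : ℕ) : (k - b).choose t * k ^ t ≤ k.choose t * (k - b) ^ t := by
  have h := descFactorial_mul_pow_le k b t
  rw [Nat.descFactorial_eq_factorial_mul_choose, Nat.descFactorial_eq_factorial_mul_choose,
    mul_assoc, mul_assoc] at h
  exact Nat.le_of_mul_le_mul_left h t.factorial_pos

variable {k r : ℕ}

lemma card_of_mem_randomSubset {J : Finset (Fin k)} (hJ : J ∈ (randomSubset k r).support) :
    J.card = subsetSize k r := by
  rw [randomSubset, PMF.mem_support_uniformOfFinset_iff] at hJ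
  exact (Finset.mem_powersetCard.1 hJ).2

/-- The random subset meets every set of at least `r` indices, with probability close to one. -/
lemma pr_randomSubset_disjoint_le (hr : 0 < r) {B : Finset (Fin k)} (hB : r ≤ B.card) :
    pr (randomSubset k r) (fun J => Disjoint J B) ≤ 1 / 512 := by
  set t := subsetSize k r with ht
  set b := B.card with hb
  have hbk : b ≤ k := (Finset.card_le_univ B).trans_eq (Fintype.card_fin k)
  have hk : 0 < k := by omega
  have hk' : (0 : ℝ) < k := by exact_mod_cast hk
  have htk : t ≤ k := min_le_right _ _
  have h1 : pr (randomSubset k r) (fun J => Disjoint J B) ≤ ((k - b).choose t : ℝ) / k.choose t := by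
    rw [pr, randomSubset]
    refine (congrArg ENNReal.toReal (PMF.toOuterMeasure_uniformOfFinset_apply _ _)).trans_le ?_
    rw [ENNReal.toReal_div, Finset.card_powersetCard, Finset.card_univ, Fintype.card_fin, ← ht]
    simp only [ENNReal.toReal_natCast]
    gcongr
    calc _ ≤ (Finset.powersetCard t Bᶜ).card := by
          refine Finset.card_le_card fun J hJ => ?_
          obtain ⟨hJt, hJB⟩ := (@Finset.mem_filter _ _ (_) _ _).1 hJ
          refine Finset.mem_powersetCard.2 ⟨fun x hx => ?_, (Finset.mem_powersetCard.1 hJt).2⟩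
          exact Finset.mem_compl.2 (Finset.disjoint_left.1 hJB hx)
      _ = (k - b).choose t := by
          rw [Finset.card_powersetCard, Finset.card_compl, Fintype.card_fin]
  refine h1.trans ?_
  have hc : (0 : ℝ) < k.choose t := by exact_mod_cast Nat.choose_pos htk
  by_cases hcase : ⌈(9 * k / r : ℝ)⌉₊ ≤ k
  · have ht' : t = ⌈(9 * k / r : ℝ)⌉₊ := min_eq_left hcase
    have h2 : ((k - b).choose t : ℝ) / k.choose t ≤ (1 - b / k) ^ t := by
      have h3 : ((k - b).choose t : ℝ) * k ^ t ≤ k.choose t * ((k - b : ℕ) : ℝ) ^ t := by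
        exact_mod_cast choose_mul_pow_le k b t
      rw [Nat.cast_sub hbk] at h3
      have h4 : (1 - (b : ℝ) / k) ^ t = (k - b) ^ t / k ^ t := by
        rw [← div_pow]; congr 1; field_simp
      rw [h4, div_le_div_iff₀ hc (by positivity)]
      linarith
    refine h2.trans ?_
    have h5 : (0 : ℝ) ≤ 1 - b / k := by
      rw [sub_nonneg, div_le_one hk']; exact_mod_cast hbk
    have h6 : (1 - (b : ℝ) / k) ≤ Real.exp (-(b / k)) := by
      have := Real.add_one_le_exp (-((b : ℝ) / k)); linarith
    have h7 : (9 : ℝ) ≤ t * (b / k) := by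
      have h8 : (9 * k / r : ℝ) ≤ t := by rw [ht']; exact Nat.le_ceil _
      have hr' : (0 : ℝ) < r := by exact_mod_cast hr
      have hb' : (r : ℝ) ≤ b := by exact_mod_cast hB
      calc (9 : ℝ) = 9 * k / r * (r / k) := by field_simp
        _ ≤ t * (b / k) := by gcongr
    calc (1 - (b : ℝ) / k) ^ t ≤ Real.exp (-(b / k)) ^ t := pow_le_pow_left₀ h5 h6 t
      _ = Real.exp (t * -(b / k)) := (Real.exp_nat_mul _ _).symm
      _ ≤ Real.exp (-9) := Real.exp_le_exp.2 (by linarith)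
      _ ≤ 1 / 512 := by
        rw [Real.exp_neg, show (9 : ℝ) = (9 : ℕ) * 1 by norm_num, Real.exp_nat_mul, ← one_div]
        have h8 : (2 : ℝ) ≤ Real.exp 1 := by have := Real.add_one_le_exp (1 : ℝ); linarith
        have h9 := pow_le_pow_left₀ (by norm_num) h8 9
        refine one_div_le_one_div_of_le (by norm_num) ?_
        norm_num at h9 ⊢
        exact h9
  · have ht' : t = k := min_eq_right (by omega)
    -- The subset is everything and cannot miss a non-empty set.
    rw [ht', Nat.choose_eq_zero_of_lt (by omega)]
    norm_num

lemma le_subsetSize (hr : 0 < r) : (k : ℝ) / r ≤ subsetSize k r := by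
  have hr' : (1 : ℝ) ≤ r := by exact_mod_cast hr
  have hk' : (0 : ℝ) ≤ k := Nat.cast_nonneg k
  rw [subsetSize, Nat.cast_min, le_min_iff]
  refine ⟨le_trans ?_ (Nat.le_ceil _), div_le_self hk' hr'⟩
  gcongr
  linarith

lemma subsetSize_le (hr : 0 < r) (hrk : r ≤ k) : (subsetSize k r : ℝ) ≤ 10 * (k / r) := by
  have hr' : (0 : ℝ) < r := by exact_mod_cast hr
  have hrk' : (r : ℝ) ≤ k := by exact_mod_cast hrk
  have h1 : 1 ≤ (k : ℝ) / r := by rwa [one_le_div hr']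
  have h2 : (⌈(9 * k / r : ℝ)⌉₊ : ℝ) < 9 * k / r + 1 := Nat.ceil_lt_add_one (by positivity)
  have h3 : (subsetSize k r : ℝ) ≤ (⌈(9 * k / r : ℝ)⌉₊ : ℝ) :=
    Nat.cast_le.2 (min_le_left _ _)
  rw [mul_div_assoc] at h2 h3
  linarith

lemma two_le_subsetSize (hr : 0 < r) (hrk : r ≤ k) (hk : 2 ≤ k) : 2 ≤ subsetSize k r := by
  have hr' : (0 : ℝ) < r := by exact_mod_cast hr
  have hrk' : (r : ℝ) ≤ k := by exact_mod_cast hrk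
  refine le_min ?_ hk
  have h1 : (2 : ℝ) ≤ 9 * k / r := by rw [le_div_iff₀ hr']; linarith
  exact_mod_cast h1.trans (Nat.le_ceil _)

end

/-! ### The cost of the first stage -/

section

variable {k n r : ℕ} {ε : ℝ}

lemma costFind_nonneg (n k r : ℕ) (ε : ℝ) : 0 ≤ costFind n k r ε := by
  have := Real.log_natCast_nonneg k
  unfold costFind; positivity

/-- The total cost of the equivalence tests, without the logarithmic factor. -/
lemma mul_div_sqrt_sketchSize_le {m : ℕ} (hε : 0 < ε) (hn : 0 < n) (hm : 0 < m) :
    m * (n / (√(sketchSize n m ε) * ε ^ 2)) ≤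
      (n * m / ε ^ 2 : ℝ) ^ (2 / 3 : ℝ) + m * √n / ε ^ 2 := by
  have hn' : (0 : ℝ) < n := by exact_mod_cast hn
  have hm' : (0 : ℝ) < m := by exact_mod_cast hm
  set y : ℝ := n * m / ε ^ 2 with hy
  have hy0 : 0 < y := by positivity
  have hb : 0 < y ^ (2 / 3 : ℝ) := by positivity
  have h1 : m * (n / (√(n : ℝ) * ε ^ 2)) = m * √n / ε ^ 2 := by
    have h2 : (n : ℝ) / √n = √n := Real.div_sqrt
    rw [← h2]; field_simp; rw [Real.sq_sqrt hn'.le]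
  have h2 : m * (n / (√(y ^ (2 / 3 : ℝ)) * ε ^ 2)) = y ^ (2 / 3 : ℝ) := by
    have h3 : m * (n / (√(y ^ (2 / 3 : ℝ)) * ε ^ 2)) = y / √(y ^ (2 / 3 : ℝ)) := by
      rw [hy]; field_simp
    rw [h3, Real.sqrt_eq_rpow, ← Real.rpow_mul hy0.le]
    nth_rewrite 1 [← Real.rpow_one y]
    rw [← Real.rpow_sub hy0]
    norm_num
  rw [sketchSize]
  -- With `y = n m / ε²`, the choice `s₁ = y ^ (2/3)` balances the flattening cost `s₁` with the
  -- testing cost `y / √s₁`; the cap `s₁ = n` produces the other term.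
  rcases min_choice (n : ℝ) (y ^ (2 / 3 : ℝ)) with h | h
  · rw [h, h1]; linarith
  · rw [h, h2]
    have : 0 ≤ m * √n / ε ^ 2 := by positivity
    linarith

lemma log_testError_le {m : ℕ} (hk : 2 ≤ k) (hm : 2 ≤ m) (hmk : (m : ℝ) ≤ 11 * k) :
    Real.log (1 / testError m) ≤ 10 * Real.log k := by
  have hk' : (2 : ℝ) ≤ k := by exact_mod_cast hk
  have hm' : (2 : ℝ) ≤ m := by exact_mod_cast hm
  rw [testError, one_div_one_div]
  -- `30 * 11 ≤ 2 ^ 9`, and each of the nine factors 2 is at most `k`.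
  have h1 : Real.log (30 * m) ≤ Real.log (2 ^ 9 * k) :=
    Real.log_le_log (by positivity) (by linarith)
  rw [Real.log_mul (show (2 : ℝ) ^ 9 ≠ 0 by norm_num) (by positivity), Real.log_pow] at h1
  have h2 : Real.log 2 ≤ Real.log k := Real.log_le_log (by norm_num) hk'
  push_cast at h1
  linarith

/-- The cost of Find-One-Unknown, up to constants, is `costFind`. -/
lemma findOneUnknown_cost_le {m : ℕ} (hε : 0 < ε) (hε1 : ε ≤ 1) (hn : 2 ≤ n) (hk : 2 ≤ k)
    (hr : 0 < r) (hm : 2 ≤ m) (hmk : (m : ℝ) ≤ 11 * (k / r)) :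
    2 * sketchSize n m ε + m * (2 * testSize findConst n m ε) ≤ 10 ^ 12 * costFind n k r ε := by
  have hn' : (2 : ℝ) ≤ n := by exact_mod_cast hn
  have hm' : (2 : ℝ) ≤ m := by exact_mod_cast hm
  have hr' : (1 : ℝ) ≤ r := by exact_mod_cast hr
  have hk' : (0 : ℝ) ≤ k := Nat.cast_nonneg k
  have hs := two_le_sketchSize hε hε1 hn hm
  have hΛ := three_le_log hm
  have hΛ' := log_testError_le hk hm (hmk.trans (by
    have := div_le_self hk' hr'; linarith))
  have h1 := mul_div_sqrt_sketchSize_le hε (show 0 < n by omega) (show 0 < m by omega)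
  have h2 : sketchSize n m ε ≤ (n * m / ε ^ 2 : ℝ) ^ (2 / 3 : ℝ) := min_le_right _ _
  have h3 : (testSize findConst n m ε : ℝ) <
      findConst * (n / (√(sketchSize n m ε) * ε ^ 2)) * Real.log (1 / testError m) + 1 := by
    have h4 : findConst * n * sketchSize n m ε ^ (-(1 / 2) : ℝ) * Real.log (1 / testError m) /
        ε ^ 2 = findConst * (n / (√(sketchSize n m ε) * ε ^ 2)) * Real.log (1 / testError m) := by
      rw [sketchSize_rpow_neg_half (by linarith)]
      have : 0 < √(sketchSize n m ε) := Real.sqrt_pos.2 (by linarith)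
      field_simp
    rw [← h4]
    refine Nat.ceil_lt_add_one ?_
    rw [h4]
    unfold findConst
    positivity
  set s₁ := sketchSize n m ε
  set Λ := Real.log (1 / testError m)
  set X := (n * m / ε ^ 2 : ℝ) ^ (2 / 3 : ℝ) with hX
  set Y := m * √n / ε ^ 2 with hY
  have hX0 : 0 ≤ X := by positivity
  have hmY : (m : ℝ) ≤ Y := by
    rw [hY, le_div_iff₀ (by positivity)]
    have h5 : 1 ≤ √(n : ℝ) := by rw [Real.one_le_sqrt]; linarith
    have h6 : ε ^ 2 ≤ 1 := pow_le_one₀ hε.le hε1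
    nlinarith
  have h5 : m * (2 * (testSize findConst n m ε : ℝ)) ≤ 2 * 10 ^ 9 * Λ * (X + Y) + 2 * m := by
    have hC : findConst = 10 ^ 9 := rfl
    have h6 := mul_le_mul_of_nonneg_left h3.le (show (0 : ℝ) ≤ 2 * m by linarith)
    have h7 := mul_le_mul_of_nonneg_left h1 (show (0 : ℝ) ≤ 2 * 10 ^ 9 * Λ by positivity)
    nth_rewrite 2 [hC] at h6
    linarith
  have h6 : 2 * s₁ + m * (2 * (testSize findConst n m ε : ℝ)) ≤ 3 * 10 ^ 9 * Λ * (X + Y) := by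
    nlinarith
  set Z := max ((n * k / (r * ε ^ 2) : ℝ) ^ (2 / 3 : ℝ)) (k * √n / (r * ε ^ 2)) with hZ
  have hXZ : X ≤ 11 * Z := by
    have h7 : (n * m / ε ^ 2 : ℝ) ≤ 11 * (n * k / (r * ε ^ 2)) := by
      calc (n * m / ε ^ 2 : ℝ) ≤ n * (11 * (k / r)) / ε ^ 2 := by gcongr
        _ = 11 * (n * k / (r * ε ^ 2)) := by field_simp
    calc X ≤ (11 * (n * k / (r * ε ^ 2)) : ℝ) ^ (2 / 3 : ℝ) :=
          Real.rpow_le_rpow (by positivity) h7 (by norm_num)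
      _ = 11 ^ (2 / 3 : ℝ) * (n * k / (r * ε ^ 2) : ℝ) ^ (2 / 3 : ℝ) :=
          Real.mul_rpow (by norm_num) (by positivity)
      _ ≤ 11 * Z := by
          have h8 : (11 : ℝ) ^ (2 / 3 : ℝ) ≤ 11 ^ (1 : ℝ) :=
            Real.rpow_le_rpow_of_exponent_le (by norm_num) (by norm_num)
          rw [Real.rpow_one] at h8
          exact mul_le_mul h8 (le_max_left _ _) (by positivity) (by norm_num)
  have hYZ : Y ≤ 11 * Z := by
    calc Y ≤ 11 * (k / r) * √n / ε ^ 2 := by rw [hY]; gcongr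
      _ = 11 * (k * √n / (r * ε ^ 2)) := by field_simp
      _ ≤ 11 * Z := mul_le_mul_of_nonneg_left (le_max_right _ _) (by norm_num)
  have hlog := one_half_le_log hk
  have hZ0 : 0 ≤ Z := le_trans (by positivity) (le_max_left _ _)
  have hcf : costFind n k r ε = Z * Real.log k := rfl
  rw [hcf]
  calc _ ≤ 3 * 10 ^ 9 * Λ * (X + Y) := h6
    _ ≤ 3 * 10 ^ 9 * (10 * Real.log k) * (22 * Z) := by gcongr; linarith
    _ ≤ 10 ^ 12 * (Z * Real.log k) := by
      have : 0 ≤ Z * Real.log k := by positivity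
      linarith

/-- The first stage: Find-One-Unknown on a random subset for smaller cluster size `r`. -/
def findStage (n k r : ℕ) (ε : ℝ) (a₁ : Fin k) : SampleAlg k n (Option (Fin k)) :=
  (rand (randomSubset k r)).bind fun J =>
    findOneUnknown equivTest findConst ε a₁ (J.erase a₁).toList

variable {D : Fin k → PMF (Fin n)}

lemma length_erase_toList_le {J : Finset (Fin k)} (a : Fin k) :
    ((J.erase a).toList.length : ℕ) ≤ J.card ∧ J.card ≤ (J.erase a).toList.length + 1 := by
  rw [Finset.length_toList]
  exact ⟨Finset.card_erase_le, Nat.sub_le_iff_le_add.1 Finset.pred_card_le_card_erase⟩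

/-- Only a lower bound on the cluster avoiding the reference is required, so any guess `r` not above
the true smaller size will do. -/
lemma pr_findStage_fail_le {I : Finset (Fin k)} (hε : 0 < ε) (hε1 : ε ≤ 1) (hn : 2 ≤ n)
    (hI : IsHiddenPartition ε D I) {a₁ : Fin k} (h₁ : a₁ ∈ I) (hr : 0 < r) (hrI : r ≤ Iᶜ.card) :
    pr (law D (findStage n k r ε a₁)) (fun o => ¬ ∃ j ∈ Iᶜ, o = some j) ≤ 0.265 := by
  rw [findStage, law_bind, law_rand]
  have h1 := pr_randomSubset_disjoint_le hr hrI
  refine (pr_bind_le (fun J => Disjoint J Iᶜ) (c := 0.262) (by norm_num) fun J _ hJ => ?_).trans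
    (by norm_num at *; linarith)
  refine pr_findOneUnknown_fail_le hε hε1 hn hI h₁ ?_
  rw [Finset.not_disjoint_iff] at hJ
  obtain ⟨i, hi, hi'⟩ := hJ
  refine ⟨i, ?_, hi'⟩
  rw [Finset.mem_toList, Finset.mem_erase]
  refine ⟨?_, hi⟩
  rintro rfl
  exact Finset.mem_compl.1 hi' h₁

lemma pr_findStage_false_le (hr : 0 < r) (hk : 2 ≤ k) (ε : ℝ) (a₁ : Fin k) :
    pr (law D (findStage n k r ε a₁)) (fun o => ∃ j, o = some j ∧ D j = D a₁) ≤
      r / (27000 * k) := by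
  rw [findStage, law_bind, law_rand]
  refine pr_bind_le_const (by positivity) fun J hJ => ?_
  refine (pr_findOneUnknown_false_le _ _ _ _).trans ?_
  have h1 := (length_erase_toList_le (J := J) a₁).2
  rw [card_of_mem_randomSubset hJ] at h1
  have h2 : (subsetSize k r : ℝ) ≤ (J.erase a₁).toList.length + 1 := by exact_mod_cast h1
  have h3 := (le_subsetSize hr).trans h2
  have hr' : (0 : ℝ) < r := by exact_mod_cast hr
  have hk' : (0 : ℝ) < k := by positivity
  rw [div_le_iff₀ hr'] at h3
  rw [div_le_div_iff₀ (by positivity) (by positivity)]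
  linarith

lemma costLE_findOneUnknown (a₁ : Fin k) (arms : List (Fin k)) :
    CostLE D (findOneUnknown equivTest findConst ε a₁ arms)
      (⌊2 * sketchSize n (arms.length + 1) ε⌋₊ +
        arms.length * (2 * testSize findConst n (arms.length + 1) ε)) := by
  rw [findOneUnknown_eq]
  refine costLE_rand_bind fun s _ => ?_
  split_ifs with h
  · exact costLE_ret _ _
  · push Not at h
    refine CostLE.bind ((costLE_iid (costLE_draw a₁) s).mono ?_) fun S _ =>
      costLE_firstDifferent (fun i => ?_) arms
    · rw [mul_one]; exact Nat.le_floor h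
    · have hflat : ∀ j, CostLE D (drawFlat S j) 1 := fun j =>
        (costLE_draw j).bind (N := 0) fun x _ => costLE_rand_bind fun _ _ => costLE_ret _ _
      have := (costLE_iid (hflat a₁) (testSize findConst n (arms.length + 1) ε)).bind
        (f := fun X => (iid (drawFlat S i) (testSize findConst n (arms.length + 1) ε)).bind fun Y =>
          rand (equivTest (Flat S) ε (testError (arms.length + 1))
            (√(30 / sketchSize n (arms.length + 1) ε)) _ X Y)) fun X _ =>
        (costLE_iid (hflat i) _).bind (N := 0) fun Y _ => costLE_rand _
      refine this.mono ?_
      omega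

lemma costLE_findStage (hε : 0 < ε) (hε1 : ε ≤ 1) (hn : 2 ≤ n) (hk : 2 ≤ k) (hr : 0 < r)
    (hrk : r ≤ k) (a₁ : Fin k) :
    CostLE D (findStage n k r ε a₁) ⌊10 ^ 12 * costFind n k r ε⌋₊ := by
  refine costLE_rand_bind fun J hJ => (costLE_findOneUnknown a₁ _).mono (Nat.le_floor ?_)
  obtain ⟨h1, h2⟩ := length_erase_toList_le (J := J) a₁
  rw [card_of_mem_randomSubset hJ] at h1 h2
  have h3 := two_le_subsetSize hr hrk hk
  have h4 := subsetSize_le hr hrk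
  set l := (J.erase a₁).toList.length
  have hr' : (0 : ℝ) < r := by exact_mod_cast hr
  have hrk' : (r : ℝ) ≤ k := by exact_mod_cast hrk
  have h5 : 1 ≤ (k : ℝ) / r := by rwa [one_le_div hr']
  have h6 : (l : ℝ) ≤ subsetSize k r := by exact_mod_cast h1
  have h7 := findOneUnknown_cost_le (m := l + 1) hε hε1 hn hk hr (by omega)
    (by push_cast; linarith)
  have hs := two_le_sketchSize (m := l + 1) hε hε1 hn (by omega)
  have h8 : (⌊2 * sketchSize n (l + 1) ε⌋₊ : ℝ) ≤ 2 * sketchSize n (l + 1) ε :=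
    Nat.floor_le (by linarith)
  have h9 : (0 : ℝ) ≤ testSize findConst n (l + 1) ε := Nat.cast_nonneg _
  push_cast at h7 ⊢
  linarith

end

/-! ### Symmetry of the two clusters -/

section

variable {k n : ℕ} {ε : ℝ} {D : Fin k → PMF (Fin n)} {I : Finset (Fin k)}

lemma tv_comm (P Q : PMF (Fin n)) : tv P Q = tv Q P := by
  simp only [tv, abs_sub_comm]

lemma IsHiddenPartition.compl (h : IsHiddenPartition ε D I) : IsHiddenPartition ε D Iᶜ where
  nonempty := h.nonempty_compl
  nonempty_compl := by rw [compl_compl]; exact h.nonempty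
  eq_of_mem := h.eq_of_mem_compl
  eq_of_mem_compl := by rw [compl_compl]; exact h.eq_of_mem
  le_tv a ha b hb := by
    rw [compl_compl] at hb
    rw [tv_comm]
    exact h.le_tv b hb a ha

lemma IsHiddenPartition.smallerSize_pos (h : IsHiddenPartition ε D I) : 0 < smallerSize I :=
  lt_min h.nonempty.card_pos h.nonempty_compl.card_pos

lemma smallerSize_le (I : Finset (Fin k)) : smallerSize I ≤ k :=
  (min_le_left _ _).trans ((Finset.card_le_univ I).trans_eq (Fintype.card_fin k))

lemma IsHiddenPartition.two_le_k (h : IsHiddenPartition ε D I) : 2 ≤ k := by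
  have h1 := h.nonempty.card_pos
  have h2 := h.nonempty_compl.card_pos
  rw [Finset.card_compl, Fintype.card_fin] at h2
  omega

lemma IsHiddenPartition.two_le_n (h : IsHiddenPartition ε D I) (hε : 0 < ε) : 2 ≤ n := by
  obtain ⟨a, ha⟩ := h.nonempty
  obtain ⟨b, hb⟩ := h.nonempty_compl
  have htv := h.le_tv a ha b hb
  by_contra! hn
  have h1 := sum_toReal (D a)
  have h2 := sum_toReal (D b)
  unfold tv at htv
  interval_cases n
  · simp at h1
  · simp only [Fin.sum_univ_one] at h1 h2 htv
    rw [h1, h2] at htv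
    norm_num at htv
    linarith

/-- If the cluster of `a₁` may be called `I`, then it may be assumed to be `I`. -/
lemma IsHiddenPartition.wlog_mem (h : IsHiddenPartition ε D I) (a₁ : Fin k) :
    ∃ I' : Finset (Fin k), IsHiddenPartition ε D I' ∧ a₁ ∈ I' ∧
      ({I', I'ᶜ} : Finset (Finset (Fin k))) = {I, Iᶜ} ∧ smallerSize I' = smallerSize I := by
  by_cases ha : a₁ ∈ I
  · exact ⟨I, h, ha, rfl, rfl⟩
  · exact ⟨Iᶜ, h.compl, Finset.mem_compl.2 ha, by rw [compl_compl, Finset.pair_comm],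
      by rw [smallerSize, smallerSize, compl_compl, min_comm]⟩

end

/-! ### The two-stage algorithm -/

section

variable {k n : ℕ} {ε : ℝ} {D : Fin k → PMF (Fin n)} {I : Finset (Fin k)}

/-- The second stage, given the outcome of the first one. -/
def finishStage {k n : ℕ} (ε : ℝ) (a₁ : Fin k) :
    Option (Fin k) → SampleAlg k n (Finset (Finset (Fin k)))
  | none => .ret {Finset.univ, ∅}
  | some a₂ => multiLFHT lfhtTest lfhtConst ε a₁ a₂

lemma twoStage_eq (r : ℕ) (a₁ : Fin k) :
    twoStage equivTest lfhtTest findConst lfhtConst r ε a₁ =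
      (findStage n k r ε a₁).bind (finishStage ε a₁) := by
  change (SampleAlg.random _ fun J => SampleAlg.bind _ _) =
    SampleAlg.random _ fun J => SampleAlg.bind _ _
  congr 1

lemma lfhtSize_nonneg (n k : ℕ) (ε : ℝ) : 0 ≤ lfhtSize n k ε := by
  unfold lfhtSize
  split_ifs
  · exact costLarge_nonneg n k ε
  · exact costMid_nonneg n k ε
  · exact costSmall_nonneg k ε

lemma costLE_finishStage (hε : 0 < ε) (hε1 : ε ≤ 1) (hk : 2 ≤ k) (a₁ : Fin k)
    (o : Option (Fin k)) : CostLE D (finishStage ε a₁ o) ⌊10 ^ 32 * lfhtSize n k ε⌋₊ := by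
  cases o with
  | none => exact costLE_ret _ _
  | some a₂ =>
    obtain ⟨N, hN, hle⟩ := exists_costLE_multiLFHT (D := D) hε hε1 hk a₁ a₂
    exact hN.mono (Nat.le_floor hle)

lemma pr_finishStage_le (hε : 0 < ε) (hε1 : ε ≤ 1) (hI : IsHiddenPartition ε D I) {a₁ : Fin k}
    (h₁ : a₁ ∈ I) {o : Option (Fin k)} (ho : ∃ j ∈ Iᶜ, o = some j) :
    pr (law D (finishStage ε a₁ o)) (· ≠ {I, Iᶜ}) ≤ 1 / 100 := by
  obtain ⟨j, hj, rfl⟩ := ho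
  exact pr_multiLFHT_lfhtConst_le hε hε1 hI h₁ hj

lemma pr_twoStage_le {r : ℕ} (hε : 0 < ε) (hε1 : ε ≤ 1) (hI : IsHiddenPartition ε D I)
    (hr : smallerSize I = r) (a₁ : Fin k) :
    pr (law D (twoStage equivTest lfhtTest findConst lfhtConst r ε a₁)) (· ≠ {I, Iᶜ}) ≤ 1 / 3 := by
  obtain ⟨I', hI', h₁, hpair, hsize⟩ := hI.wlog_mem a₁
  rw [← hpair, ← hr, ← hsize, twoStage_eq, law_bind]
  have h := pr_findStage_fail_le hε hε1 (hI'.two_le_n hε) hI' h₁ hI'.smallerSize_pos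
    (min_le_right _ _)
  refine (pr_bind_le (fun o => ¬ ∃ j ∈ I'ᶜ, o = some j) (c := 1 / 100) (by norm_num)
    fun o _ ho => pr_finishStage_le hε hε1 hI' h₁ (not_not.1 ho)).trans ?_
  norm_num at h ⊢
  linarith

lemma costLE_twoStage {r : ℕ} (hε : 0 < ε) (hε1 : ε ≤ 1) (hn : 2 ≤ n) (hk : 2 ≤ k) (hr : 0 < r)
    (hrk : r ≤ k) (a₁ : Fin k) :
    CostLE D (twoStage equivTest lfhtTest findConst lfhtConst r ε a₁)
      (⌊10 ^ 12 * costFind n k r ε⌋₊ + ⌊10 ^ 32 * lfhtSize n k ε⌋₊) := by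
  rw [twoStage_eq]
  exact (costLE_findStage hε hε1 hn hk hr hrk a₁).bind fun o _ =>
    costLE_finishStage hε hε1 hk a₁ o

end

/-! ### Searching for the smaller cluster size -/

section

variable {k n : ℕ} {ε : ℝ} {D : Fin k → PMF (Fin n)} {I : Finset (Fin k)}

/-- The slower of the two decays is `(1/2) ^ (2/3) = (1/4) ^ (1/3) ≤ (8/27) ^ (1/3)`. A ratio of at
most 2/3 bounds the geometric series by 3 times its largest term. -/
lemma costFind_two_mul_le {r : ℕ} : costFind n k (2 * r) ε ≤ 2 / 3 * costFind n k r ε := by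
  have hlog := Real.log_natCast_nonneg k
  have h1 : ((1 / 2 : ℝ)) ^ (2 / 3 : ℝ) ≤ 2 / 3 := by
    have h2 : ((1 / 2 : ℝ)) ^ (2 / 3 : ℝ) = ((1 / 4 : ℝ)) ^ (1 / 3 : ℝ) := by
      rw [show (1 / 4 : ℝ) = (1 / 2) ^ (2 : ℝ) by norm_num, ← Real.rpow_mul (by norm_num)]
      norm_num
    have h3 : (2 / 3 : ℝ) = (8 / 27 : ℝ) ^ (1 / 3 : ℝ) := by
      rw [show (8 / 27 : ℝ) = (2 / 3) ^ (3 : ℝ) by norm_num, ← Real.rpow_mul (by norm_num)]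
      norm_num
    rw [h2, h3]
    exact Real.rpow_le_rpow (by norm_num) (by norm_num) (by norm_num)
  have h2 : (n * k / ((2 * r : ℕ) * ε ^ 2) : ℝ) = 1 / 2 * (n * k / (r * ε ^ 2)) := by
    push_cast; ring
  have h3 : (k * √n / ((2 * r : ℕ) * ε ^ 2) : ℝ) = 1 / 2 * (k * √n / (r * ε ^ 2)) := by
    push_cast; ring
  unfold costFind
  rw [← mul_assoc, h2, h3, Real.mul_rpow (by norm_num) (by positivity)]
  refine mul_le_mul_of_nonneg_right (max_le ?_ ?_) hlog
  · exact mul_le_mul h1 (le_max_left _ _) (by positivity) (by norm_num)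
  · exact mul_le_mul (by norm_num) (le_max_right _ _) (by positivity) (by norm_num)

lemma costFind_le_two_mul {q r : ℕ} (hε : 0 < ε) (hq : 0 < q) (hr : 0 < r) (hrq : r ≤ 2 * q) :
    costFind n k q ε ≤ 2 * costFind n k r ε := by
  have hlog := Real.log_natCast_nonneg k
  have hq' : (0 : ℝ) < q := by exact_mod_cast hq
  have hr' : (0 : ℝ) < r := by exact_mod_cast hr
  have hrq' : (r : ℝ) ≤ 2 * q := by exact_mod_cast hrq
  have key : ∀ x : ℝ, 0 ≤ x → x / (q * ε ^ 2) ≤ 2 * (x / (r * ε ^ 2)) := fun x hx => by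
    rw [← mul_div_assoc, div_le_div_iff₀ (by positivity) (by positivity)]
    have := mul_le_mul_of_nonneg_left hrq' (show 0 ≤ x * ε ^ 2 by positivity)
    linarith
  have h1 : (2 : ℝ) ^ (2 / 3 : ℝ) ≤ 2 := by
    have h2 : (2 : ℝ) ^ (2 / 3 : ℝ) ≤ 2 ^ (1 : ℝ) :=
      Real.rpow_le_rpow_of_exponent_le (by norm_num) (by norm_num)
    rwa [Real.rpow_one] at h2
  unfold costFind
  rw [← mul_assoc]
  refine mul_le_mul_of_nonneg_right (max_le ?_ ?_) hlog
  · refine (Real.rpow_le_rpow (by positivity) (key _ (by positivity)) (by norm_num)).trans ?_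
    rw [Real.mul_rpow (by norm_num) (by positivity)]
    exact mul_le_mul h1 (le_max_left _ _) (by positivity) (by norm_num)
  · exact (key _ (by positivity)).trans
      (mul_le_mul_of_nonneg_left (le_max_right _ _) (by norm_num))

lemma sum_costFind_le (n k : ℕ) (ε : ℝ) {j L : ℕ} (h : j ≤ L) :
    ∑ i ∈ Finset.Ico j L, costFind n k (2 ^ i) ε ≤ 3 * costFind n k (2 ^ j) ε := by
  have key : ∑ i ∈ Finset.Ico j L, costFind n k (2 ^ i) ε + 3 * costFind n k (2 ^ L) ε ≤
      3 * costFind n k (2 ^ j) ε := by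
    induction L, h using Nat.le_induction with
    | base => simp
    | succ L hL ih =>
      rw [Finset.sum_Ico_succ_top hL, pow_succ']
      have := costFind_two_mul_le (n := n) (k := k) (ε := ε) (r := 2 ^ L)
      linarith
  have := costFind_nonneg n k (2 ^ L) ε
  linarith

/-- Run the first stage with the guesses `2 ^ (L - 1), …, 2, 1` of the smaller cluster size, until
a distribution that differs from that of `a₁` is found. -/
def search (n k : ℕ) (ε : ℝ) (a₁ : Fin k) : ℕ → SampleAlg k n (Option (Fin k))
  | 0 => .ret none
  | L + 1 => (findStage n k (2 ^ L) ε a₁).bind fun o =>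
    match o with
    | some j => .ret (some j)
    | none => search n k ε a₁ L

/-- With probability close to one, the search ends with success no later than at the guess that is
of the order of the smaller cluster size. -/
lemma pr_search_fail_le (hε : 0 < ε) (hε1 : ε ≤ 1) (hI : IsHiddenPartition ε D I) {a₁ : Fin k}
    (h₁ : a₁ ∈ I) {j₀ L : ℕ} (hj₀ : 2 ^ j₀ ≤ Iᶜ.card) (hL : j₀ + 1 ≤ L) (hLk : 2 ^ L ≤ 2 * k) :
    pr ((search n k ε a₁ L).run D)
        (fun p => ¬ ((∃ j ∈ Iᶜ, p.1 = some j) ∧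
          (p.2 : ℝ) ≤ 10 ^ 12 * ∑ i ∈ Finset.Ico j₀ L, costFind n k (2 ^ i) ε)) ≤
      0.265 + 2 ^ L / (27000 * k) := by
  have hn := hI.two_le_n hε
  have hk := hI.two_le_k
  have hcost : ∀ i, 2 ^ (i + 1) ≤ 2 * k → ∀ p ∈ ((findStage n k (2 ^ i) ε a₁).run D).support,
      (p.2 : ℝ) ≤ 10 ^ 12 * costFind n k (2 ^ i) ε := fun i hi p hp => by
    have h1 := costLE_findStage hε hε1 hn hk (show 0 < 2 ^ i by positivity)
      (by rw [pow_succ] at hi; omega) a₁ p hp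
    exact (Nat.cast_le.2 h1).trans
      (Nat.floor_le (mul_nonneg (by norm_num) (costFind_nonneg _ _ _ _)))
  induction L, hL using Nat.le_induction with
  | base =>
    rw [search, run_bind]
    have h := pr_findStage_fail_le (r := 2 ^ j₀) hε hε1 hn hI h₁ (by positivity) hj₀
    rw [pr_law] at h
    -- At the guess `2 ^ j₀` a miss counts as a failure, although smaller guesses might still
    -- succeed: their cost is not covered.
    refine (pr_bind_le (fun p => ¬ ∃ j ∈ Iᶜ, p.1 = some j) (c := 0) le_rfl fun p hp hG => ?_).trans
      ?_
    · rw [not_not] at hG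
      obtain ⟨j, hj, hpj⟩ := hG
      simp only [hpj, SampleAlg.run, PMF.pure_map]
      rw [pr_pure_of_not]
      simpa [Finset.mem_compl.1 hj] using hcost j₀ hLk p hp
    · have : (0 : ℝ) ≤ 2 ^ (j₀ + 1) / (27000 * k) := by positivity
      linarith
  | succ L hL ih =>
    have ih := ih (by rw [pow_succ] at hLk; omega)
    rw [search, run_bind, Finset.sum_Ico_succ_top (by omega)]
    have hS : 0 ≤ ∑ i ∈ Finset.Ico j₀ L, costFind n k (2 ^ i) ε :=
      Finset.sum_nonneg fun i _ => costFind_nonneg _ _ _ _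
    have h := pr_findStage_false_le (D := D) (r := 2 ^ L) (by positivity) hk ε a₁
    rw [pr_law] at h
    -- At a larger guess only a false discovery hurts: a true one ends the search early, and a miss
    -- passes to the next guess. The error terms `2 ^ L / (27000 k)` double from guess to guess and
    -- telescope.
    refine (pr_bind_le (fun p => ∃ j, p.1 = some j ∧ D j = D a₁)
      (c := 0.265 + 2 ^ L / (27000 * k)) (by positivity) fun p hp hG => ?_).trans ?_
    · have hc := hcost L hLk p hp
      rw [pr_map]
      rcases hp1 : p.1 with _ | j
      · refine le_trans (pr_mono fun q _ hq => ?_) ih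
        contrapose! hq
        refine ⟨hq.1, ?_⟩
        push_cast
        linarith [hq.2]
      · simp only [SampleAlg.run]
        rw [pr_pure_of_not]
        · positivity
        · rw [not_not]
          refine ⟨⟨j, ?_, rfl⟩, ?_⟩
          · rw [Finset.mem_compl]
            exact fun hj => hG ⟨j, hp1, hI.eq_of_mem j hj a₁ h₁⟩
          · push_cast
            linarith
    · push_cast at h
      rw [pow_succ]
      have : (2 : ℝ) ^ L * 2 / (27000 * k) = 2 ^ L / (27000 * k) + 2 ^ L / (27000 * k) := by ring
      linarith

/-- The two-stage algorithm for unknown smaller cluster size. -/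
def searchTwoStage (n k : ℕ) (ε : ℝ) : SampleAlg k n (Finset (Finset (Fin k))) :=
  if h : 0 < k then
    (search n k ε ⟨0, h⟩ (Nat.log 2 k + 1)).bind (finishStage ε ⟨0, h⟩)
  else .ret ∅

lemma pr_searchTwoStage_le {c : ℝ} (hc : 0 < c) (hε : 0 < ε) (hε1 : ε ≤ 1)
    (hI : IsHiddenPartition ε D I) :
    pr ((searchTwoStage n k ε).run D) (fun p => ¬ (p.1 = {I, Iᶜ} ∧
      SampleBound c (10 ^ 32 * max 1 (1 / c) ^ 2) n k (smallerSize I) ε p.2)) ≤ 1 / 3 := by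
  have hk := hI.two_le_k
  rw [searchTwoStage, dif_pos (show 0 < k by omega)]
  obtain ⟨I', hI', h₁, hpair, hsize⟩ := hI.wlog_mem ⟨0, by omega⟩
  rw [← hpair, ← hsize, run_bind]
  set r := smallerSize I'
  set a₁ : Fin k := ⟨0, by omega⟩
  have hr : 0 < r := hI'.smallerSize_pos
  have hr0 : 2 ^ Nat.log 2 r ≤ r := Nat.pow_log_le_self 2 hr.ne'
  have hr1 : r < 2 ^ (Nat.log 2 r + 1) := Nat.lt_pow_succ_log_self (by norm_num) r
  have hj₀ : Nat.log 2 r ≤ Nat.log 2 k := Nat.log_mono_right (smallerSize_le I')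
  have hk0 : 2 ^ Nat.log 2 k ≤ k := Nat.pow_log_le_self 2 (by omega)
  have hLk : 2 ^ (Nat.log 2 k + 1) ≤ 2 * k := by rw [pow_succ]; omega
  have h := pr_search_fail_le hε hε1 hI' h₁ (hr0.trans (min_le_right _ _))
    (show Nat.log 2 r + 1 ≤ Nat.log 2 k + 1 by omega) hLk
  -- A factor 3 comes from the geometric series and a factor 2 from rounding `r` down to a power of
  -- two.
  have hsum : ∑ i ∈ Finset.Ico (Nat.log 2 r) (Nat.log 2 k + 1), costFind n k (2 ^ i) ε ≤
      6 * costFind n k r ε := by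
    have h2 := sum_costFind_le n k ε (show Nat.log 2 r ≤ Nat.log 2 k + 1 by omega)
    have h3 := costFind_le_two_mul (n := n) (k := k) (q := 2 ^ Nat.log 2 r) hε (by positivity) hr
      (by rw [← pow_succ']; exact hr1.le)
    linarith
  refine (pr_bind_le _ (c := 1 / 100) (by norm_num) fun p _ hp => ?_).trans (add_le_add_left h _)
    |>.trans ?_
  · obtain ⟨hj, hp2⟩ := not_not.1 hp
    rw [pr_map]
    refine le_trans (pr_mono fun q hq hE => ?_)
      ((pr_law _ _).symm.trans_le (pr_finishStage_le hε hε1 hI' h₁ hj))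
    contrapose! hE
    refine ⟨hE, ?_⟩
    have hf := costFind_nonneg n k r ε
    have hq2 : (q.2 : ℝ) ≤ 10 ^ 32 * lfhtSize n k ε :=
      (Nat.cast_le.2 (costLE_finishStage hε hε1 hk a₁ p.1 q hq)).trans
        (Nat.floor_le (mul_nonneg (by norm_num) (lfhtSize_nonneg n k ε)))
    refine sampleBound_of_le hε hε1 hc (by norm_num) hf ?_
    push_cast
    linarith
  · have hk' : (0 : ℝ) < k := by exact_mod_cast (show 0 < k by omega)
    have hLk' : (2 : ℝ) ^ (Nat.log 2 k + 1) ≤ 2 * k := by exact_mod_cast hLk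
    have h2 : (2 : ℝ) ^ (Nat.log 2 k + 1) / (27000 * k) ≤ 1 / 13500 := by
      rw [div_le_div_iff₀ (by positivity) (by norm_num)]
      linarith
    norm_num at *
    linarith

end

end

end TwoClustering

theorem theoremC3 :
    -- The two-stage algorithm, which is told `r`: worst-case number of samples.
    (∃ (test : EquivalenceTest) (lfht : LFHTest) (C₁ C₂ : ℝ), 0 < C₁ ∧ 0 < C₂ ∧
      ∀ c : ℝ, 0 < c → ∃ C : ℝ, 0 < C ∧
        ∀ (n k r : ℕ) (ε : ℝ) (D : Fin k → PMF (Fin n)) (I : Finset (Fin k)) (a₁ : Fin k),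
          0 < ε → ε ≤ 1 → IsHiddenPartition ε D I → smallerSize I = r →
          2 / 3 ≤ (twoStage test lfht C₁ C₂ r ε a₁).prob D (fun out _ => out = {I, Iᶜ}) ∧
          ∀ p ∈ ((twoStage test lfht C₁ C₂ r ε a₁).run D).support,
            SampleBound c C n k r ε p.2) ∧
    -- An algorithm that is not told `r`, and takes no more samples up to constants.
    (∃ alg : ∀ n k : ℕ, ℝ → SampleAlg k n (Finset (Finset (Fin k))),
      ∀ c : ℝ, 0 < c → ∃ C : ℝ, 0 < C ∧
        ∀ (n k : ℕ) (ε : ℝ) (D : Fin k → PMF (Fin n)) (I : Finset (Fin k)),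
          0 < ε → ε ≤ 1 → IsHiddenPartition ε D I →
          2 / 3 ≤ (alg n k ε).prob D
            (fun out N => out = {I, Iᶜ} ∧ SampleBound c C n k (smallerSize I) ε N)) := by
  have hthird : (2 / 3 : ℝ≥0∞) = ENNReal.ofReal (2 / 3) := by
    rw [ENNReal.ofReal_div_of_pos (by norm_num)]
    norm_num
  constructor
  · refine ⟨equivTest, lfhtTest, findConst, lfhtConst, by unfold findConst; norm_num,
      by unfold lfhtConst; norm_num, fun c hc => ⟨10 ^ 32 * max 1 (1 / c) ^ 2, by positivity, ?_⟩⟩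
    intro n k r ε D I a₁ hε hε1 hI hr
    refine ⟨?_, fun p hp => ?_⟩
    · rw [hthird]
      refine ofReal_le_toOuterMeasure ?_
      have h := pr_twoStage_le hε hε1 hI hr a₁
      rw [pr_law] at h
      exact h.trans (by norm_num)
    · have hf := costFind_nonneg n k r ε
      have hp2 := costLE_twoStage hε hε1 (hI.two_le_n hε) hI.two_le_k
        (hr ▸ hI.smallerSize_pos) (hr ▸ smallerSize_le I) a₁ p hp
      have h1 : (⌊10 ^ 12 * costFind n k r ε⌋₊ : ℝ) ≤ 10 ^ 12 * costFind n k r ε :=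
        Nat.floor_le (by positivity)
      have h2 : (⌊10 ^ 32 * lfhtSize n k ε⌋₊ : ℝ) ≤ 10 ^ 32 * lfhtSize n k ε :=
        Nat.floor_le (mul_nonneg (by norm_num) (lfhtSize_nonneg n k ε))
      have h3 : (p.2 : ℝ) ≤ ⌊10 ^ 12 * costFind n k r ε⌋₊ + ⌊10 ^ 32 * lfhtSize n k ε⌋₊ := by
        exact_mod_cast hp2
      refine sampleBound_of_le hε hε1 hc (by norm_num) hf ?_
      linarith
  · refine ⟨searchTwoStage, fun c hc => ⟨10 ^ 32 * max 1 (1 / c) ^ 2, by positivity, ?_⟩⟩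
    intro n k ε D I hε hε1 hI
    rw [hthird]
    refine ofReal_le_toOuterMeasure ?_
    exact (pr_searchTwoStage_le hc hε hε1 hI).trans (by norm_num)
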